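/- Let $\mathbb K$ be a field of characteristic zero. For a $\mathbb Z$-graded $\mathbb K$-vector space $V=\bigoplus_i V^i$ let $S^c(V)=\bigoplus_{n\ge 0}V^{\odot n}$ be the graded symmetric coalgebra, with projection $p\colon S^c(V)\to V$. An $L_\infty[1]$ algebra $(V,Q)$ is a graded vector space $V$ with a degree $+1$ coderivation $Q$ of $S^c(V)$ such that $Q\circ Q=0$ and $p(Q(1))=0$; its Taylor coefficients are the restrictions $q_n\colon V^{\odot n}\to V$ of $p\circ Q$, its tangent complex is $(V,q_1)$, and $H^i(V,q_1)$ denotes the cohomology of the latter. An $L_\infty[1]$ morphism $F\colon(V,Q)\dashrightarrow(W,R)$ is a morphism of counital coaugmented DG coalgebras $(S^c(V),Q)\to(S^c(W),R)$; its linear part is $f_1=p\circ F|_V\colon (V,q_1)\to(W,r_1)$, and $F$ is a weak equivalence if $f_1$ is a quasi-isomorphism. Two $L_\infty[1]$ algebras are weakly equivalent if they are joined by a zigzag of weak equivalences. An $L_\infty[1]$ algebra is homotopy abelian if it is weakly equivalent to a graded vector space with zero codifferential. It is formal if there is a weak equivalence $(V,Q)\dashrightarrow (H(V,q_1),0,r_2,0,0,\dots)$,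 where $r_2([x],[y])=[q_2(x,y)]$. A minimal model of $(V,Q)$ is an $L_\infty[1]$ algebra $(H,R)$ with $r_1=0$ together with a weak equivalence $(H,R)\dashrightarrow(V,Q)$. If $H^0(V,q_1)$ is finite dimensional, the Kuranishi algebra of a minimal model $(H,R)$ of $(V,Q)$ is $\mathbb K[[x_1,\dots,x_n]]/I$, where $e_1,\dots,e_n$ is a basis of $H^0$ and $I$ is the ideal generated by the series \[ \sum_{J\in\mathbb N^n}\frac{\eta\bigl(r_{|J|}(e_1^{\odot j_1}\odot\cdots\odot e_n^{\odot j_n})\bigr)}{j_1!\cdots j_n!}\,x^J,\qquad \eta\in (H^1)^\vee .\] A $\mathbb K$-algebra is quadratic if it is isomorphic to $\mathbb K[[x_1,\dots,x_n]]/I$ for some $n$ and some ideal $I$ generated by homogeneous polynomials of degree two. Let $(V,Q)$ be an $L_\infty[1]$ algebra over $\mathbb K$ with $H^i(V,q_1)=0$ for every $i<0$, and assume that: 1. $H^0(V,q_1)$ and $H^1(V,q_1)$ are finite dimensional; 2. there is an $L_\infty[1]$ morphism $F\colon(V,Q)\dashrightarrow(W,R)$ to a homotopy abelian $L_\infty[1]$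 algebra $(W,R)$ such that $H^i(f_1)\colon H^i(V,q_1)\to H^i(W,r_1)$ is injective for every $i\ge 2$. Then $(V,Q)$ has a minimal model, and for every minimal model of $(V,Q)$ the following holds: $(V,Q)$ is formal if and only if the Kuranishi algebra of the minimal model is quadratic. -/

import Mathlib

open scoped DirectSum TensorProduct

noncomputable section

namespace LInf

universe u v w

/-! ### The symmetric coalgebra of a graded vector space -/

section SymmetricCoalgebra

variable (K : Type u) [Field K] (V : ℤ → Type v) [∀ i, AddCommGroup (V i)] [∀ i, Module K (V i)]

/-- The Koszul relations `v ⊙ w = (-1)^{|v||w|} w ⊙ v` for homogeneous `v`, `w`. -/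
inductive KoszulRel : TensorAlgebra K (⨁ i, V i) → TensorAlgebra K (⨁ i, V i) → Prop
  | comm (i j : ℤ) (v : V i) (w : V j) :
      KoszulRel
        (TensorAlgebra.ι K (DirectSum.lof K ℤ V i v) * TensorAlgebra.ι K (DirectSum.lof K ℤ V j w))
        ((i * j).negOnePow •
          (TensorAlgebra.ι K (DirectSum.lof K ℤ V j w) *
            TensorAlgebra.ι K (DirectSum.lof K ℤ V i v)))

/-- The underlying space `S(V) = ⨁ₙ V^{⊙ n}` of the symmetric coalgebra of the graded space
`V = ⨁ᵢ Vⁱ`; its product is the graded symmetric product `⊙`. -/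
def Sym : Type (max u v) := RingQuot (KoszulRel K V)

instance : Ring (Sym K V) := inferInstanceAs (Ring (RingQuot (KoszulRel K V)))

instance : Algebra K (Sym K V) := inferInstanceAs (Algebra K (RingQuot (KoszulRel K V)))

/-- The quotient map from the tensor algebra. -/
def mk : TensorAlgebra K (⨁ i, V i) →ₐ[K] Sym K V := RingQuot.mkAlgHom K (KoszulRel K V)

/-- The inclusion `V = V^{⊙ 1} → S(V)`. -/
def ι : (⨁ i, V i) →ₗ[K] Sym K V := (mk K V).toLinearMap ∘ₗ TensorAlgebra.ι K

/-- The inclusion of the elements of degree `i`. -/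
def gen (i : ℤ) : V i →ₗ[K] Sym K V := ι K V ∘ₗ DirectSum.lof K ℤ V i

variable {K V}

theorem gen_mul_gen (i j : ℤ) (v : V i) (w : V j) :
    gen K V i v * gen K V j w = (i * j).negOnePow • (gen K V j w * gen K V i v) := by
  have h := RingQuot.mkAlgHom_rel K (KoszulRel.comm (K := K) i j v w)
  rw [Units.smul_def, map_zsmul, map_mul, map_mul] at h
  rw [Units.smul_def]
  exact h

/-- The universal property of `S(V)` as graded commutative algebra. -/
def lift {A : Type*} [Ring A] [Algebra K A] (f : (⨁ i, V i) →ₗ[K] A)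
    (hf : ∀ (i j : ℤ) (v : V i) (w : V j),
      f (DirectSum.lof K ℤ V i v) * f (DirectSum.lof K ℤ V j w) =
        (i * j).negOnePow • (f (DirectSum.lof K ℤ V j w) * f (DirectSum.lof K ℤ V i v))) :
    Sym K V →ₐ[K] A :=
  RingQuot.liftAlgHom K ⟨TensorAlgebra.lift K f, by
    intro x y h
    induction h with
    | comm i j v w =>
      rw [Units.smul_def, map_zsmul, map_mul, map_mul]
      simp only [TensorAlgebra.lift_ι_apply]
      rw [hf i j v w, Units.smul_def]⟩

theorem lift_ι {A : Type*} [Ring A] [Algebra K A] (f : (⨁ i, V i) →ₗ[K] A) (hf) (x : ⨁ i, V i) :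
    lift f hf (ι K V x) = f x := by
  change RingQuot.liftAlgHom K _ (RingQuot.mkAlgHom K _ _) = _
  rw [RingQuot.liftAlgHom_mkAlgHom_apply]
  exact TensorAlgebra.lift_ι_apply f x

theorem lift_gen {A : Type*} [Ring A] [Algebra K A] (f : (⨁ i, V i) →ₗ[K] A) (hf) (i : ℤ)
    (x : V i) : lift f hf (gen K V i x) = f (DirectSum.lof K ℤ V i x) :=
  lift_ι f hf _

/-- Products of homogeneous elements of `V` span `S(V)`. -/
theorem sym_induction {P : Sym K V → Prop} (one : P 1) (add : ∀ x y, P x → P y → P (x + y))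
    (smul : ∀ (c : K) x, P x → P (c • x))
    (gen_mul : ∀ (i : ℤ) (v : V i) x, P x → P (gen K V i v * x)) (x : Sym K V) : P x := by
  have zero : P 0 := by simpa using smul 0 1 one
  have key : ∀ (t : TensorAlgebra K (⨁ i, V i)) (x : Sym K V), P x →
      P (mk K V t * x) := by
    intro t
    induction t using TensorAlgebra.induction with
    | algebraMap r =>
      intro x hx
      rw [AlgHom.commutes, ← Algebra.smul_def]
      exact smul r x hx
    | ι a =>
      intro x hx
      change P (ι K V a * x)
      induction a using DirectSum.induction_on with
      | zero => rw [map_zero, zero_mul]; exact zero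
      | of i a => exact gen_mul i a x hx
      | add a b ha hb => rw [map_add, add_mul]; exact add _ _ ha hb
    | mul a b ha hb =>
      intro x hx
      rw [map_mul]
      have := ha _ (hb x hx)
      rwa [← mul_assoc] at this
    | add a b ha hb =>
      intro x hx
      rw [map_add]
      have := add _ _ (ha x hx) (hb x hx)
      rwa [← add_mul] at this
  obtain ⟨t, rfl⟩ := RingQuot.mkAlgHom_surjective K (KoszulRel K V) x
  have := key t 1 one
  rwa [mul_one] at this

variable (K V)

/-- The part of degree `d` of `S(V)`, spanned by the products `v₁ ⊙ ⋯ ⊙ vₙ` of homogeneous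
elements with `|v₁| + ⋯ + |vₙ| = d`. -/
def degPart (d : ℤ) : Submodule K (Sym K V) :=
  Submodule.span K
    {x | ∃ l : List (Σ i, V i), (l.map Sigma.fst).sum = d ∧
      x = (l.map fun a => gen K V a.1 a.2).prod}

/-- The linear map `v ↦ (-1)^{k |v|} v` on `V`. -/
def signV (k : ℤ) : (⨁ i, V i) →ₗ[K] ⨁ i, V i :=
  DirectSum.toModule K ℤ _ fun i => (((k * i).negOnePow : ℤ) : K) • DirectSum.lof K ℤ V i

theorem signV_lof (k i : ℤ) (v : V i) :
    signV K V k (DirectSum.lof K ℤ V i v) = (k * i).negOnePow • DirectSum.lof K ℤ V i v := by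
  rw [signV, DirectSum.toModule_lof, LinearMap.smul_apply, Int.cast_smul_eq_zsmul, Units.smul_def]

/-- The algebra map `x ↦ (-1)^{k |x|} x` on `S(V)`. -/
def sign (k : ℤ) : Sym K V →ₐ[K] Sym K V :=
  lift (ι K V ∘ₗ signV K V k) (by
    intro i j v w
    have h := gen_mul_gen (K := K) i j v w
    simp only [LinearMap.comp_apply, signV_lof, Units.smul_def, map_zsmul, smul_mul_assoc,
      mul_smul_comm] at h ⊢
    change _ • _ • (gen K V i v * gen K V j w) = _ • _ • _ • (gen K V j w * gen K V i v)
    rw [h]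
    simp only [smul_smul]
    congr 1
    ring)

theorem sign_gen (k i : ℤ) (v : V i) :
    sign K V k (gen K V i v) = (k * i).negOnePow • gen K V i v := by
  rw [sign, lift_gen, LinearMap.comp_apply, signV_lof, Units.smul_def, map_zsmul, Units.smul_def]
  rfl

theorem sign_comm (k l : ℤ) (x : Sym K V) :
    sign K V k (sign K V l x) = sign K V l (sign K V k x) := by
  induction x using sym_induction with
  | one => simp only [map_one]
  | add x y hx hy => simp only [map_add, hx, hy]
  | smul c x hx => simp only [map_smul, hx]
  | gen_mul i v x hx =>
    simp only [map_mul, sign_gen, hx, Units.smul_def, map_zsmul, smul_mul_assoc]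
    rw [smul_comm]

/-- Left multiplication by `v ⊗ 1 + 1 ⊗ v` on the graded tensor product `S(V) ⊗ S(V)`: for `v`
homogeneous it sends `a ⊗ b` to `(v ⊙ a) ⊗ b + (-1)^{|v||a|} a ⊗ (v ⊙ b)`. -/
def comulAct : (⨁ i, V i) →ₗ[K] Module.End K (Sym K V ⊗[K] Sym K V) :=
  DirectSum.toModule K ℤ _ fun i =>
    (TensorProduct.mapBilinear (.id K) (Sym K V) (Sym K V) (Sym K V) (Sym K V)).flip LinearMap.id ∘ₗ
        (LinearMap.mul K (Sym K V)) ∘ₗ gen K V i +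
      TensorProduct.mapBilinear (.id K) (Sym K V) (Sym K V) (Sym K V) (Sym K V)
        (sign K V i).toLinearMap ∘ₗ (LinearMap.mul K (Sym K V)) ∘ₗ gen K V i

theorem comulAct_lof (i : ℤ) (v : V i) (a b : Sym K V) :
    comulAct K V (DirectSum.lof K ℤ V i v) (a ⊗ₜ b) =
      (gen K V i v * a) ⊗ₜ b + sign K V i a ⊗ₜ (gen K V i v * b) := by
  simp [comulAct]

/-- `S(V)` acting on `S(V) ⊗ S(V)` through the graded algebra map with `v ↦ v ⊗ 1 + 1 ⊗ v`. -/
def comulHom : Sym K V →ₐ[K] Module.End K (Sym K V ⊗[K] Sym K V) :=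
  lift (comulAct K V) (by
    intro i j v w
    have h := gen_mul_gen (K := K) i j v w
    have hc := sign_comm K V i j
    have hi := sign_gen K V i j w
    have hj := sign_gen K V j i v
    rw [mul_comm j i] at hj
    refine TensorProduct.ext' fun a b => ?_
    rcases Int.units_eq_one_or (i * j).negOnePow with e | e
    · rw [e, one_smul] at h hi hj ⊢
      simp only [Module.End.mul_apply, comulAct_lof, map_add, map_mul, ← mul_assoc, h, hi, hj, hc]
      abel
    · rw [e, Units.neg_smul, one_smul] at h hi hj ⊢
      simp only [Module.End.mul_apply, LinearMap.neg_apply, comulAct_lof, map_add, map_mul,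
        ← mul_assoc, h, hi, hj, hc, neg_mul, TensorProduct.neg_tmul, TensorProduct.tmul_neg]
      abel)

/-- The coproduct of `S(V)`: the map of graded algebras `S(V) → S(V) ⊗ S(V)` with
`Δ v = v ⊗ 1 + 1 ⊗ v` for `v ∈ V`. -/
def comul : Sym K V →ₗ[K] Sym K V ⊗[K] Sym K V :=
  LinearMap.applyₗ ((1 : Sym K V) ⊗ₜ[K] (1 : Sym K V)) ∘ₗ (comulHom K V).toLinearMap

/-- `S(V)` acting on `K ⊕ V = S(V) / ⨁_{n ≥ 2} V^{⊙ n}` by multiplication. -/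
def truncHom : Sym K V →ₐ[K] Module.End K (K × ⨁ i, V i) :=
  lift
    { toFun := fun v => LinearMap.inr K K _ ∘ₗ LinearMap.toSpanSingleton K _ v ∘ₗ LinearMap.fst K K _
      map_add' := fun v w => by ext <;> simp
      map_smul' := fun c v => by ext <;> simp }
    (by
      intro i j v w
      rcases Int.units_eq_one_or (i * j).negOnePow with e | e <;> rw [e] <;> ext <;> simp)

/-- The counit `S(V) → V^{⊙ 0} = K`. -/
def counit : Sym K V →ₗ[K] K :=
  LinearMap.fst K K _ ∘ₗ LinearMap.applyₗ (1, 0) ∘ₗ (truncHom K V).toLinearMap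

/-- The natural projection `p : S(V) → V^{⊙ 1} = V`. -/
def proj : Sym K V →ₗ[K] ⨁ i, V i :=
  LinearMap.snd K K _ ∘ₗ LinearMap.applyₗ (1, 0) ∘ₗ (truncHom K V).toLinearMap

variable {K V}

theorem counit_one : counit K V 1 = 1 := by simp [counit]

theorem proj_one : proj K V 1 = 0 := by simp [proj]

theorem trunc_gen_mul (i : ℤ) (v : V i) (x : Sym K V) :
    truncHom K V (gen K V i v * x) (1, 0) = (0, counit K V x • DirectSum.lof K ℤ V i v) := by
  rw [map_mul, truncHom, lift_gen]
  simp [counit, truncHom]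

theorem counit_gen_mul (i : ℤ) (v : V i) (x : Sym K V) : counit K V (gen K V i v * x) = 0 := by
  change (truncHom K V (gen K V i v * x) (1, 0)).1 = 0
  rw [trunc_gen_mul]

theorem proj_gen_mul (i : ℤ) (v : V i) (x : Sym K V) :
    proj K V (gen K V i v * x) = counit K V x • DirectSum.lof K ℤ V i v := by
  change (truncHom K V (gen K V i v * x) (1, 0)).2 = _
  rw [trunc_gen_mul]

theorem proj_gen (i : ℤ) (v : V i) : proj K V (gen K V i v) = DirectSum.lof K ℤ V i v := by
  have h := proj_gen_mul i v (1 : Sym K V)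
  rwa [mul_one, counit_one, one_smul] at h

theorem proj_ι (x : ⨁ i, V i) : proj K V (ι K V x) = x := by
  have h : proj K V ∘ₗ ι K V = LinearMap.id := by
    refine DirectSum.linearMap_ext K fun i => LinearMap.ext fun v => ?_
    exact proj_gen i v
  exact LinearMap.congr_fun h x

theorem comul_one : comul K V 1 = 1 ⊗ₜ 1 := by simp [comul]

theorem comul_gen_mul (i : ℤ) (v : V i) (x : Sym K V) :
    comul K V (gen K V i v * x) =
      comulAct K V (DirectSum.lof K ℤ V i v) (comul K V x) := by
  change comulHom K V (gen K V i v * x) (1 ⊗ₜ 1) = _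
  rw [map_mul, comulHom, lift_gen]
  rfl

theorem comul_ι (x : ⨁ i, V i) : comul K V (ι K V x) = ι K V x ⊗ₜ 1 + 1 ⊗ₜ ι K V x := by
  induction x using DirectSum.induction_on with
  | zero => simp
  | of i v =>
    have h := comul_gen_mul i v (1 : Sym K V)
    rw [comul_one, comulAct_lof, mul_one, map_one] at h
    exact h
  | add x y hx hy =>
    simp only [map_add, hx, hy, TensorProduct.add_tmul, TensorProduct.tmul_add]
    abel

theorem counit_sign (k : ℤ) (x : Sym K V) : counit K V (sign K V k x) = counit K V x := by
  induction x using sym_induction with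
  | one => rw [map_one]
  | add x y hx hy => simp only [map_add, hx, hy]
  | smul c x hx => simp only [map_smul, hx]
  | gen_mul j w x hx =>
    rw [map_mul, sign_gen, counit_gen_mul, Units.smul_def, smul_mul_assoc, map_zsmul,
      counit_gen_mul, smul_zero]

theorem counit_comul (x : Sym K V) :
    TensorProduct.lid K (Sym K V) (TensorProduct.map (counit K V) LinearMap.id (comul K V x)) =
      x := by
  induction x using sym_induction with
  | one => simp [comul_one, counit_one]
  | add x y hx hy => simp only [map_add, hx, hy]
  | smul c x hx => simp only [map_smul, hx]
  | gen_mul i v x hx =>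
    have key : ∀ t : Sym K V ⊗[K] Sym K V,
        TensorProduct.lid K (Sym K V) (TensorProduct.map (counit K V) LinearMap.id
          (comulAct K V (DirectSum.lof K ℤ V i v) t)) =
        gen K V i v * TensorProduct.lid K (Sym K V)
          (TensorProduct.map (counit K V) LinearMap.id t) := by
      intro t
      induction t using TensorProduct.induction_on with
      | zero => simp
      | add s t hs ht => simp only [map_add, hs, ht, mul_add]
      | tmul a b =>
        simp [comulAct_lof, counit_gen_mul, counit_sign]
    rw [comul_gen_mul, key, hx]

/-- The Euler operator, which is multiplication by `n` on `V^{⊙ n}`. -/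
def euler : Sym K V →ₗ[K] Sym K V :=
  LinearMap.mul' K (Sym K V) ∘ₗ TensorProduct.map (ι K V ∘ₗ proj K V) LinearMap.id ∘ₗ comul K V

theorem proj_sign (k : ℤ) (x : Sym K V) : proj K V (sign K V k x) = signV K V k (proj K V x) := by
  induction x using sym_induction with
  | one => simp [proj_one]
  | add x y hx hy => simp only [map_add, hx, hy]
  | smul c x hx => simp only [map_smul, hx]
  | gen_mul j w x hx =>
    rw [map_mul, sign_gen, proj_gen_mul, Units.smul_def, smul_mul_assoc, map_zsmul,
      proj_gen_mul, counit_sign, map_smul, signV_lof, Units.smul_def, smul_comm]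

theorem signV_comm (i : ℤ) (v : V i) (x : ⨁ i, V i) :
    ι K V (signV K V i x) * gen K V i v = gen K V i v * ι K V x := by
  induction x using DirectSum.induction_on with
  | zero => simp
  | of j w =>
    change ι K V (signV K V i (DirectSum.lof K ℤ V j w)) * _ = _ * gen K V j w
    rw [signV_lof, Units.smul_def, map_zsmul, gen_mul_gen, Units.smul_def, smul_mul_assoc]
    rfl
  | add x y hx hy => simp only [map_add, add_mul, mul_add, hx, hy]

theorem euler_gen_mul (i : ℤ) (v : V i) (x : Sym K V) :
    euler (gen K V i v * x) = gen K V i v * x + gen K V i v * euler x := by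
  have key : ∀ t : Sym K V ⊗[K] Sym K V,
      LinearMap.mul' K (Sym K V) (TensorProduct.map (ι K V ∘ₗ proj K V) LinearMap.id
        (comulAct K V (DirectSum.lof K ℤ V i v) t)) =
      gen K V i v * TensorProduct.lid K (Sym K V)
        (TensorProduct.map (counit K V) LinearMap.id t) +
      gen K V i v * LinearMap.mul' K (Sym K V)
        (TensorProduct.map (ι K V ∘ₗ proj K V) LinearMap.id t) := by
    intro t
    induction t using TensorProduct.induction_on with
    | zero => simp
    | add s t hs ht =>
      simp only [map_add, hs, ht, mul_add]
      abel
    | tmul a b =>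
      simp only [comulAct_lof, map_add, TensorProduct.map_tmul, LinearMap.comp_apply,
        proj_gen_mul, proj_sign, LinearMap.id_apply, LinearMap.mul'_apply, ← mul_assoc,
        signV_comm, TensorProduct.lid_tmul, map_smul, smul_mul_assoc, mul_smul_comm]
      rfl
  change LinearMap.mul' K (Sym K V) (TensorProduct.map (ι K V ∘ₗ proj K V) LinearMap.id
    (comul K V (gen K V i v * x))) = _
  rw [comul_gen_mul, key, counit_comul]
  rfl

/-- The algebra map `x ↦ x tⁿ` for `x ∈ V^{⊙ n}`. -/
def weight : Sym K V →ₐ[K] Polynomial (Sym K V) :=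
  lift
    { toFun := fun v => Polynomial.monomial 1 (ι K V v)
      map_add' := fun v w => by simp
      map_smul' := fun c v => by
        rw [map_smul, RingHom.id_apply, Polynomial.smul_monomial] }
    (by
      intro i j v w
      have h := gen_mul_gen (K := K) i j v w
      rw [Units.smul_def] at h ⊢
      simp only [LinearMap.coe_mk, AddHom.coe_mk, Polynomial.monomial_mul_monomial,
        ← map_zsmul]
      exact congrArg _ h)

theorem weight_gen_mul (i : ℤ) (v : V i) (x : Sym K V) :
    weight (gen K V i v * x) = Polynomial.monomial 1 (gen K V i v) * weight x := by
  rw [map_mul]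
  congr 1
  exact lift_gen _ _ i v

theorem weight_coeff_zero (x : Sym K V) :
    (weight x).coeff 0 = algebraMap K (Sym K V) (counit K V x) := by
  induction x using sym_induction with
  | one => simp [counit_one]
  | add x y hx hy => simp only [map_add, hx, hy, Polynomial.coeff_add]
  | smul c x hx =>
    rw [map_smul, map_smul, Polynomial.coeff_smul, hx, Algebra.smul_def, smul_eq_mul, map_mul]
  | gen_mul i v x hx =>
    rw [weight_gen_mul, counit_gen_mul, Polynomial.mul_coeff_zero]
    simp [Polynomial.coeff_monomial]

theorem weight_injective : Function.Injective (weight (K := K) (V := V)) := by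
  let e : Polynomial (Sym K V) →ₐ[K] Sym K V :=
    Polynomial.eval₂AlgHom (AlgHom.id K (Sym K V)) 1 fun a => Commute.one_right a
  refine Function.LeftInverse.injective (g := e) fun x => ?_
  induction x using sym_induction with
  | one => simp only [map_one]
  | add x y hx hy => simp only [map_add, hx, hy]
  | smul c x hx => simp only [map_smul, hx]
  | gen_mul i v x hx =>
    rw [weight_gen_mul, map_mul, hx]
    congr 1
    change Polynomial.eval₂ _ _ _ = _
    rw [Polynomial.eval₂_monomial, one_pow, mul_one]
    rfl

theorem weight_euler (x : Sym K V) (n : ℕ) :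
    (weight (euler x)).coeff n = (n : K) • (weight x).coeff n := by
  induction x using sym_induction generalizing n with
  | one =>
    have : euler (1 : Sym K V) = 0 := by simp [euler, comul_one, proj_one]
    rw [this, map_zero, map_one, Polynomial.coeff_one]
    split_ifs with h
    · simp [h]
    · simp
  | add x y hx hy => simp only [map_add, Polynomial.coeff_add, hx, hy, smul_add]
  | smul c x hx => simp only [map_smul, Polynomial.coeff_smul, hx, smul_comm c]
  | gen_mul i v x hx =>
    rw [euler_gen_mul, map_add, weight_gen_mul, weight_gen_mul, Polynomial.coeff_add]
    cases n with
    | zero => simp [Polynomial.mul_coeff_zero, Polynomial.coeff_monomial]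
    | succ n =>
      rw [Polynomial.coeff_monomial_mul, Polynomial.coeff_monomial_mul, hx]
      push_cast
      rw [add_smul, one_smul, mul_smul_comm, add_comm]

/-- In characteristic zero the primitive elements of `S(V)` are the elements of `V`. -/
theorem eq_ι_of_primitive [CharZero K] (x : Sym K V) (hx : comul K V x = x ⊗ₜ 1 + 1 ⊗ₜ x) :
    x = ι K V (proj K V x) := by
  have hc : counit K V x = 0 := by
    have h := congrArg (counit K V) (counit_comul x)
    rw [hx] at h
    simpa [counit_one] using h
  have he : euler x = ι K V (proj K V x) := by
    simp [euler, hx, proj_one]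
  have hw : ∀ n, n ≠ 1 → (weight (ι K V (proj K V x))).coeff n = 0 := by
    intro n hn
    rw [weight, lift_ι]
    simp [Polynomial.coeff_monomial, hn.symm]
  refine weight_injective (Polynomial.ext fun n => ?_)
  have h := weight_euler x n
  rw [he] at h
  rcases eq_or_ne n 1 with rfl | hn
  · rw [h]; simp
  · rw [hw n hn] at h ⊢
    rcases Nat.eq_zero_or_pos n with rfl | hn0
    · rw [weight_coeff_zero, hc, map_zero]
    · have hn1 : (n : K) ≠ 0 := by exact_mod_cast hn0.ne'
      exact (smul_eq_zero.mp h.symm).resolve_left hn1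

theorem proj_mem_of_mem_degPart (d : ℤ) (x : Sym K V) (hx : x ∈ degPart K V d) :
    proj K V x ∈ LinearMap.range (DirectSum.lof K ℤ V d) := by
  refine Submodule.span_induction (p := fun x _ =>
    proj K V x ∈ LinearMap.range (DirectSum.lof K ℤ V d)) ?_ ?_ ?_ ?_ hx
  · rintro _ ⟨l, hl, rfl⟩
    match l, hl with
    | [], _ => simp [proj_one]
    | [a], hl =>
      obtain rfl : a.1 = d := by simpa using hl
      exact ⟨a.2, by simp [proj_gen]⟩
    | a :: b :: l, _ => simp [proj_gen_mul, counit_gen_mul]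
  · simp
  · intro x y _ _ hx hy
    rw [map_add]
    exact add_mem hx hy
  · intro c x _ hx
    rw [map_smul]
    exact Submodule.smul_mem _ _ hx

theorem gen_mem_degPart (i : ℤ) (v : V i) : gen K V i v ∈ degPart K V i :=
  Submodule.subset_span ⟨[⟨i, v⟩], by simp, by simp⟩

end SymmetricCoalgebra

/-! ### `L∞[1]` algebras and their morphisms -/

/-- An `L∞[1]` algebra structure on the graded vector space `V`: a coderivation `Q` of degree `1`
of the symmetric coalgebra, with vanishing constant part and `Q ∘ Q = 0`. The Koszul sign in
`(id ⊗ Q) (a ⊗ b) = (-1)^{|a|} a ⊗ Q b` is carried by `sign K V 1`. -/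
structure Alg (K : Type u) [Field K] (V : ℤ → Type v) [∀ i, AddCommGroup (V i)]
    [∀ i, Module K (V i)] where
  /-- the codifferential -/
  Q : Sym K V →ₗ[K] Sym K V
  degree_one : ∀ d, ∀ x ∈ degPart K V d, Q x ∈ degPart K V (d + 1)
  coderivation : comul K V ∘ₗ Q =
    (TensorProduct.map Q LinearMap.id + TensorProduct.map (sign K V 1).toLinearMap Q) ∘ₗ comul K V
  constant_part : proj K V (Q 1) = 0
  square_zero : Q ∘ₗ Q = 0

section Algebras

variable {K : Type u} [Field K]
variable {V : ℤ → Type v} [∀ i, AddCommGroup (V i)] [∀ i, Module K (V i)]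
variable {W : ℤ → Type w} [∀ i, AddCommGroup (W i)] [∀ i, Module K (W i)]

namespace Alg

/-- The Taylor coefficients `qₙ(v₁, …, vₙ) = p (Q (v₁ ⊙ ⋯ ⊙ vₙ))`. -/
def taylor (A : Alg K V) (l : List (⨁ i, V i)) : ⨁ i, V i :=
  proj K V (A.Q (l.map (ι K V)).prod)

/-- The linear part `q₁`, the differential of the tangent complex. -/
def d (A : Alg K V) : (⨁ i, V i) →ₗ[K] ⨁ i, V i := proj K V ∘ₗ A.Q ∘ₗ ι K V

/-- An `L∞[1]` algebra is minimal if `q₁ = 0`. -/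
def IsMinimal (A : Alg K V) : Prop := A.d = 0

/-- The cocycles `Zⁱ(V, q₁)`. -/
def cocycles (A : Alg K V) (i : ℤ) : Submodule K (V i) :=
  LinearMap.ker (A.d ∘ₗ DirectSum.lof K ℤ V i)

/-- The coboundaries `Bⁱ(V, q₁)`. -/
def coboundaries (A : Alg K V) (i : ℤ) : Submodule K (V i) :=
  (LinearMap.range A.d).comap (DirectSum.lof K ℤ V i)

/-- The tangent cohomology `Hⁱ(V, q₁)`. -/
abbrev H (A : Alg K V) (i : ℤ) : Type v :=
  A.cocycles i ⧸ (A.coboundaries i).submoduleOf (A.cocycles i)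

/-- The cohomology class of a cocycle. -/
def cls (A : Alg K V) (i : ℤ) : A.cocycles i →ₗ[K] A.H i := Submodule.mkQ _

theorem Q_one [CharZero K] (A : Alg K V) : A.Q 1 = 0 := by
  have h := LinearMap.congr_fun A.coderivation 1
  simp only [LinearMap.comp_apply, comul_one, LinearMap.add_apply, TensorProduct.map_tmul,
    LinearMap.id_apply, AlgHom.toLinearMap_apply, map_one] at h
  rw [eq_ι_of_primitive _ h, A.constant_part, map_zero]

theorem Q_ι [CharZero K] (A : Alg K V) (x : ⨁ i, V i) : A.Q (ι K V x) = ι K V (A.d x) := by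
  refine eq_ι_of_primitive _ ?_
  have h := LinearMap.congr_fun A.coderivation (ι K V x)
  simpa [comul_ι, Q_one] using h

variable (K V) in
/-- A graded vector space, as an `L∞[1]` algebra with trivial structure. -/
def trivial : Alg K V where
  Q := 0
  degree_one _ _ _ := Submodule.zero_mem _
  coderivation := by simp
  constant_part := by simp
  square_zero := by simp

end Alg

/-- An `L∞[1]` morphism `(V, Q) ⇢ (W, R)`: a morphism of counital coaugmented DG coalgebras
`S(V) → S(W)`. -/
structure Hom (A : Alg K V) (B : Alg K W) where
  /-- the map of coalgebras -/
  F : Sym K V →ₗ[K] Sym K W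
  degree_zero : ∀ d, ∀ x ∈ degPart K V d, F x ∈ degPart K W d
  map_comul : comul K W ∘ₗ F = TensorProduct.map F F ∘ₗ comul K V
  map_counit : counit K W ∘ₗ F = counit K V
  map_unit : F 1 = 1
  map_Q : F ∘ₗ A.Q = B.Q ∘ₗ F

namespace Hom

variable {A : Alg K V} {B : Alg K W}

/-- The linear part `f₁`. -/
def f₁ (F : Hom A B) : (⨁ i, V i) →ₗ[K] ⨁ i, W i := proj K W ∘ₗ F.F ∘ₗ ι K V

/-- The linear part in degree `i`. -/
def f₁Deg (F : Hom A B) (i : ℤ) : V i →ₗ[K] W i :=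
  DirectSum.component K ℤ W i ∘ₗ F.f₁ ∘ₗ DirectSum.lof K ℤ V i

theorem f₁_lof (F : Hom A B) (i : ℤ) (v : V i) :
    F.f₁ (DirectSum.lof K ℤ V i v) = DirectSum.lof K ℤ W i (F.f₁Deg i v) := by
  obtain ⟨w, hw⟩ := proj_mem_of_mem_degPart i _ (F.degree_zero i _ (gen_mem_degPart i v))
  have h : F.f₁ (DirectSum.lof K ℤ V i v) = DirectSum.lof K ℤ W i w := hw.symm
  rw [f₁Deg, LinearMap.comp_apply, LinearMap.comp_apply, h, DirectSum.component.lof_self]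

theorem F_ι [CharZero K] (F : Hom A B) (x : ⨁ i, V i) : F.F (ι K V x) = ι K W (F.f₁ x) := by
  refine eq_ι_of_primitive _ ?_
  have h := LinearMap.congr_fun F.map_comul (ι K V x)
  simpa [comul_ι, F.map_unit] using h

/-- The linear part is a morphism of complexes. -/
theorem f₁_d [CharZero K] (F : Hom A B) (x : ⨁ i, V i) : F.f₁ (A.d x) = B.d (F.f₁ x) := by
  have h := LinearMap.congr_fun F.map_Q (ι K V x)
  simp only [LinearMap.comp_apply, Alg.Q_ι, F_ι] at h
  simpa [proj_ι] using congrArg (proj K W) h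

theorem f₁Deg_mem_cocycles [CharZero K] (F : Hom A B) (i : ℤ) (x : V i) (hx : x ∈ A.cocycles i) :
    F.f₁Deg i x ∈ B.cocycles i := by
  change A.d _ = 0 at hx
  change B.d _ = 0
  rw [← f₁_lof, ← f₁_d, hx, map_zero]

theorem f₁Deg_mem_coboundaries [CharZero K] (F : Hom A B) (i : ℤ) (x : V i)
    (hx : x ∈ A.coboundaries i) : F.f₁Deg i x ∈ B.coboundaries i := by
  obtain ⟨y, hy⟩ := hx
  exact ⟨F.f₁ y, by rw [← f₁_lof, ← f₁_d, hy]⟩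

/-- The linear part on cocycles. -/
def mapCocycles [CharZero K] (F : Hom A B) (i : ℤ) : A.cocycles i →ₗ[K] B.cocycles i :=
  (F.f₁Deg i).restrict (F.f₁Deg_mem_cocycles i)

/-- The map `Hⁱ(V, q₁) → Hⁱ(W, r₁)` induced by the linear part. -/
def mapH [CharZero K] (F : Hom A B) (i : ℤ) : A.H i →ₗ[K] B.H i :=
  Submodule.mapQ _ _ (F.mapCocycles i) fun x hx => F.f₁Deg_mem_coboundaries i x hx

/-- `F` is a weak equivalence if its linear part is a quasi-isomorphism. -/
def IsWeakEquiv [CharZero K] (F : Hom A B) : Prop := ∀ i, Function.Bijective (F.mapH i)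

end Hom

end Algebras

/-! ### Homotopy abelian and formal algebras -/

/-- A graded vector space together with an `L∞[1]` structure. -/
structure Obj (K : Type u) [Field K] where
  /-- the graded pieces -/
  V : ℤ → Type v
  [addCommGroup : ∀ i, AddCommGroup (V i)]
  [module : ∀ i, Module K (V i)]
  /-- the structure -/
  alg : Alg K V

attribute [instance] Obj.addCommGroup Obj.module

/-- Weak equivalence of `L∞[1]` algebras: the equivalence relation generated by the existence of a
weak equivalence. -/
def WeaklyEquivalent {K : Type u} [Field K] [CharZero K] (A B : Obj.{u, v} K) : Prop :=
  Relation.EqvGen (fun A B : Obj.{u, v} K => ∃ F : Hom A.alg B.alg, F.IsWeakEquiv) A B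

namespace Alg

variable {K : Type u} [Field K] [CharZero K]
variable {V : ℤ → Type v} [∀ i, AddCommGroup (V i)] [∀ i, Module K (V i)]

/-- An `L∞[1]` algebra is homotopy abelian if it is weakly equivalent to a graded vector space
with trivial structure. -/
def IsHomotopyAbelian (A : Alg K V) : Prop :=
  ∃ (U : ℤ → Type v) (_ : ∀ i, AddCommGroup (U i)) (_ : ∀ i, Module K (U i)),
    WeaklyEquivalent (⟨V, A⟩ : Obj.{u, v} K) ⟨U, trivial K U⟩

/-- `B` is the `L∞[1]` structure `(0, r₂, 0, 0, …)` on the cohomology `H(V, q₁)`, where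
`r₂([x], [y]) = [q₂(x, y)]` is the induced quadratic bracket. -/
structure IsCohomologyBracket (A : Alg K V) (B : Alg K A.H) : Prop where
  taylor_eq_zero : ∀ l : List (⨁ i, A.H i), l.length ≠ 2 → B.taylor l = 0
  taylor_two : ∀ (i j : ℤ) (x : A.cocycles i) (y : A.cocycles j),
    ∃ z : A.cocycles (i + j + 1),
      DirectSum.lof K ℤ V (i + j + 1) z =
          A.taylor [DirectSum.lof K ℤ V i x, DirectSum.lof K ℤ V j y] ∧
        B.taylor [DirectSum.lof K ℤ A.H i (A.cls i x), DirectSum.lof K ℤ A.H j (A.cls j y)] =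
          DirectSum.lof K ℤ A.H (i + j + 1) (A.cls (i + j + 1) z)

/-- An `L∞[1]` algebra is formal if there is a weak equivalence `(V, Q) ⇢ (H(V, q₁), r₂)`. -/
def IsFormal (A : Alg K V) : Prop :=
  ∃ B : Alg K A.H, A.IsCohomologyBracket B ∧ ∃ F : Hom A B, F.IsWeakEquiv

end Alg

/-! ### Minimal models and the Kuranishi algebra -/

/-- A minimal model of `(V, Q)`: a minimal `L∞[1]` algebra `(W, R)` with a weak equivalence
`(W, R) ⇢ (V, Q)`. -/
structure MinimalModel {K : Type u} [Field K] [CharZero K] {V : ℤ → Type v}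
    [∀ i, AddCommGroup (V i)] [∀ i, Module K (V i)] (A : Alg K V) extends Obj.{u, v} K where
  isMinimal : alg.IsMinimal
  /-- the weak equivalence -/
  hom : Hom alg A
  isWeakEquiv : hom.IsWeakEquiv

section Kuranishi

variable {K : Type u} [Field K] {W : ℤ → Type v} [∀ i, AddCommGroup (W i)] [∀ i, Module K (W i)]

/-- For `η ∈ (W¹)^∨` and a basis `e₁, …, eₙ` of `W⁰`, the formal power series
`∑_I η(r_{|I|}(e^{⊙ I})) / I! x^I`, the image of `η` under the transpose of the Taylor coefficients
`(W⁰)^{⊙ k} → W¹`. -/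
def kuranishiSeries (B : Alg K W) {n : ℕ} (e : Module.Basis (Fin n) K (W 0))
    (η : Module.Dual K (W 1)) : MvPowerSeries (Fin n) K := fun I =>
  (∏ i, ((I i).factorial : K))⁻¹ *
    η (DirectSum.component K ℤ W 1 (B.taylor ((List.finRange n).flatMap fun i =>
      List.replicate (I i) (DirectSum.lof K ℤ W 0 (e i)))))

/-- The ideal of `K[[x₁, …, xₙ]]` generated by the image of `(W¹)^∨`. -/
def kuranishiIdeal (B : Alg K W) {n : ℕ} (e : Module.Basis (Fin n) K (W 0)) :
    Ideal (MvPowerSeries (Fin n) K) :=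
  Ideal.span (Set.range (kuranishiSeries B e))

end Kuranishi

/-- A `K`-algebra is quadratic if it is isomorphic to `K[[x₁, …, xₙ]] / I` with `I` generated by
homogeneous polynomials of degree two. -/
def IsQuadraticAlgebra (K : Type u) [Field K] (R : Type w) [CommRing R] [Algebra K R] : Prop :=
  ∃ (n : ℕ) (S : Set (MvPolynomial (Fin n) K)), (∀ p ∈ S, p.IsHomogeneous 2) ∧
    Nonempty (R ≃ₐ[K] MvPowerSeries (Fin n) K ⧸
      Ideal.span ((fun p : MvPolynomial (Fin n) K => (p : MvPowerSeries (Fin n) K)) '' S))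

namespace MinimalModel

variable {K : Type u} [Field K] [CharZero K]
variable {V : ℤ → Type v} [∀ i, AddCommGroup (V i)] [∀ i, Module K (V i)] {A : Alg K V}

instance finite_zero (M : MinimalModel A) [Module.Finite K (A.H 0)] : Module.Finite K (M.V 0) := by
  have hd : M.alg.d = 0 := M.isMinimal
  have hz : ∀ x : M.V 0, x ∈ M.alg.cocycles 0 := fun x => by simp [Alg.cocycles, hd]
  refine Module.Finite.of_injective
    (M.hom.mapH 0 ∘ₗ M.alg.cls 0 ∘ₗ LinearMap.id.codRestrict (M.alg.cocycles 0) hz) ?_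
  rw [LinearMap.coe_comp]
  refine (M.isWeakEquiv 0).injective.comp ?_
  refine (injective_iff_map_eq_zero _).mpr fun x hx => ?_
  obtain ⟨y, hy⟩ := (Submodule.Quotient.mk_eq_zero _).mp hx
  rw [hd] at hy
  exact (DirectSum.of_injective (β := M.V) 0) (by rw [map_zero]; exact hy.symm)

/-- The Kuranishi algebra `K[[x₁, …, xₙ]] / I` of a minimal model, `n = dim H⁰`. -/
abbrev KuranishiAlgebra (M : MinimalModel A) [Module.Finite K (A.H 0)] : Type u :=
  MvPowerSeries (Fin (Module.finrank K (M.V 0))) K ⧸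
    kuranishiIdeal M.alg (Module.finBasis K (M.V 0))

end MinimalModel

end LInf

end

/-! Coalgebra morphisms between symmetric coalgebras act as formal coordinate changes. A map p ∘ F
with bijective linear part can be prescribed freely (`cofree`, the convolution exponential), the
resulting morphism is invertible (`IsCoalgHom.exists_inverse`), and a codifferential is transported
along it (`Alg.exists_transport`). The underlying existence and uniqueness statements come from the
Euler operator E, which multiplies V^{⊙ n} by n. Coalgebra morphisms satisfy E F = (pF) * F,
coderivations satisfy similar equations, and in characteristic zero these are solved weight by
weight.

Reduction to minimal models: a contraction h of the tangent complex gives coordinates in which the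
contractible directions are linear, so that the harmonic part is a subalgebra
(`Alg.exists_minimalModel`). A retraction onto it is the projection along the image of [Q, h]
(`Alg.exists_retraction`). Weak equivalences can therefore be reversed, and a homotopy abelian
algebra has a single weak equivalence to a trivial one.

Formal implies quadratic: the dual of the degree-zero part of S(V) is K[[x]], and the Kuranishi
ideal is generated by linear forms l ∘ Q, so isomorphic minimal algebras have isomorphic Kuranishi
algebras (`Hom.nonempty_kuranishi_equiv`). A minimal model of a formal algebra is isomorphic to the
cohomology with its bracket, whose Kuranishi series are quadratic forms.

Quadratic implies formal: a morphism to a trivial algebra that is injective in degrees at least two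
gives coordinates in which no Taylor coefficient has values in those degrees
(`Alg.IsMinimal.exists_truncated`). Since nothing lives in negative degrees, only the maps (H⁰)^{⊙
n} → H¹ survive: the structure is the vector κ of Kuranishi series. If K[[x]]/(κ) is quadratic, then
(1 - B) κ = q(a) for a coordinate change a, a matrix B vanishing at the origin and quadratic forms q
(`exists_quadratic_normal_form`). Taking a as coordinates on H⁰ and 1 - B as change of frame on H¹
leaves only a quadratic coefficient (`Alg.IsMinimal.exists_quadratic`). -/

noncomputable section

namespace LInf

universe u v w

/-! ### The bigrading of S(V) by weight and degree. -/

section Homogeneous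

variable {K : Type u} [Field K] {V : ℤ → Type v} [∀ i, AddCommGroup (V i)] [∀ i, Module K (V i)]

variable (K V) in
/-- The product `v₁ ⊙ ⋯ ⊙ vₙ` of a list of homogeneous elements. -/
def listProd (l : List (Σ i, V i)) : Sym K V := (l.map fun a => gen K V a.1 a.2).prod

variable (K V) in
/-- The part of `V^{⊙ n}` of degree `d`. -/
def homPart (n : ℕ) (d : ℤ) : Submodule K (Sym K V) :=
  Submodule.span K
    {x | ∃ l : List (Σ i, V i), l.length = n ∧ (l.map Sigma.fst).sum = d ∧ x = listProd K V l}

theorem listProd_nil : listProd K V [] = 1 := rfl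

theorem listProd_cons (a : Σ i, V i) (l : List (Σ i, V i)) :
    listProd K V (a :: l) = gen K V a.1 a.2 * listProd K V l := by
  simp [listProd]

theorem listProd_mem (l : List (Σ i, V i)) :
    listProd K V l ∈ homPart K V l.length (l.map Sigma.fst).sum :=
  Submodule.subset_span ⟨l, rfl, rfl, rfl⟩

theorem one_mem_homPart : (1 : Sym K V) ∈ homPart K V 0 0 := listProd_mem []

theorem mul_mem_homPart {n m : ℕ} {d e : ℤ} {x y : Sym K V} (hx : x ∈ homPart K V n d)
    (hy : y ∈ homPart K V m e) : x * y ∈ homPart K V (n + m) (d + e) := by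
  have h : homPart K V n d * homPart K V m e ≤ homPart K V (n + m) (d + e) := by
    rw [homPart, homPart, Submodule.span_mul_span, Submodule.span_le]
    rintro _ ⟨_, ⟨l, hl, hd, rfl⟩, _, ⟨l', hl', hd', rfl⟩, rfl⟩
    refine Submodule.subset_span ⟨l ++ l', ?_, ?_, ?_⟩
    · simp [hl, hl']
    · simp [hd, hd']
    · simp [listProd]
  exact h (Submodule.mul_mem_mul hx hy)

theorem gen_mem_homPart (i : ℤ) (v : V i) : gen K V i v ∈ homPart K V 1 i :=
  Submodule.subset_span ⟨[⟨i, v⟩], rfl, by simp, by simp [listProd]⟩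

theorem gen_mul_mem_homPart (i : ℤ) (v : V i) {n : ℕ} {d : ℤ} {x : Sym K V}
    (hx : x ∈ homPart K V n d) : gen K V i v * x ∈ homPart K V (n + 1) (i + d) := by
  rw [add_comm n]
  exact mul_mem_homPart (gen_mem_homPart i v) hx

theorem homPart_le_degPart (n : ℕ) (d : ℤ) : homPart K V n d ≤ degPart K V d :=
  Submodule.span_mono fun _ ⟨l, _, hd, hx⟩ => ⟨l, hd, hx⟩

theorem degPart_induction {d : ℤ} {P : Sym K V → Prop} (zero : P 0)
    (add : ∀ x y, P x → P y → P (x + y)) (hom : ∀ n, ∀ x ∈ homPart K V n d, P x) {x : Sym K V}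
    (hx : x ∈ degPart K V d) : P x := by
  have h : degPart K V d ≤ ⨆ n, homPart K V n d := by
    refine Submodule.span_le.mpr ?_
    rintro _ ⟨l, rfl, rfl⟩
    exact Submodule.mem_iSup_of_mem l.length (listProd_mem l)
  exact Submodule.iSup_induction (motive := P) _ (h hx) hom zero add

theorem iSup_homPart : ⨆ p : ℕ × ℤ, homPart K V p.1 p.2 = ⊤ := by
  refine eq_top_iff.mpr fun x _ => ?_
  induction x using sym_induction with
  | one => exact Submodule.mem_iSup_of_mem (0, 0) one_mem_homPart
  | add x y hx hy => exact add_mem (hx trivial) (hy trivial)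
  | smul c x hx => exact Submodule.smul_mem _ c (hx trivial)
  | gen_mul i v x hx =>
    refine Submodule.iSup_induction (motive := fun x => gen K V i v * x ∈
      ⨆ p : ℕ × ℤ, homPart K V p.1 p.2) _ (hx trivial) ?_ ?_ ?_
    · intro p x hx
      exact Submodule.mem_iSup_of_mem (p.1 + 1, i + p.2) (gen_mul_mem_homPart i v hx)
    · simp
    · intro x y hx hy
      rw [mul_add]
      exact add_mem hx hy

theorem hom_induction {P : Sym K V → Prop} (zero : P 0)
    (add : ∀ x y, P x → P y → P (x + y)) (hom : ∀ n d, ∀ x ∈ homPart K V n d, P x)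
    (x : Sym K V) : P x :=
  Submodule.iSup_induction (motive := P) _ (iSup_homPart (K := K) (V := V) ▸ Submodule.mem_top)
    (fun p x hx => hom p.1 p.2 x hx) zero add

theorem linearMap_ext_hom {M : Type*} [AddCommGroup M] [Module K M] {f g : Sym K V →ₗ[K] M}
    (h : ∀ n d, ∀ x ∈ homPart K V n d, f x = g x) : f = g := by
  ext x
  induction x using hom_induction with
  | zero => simp
  | add x y hx hy => simp [hx, hy]
  | hom n d x hx => exact h n d x hx

theorem tensor_ext_hom {M : Type*} [AddCommGroup M] [Module K M]
    {f g : Sym K V ⊗[K] Sym K V →ₗ[K] M}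
    (h : ∀ n d m e, ∀ x ∈ homPart K V n d, ∀ y ∈ homPart K V m e, f (x ⊗ₜ y) = g (x ⊗ₜ y)) :
    f = g := by
  refine TensorProduct.ext ?_
  refine linearMap_ext_hom fun n d x hx => ?_
  exact linearMap_ext_hom fun m e y hy => h n d m e x hx y hy

theorem weight_of_mem {n : ℕ} {d : ℤ} {x : Sym K V} (hx : x ∈ homPart K V n d) :
    weight x = Polynomial.monomial n x := by
  refine Submodule.span_induction (p := fun x _ => weight x = Polynomial.monomial n x)
    ?_ (by simp) (fun x y _ _ hx hy => by simp [hx, hy])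
    (fun c x _ hx => by rw [map_smul, hx, Polynomial.smul_monomial]) hx
  rintro _ ⟨l, rfl, rfl, rfl⟩
  clear hx
  induction l with
  | nil => simp [listProd_nil]
  | cons a l ih =>
    rw [listProd_cons, weight_gen_mul, ih, Polynomial.monomial_mul_monomial, List.length_cons,
      add_comm]

theorem sign_of_mem_degPart (k : ℤ) {d : ℤ} {x : Sym K V} (hx : x ∈ degPart K V d) :
    sign K V k x = (k * d).negOnePow • x := by
  refine Submodule.span_induction (p := fun x _ => sign K V k x = (k * d).negOnePow • x)
    ?_ (by simp) (fun x y _ _ hx hy => by simp [hx, hy])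
    (fun c x _ hx => by simp [hx, Units.smul_def, smul_comm]) hx
  rintro _ ⟨l, rfl, rfl⟩
  clear hx
  induction l with
  | nil => simp
  | cons a l ih =>
    rw [List.map_cons, List.prod_cons, map_mul, ih, sign_gen, List.map_cons, List.sum_cons,
      mul_add, Int.negOnePow_add, mul_smul]
    simp only [Units.smul_def, smul_mul_assoc, mul_smul_comm]
    rw [smul_comm]

theorem sign_of_mem (k : ℤ) {n : ℕ} {d : ℤ} {x : Sym K V} (hx : x ∈ homPart K V n d) :
    sign K V k x = (k * d).negOnePow • x :=
  sign_of_mem_degPart k (homPart_le_degPart n d hx)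

theorem sign_of_even {k : ℤ} (hk : Even k) (x : Sym K V) : sign K V k x = x := by
  induction x using hom_induction with
  | zero => simp
  | add x y hx hy => simp [hx, hy]
  | hom n d x hx => rw [sign_of_mem k hx, Int.negOnePow_even _ (hk.mul_right d), one_smul]

theorem sign_of_odd {k : ℤ} (hk : Odd k) (x : Sym K V) : sign K V k x = sign K V 1 x := by
  induction x using hom_induction with
  | zero => simp
  | add x y hx hy => simp [hx, hy]
  | hom n d x hx =>
    rw [sign_of_mem k hx, sign_of_mem 1 hx]
    congr 1
    rw [Int.negOnePow_eq_iff]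
    obtain ⟨m, rfl⟩ := hk
    exact ⟨m * d, by ring⟩

theorem sign_sign (k : ℤ) (x : Sym K V) : sign K V k (sign K V k x) = x := by
  induction x using hom_induction with
  | zero => simp
  | add x y hx hy => simp [hx, hy]
  | hom n d x hx =>
    rw [sign_of_mem k hx, Units.smul_def, map_zsmul, sign_of_mem k hx, ← Units.smul_def, smul_smul]
    simp

theorem counit_of_mem {n : ℕ} {d : ℤ} {x : Sym K V} (hx : x ∈ homPart K V n d) (hn : n ≠ 0) :
    counit K V x = 0 := by
  refine Submodule.span_induction (p := fun x _ => counit K V x = 0)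
    ?_ (by simp) (fun x y _ _ hx hy => by simp [hx, hy]) (fun c x _ hx => by simp [hx]) hx
  rintro _ ⟨l, rfl, rfl, rfl⟩
  cases l with
  | nil => simp at hn
  | cons a l => rw [listProd_cons, counit_gen_mul]

theorem exists_smul_one_of_mem {d : ℤ} {x : Sym K V} (hx : x ∈ homPart K V 0 d) :
    ∃ c : K, x = c • 1 := by
  refine Submodule.span_induction (p := fun x _ => ∃ c : K, x = c • 1) ?_ ⟨0, by simp⟩ ?_ ?_ hx
  · rintro _ ⟨l, hl, rfl, rfl⟩
    exact ⟨1, by rw [List.length_eq_zero_iff.mp hl, listProd_nil, one_smul]⟩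
  · rintro x y _ _ ⟨a, rfl⟩ ⟨b, rfl⟩
    exact ⟨a + b, by rw [add_smul]⟩
  · rintro c x _ ⟨a, rfl⟩
    exact ⟨c * a, by rw [mul_smul]⟩

theorem exists_gen_of_mem {d : ℤ} {x : Sym K V} (hx : x ∈ homPart K V 1 d) :
    ∃ v : V d, x = gen K V d v := by
  refine Submodule.span_induction (p := fun x _ => ∃ v : V d, x = gen K V d v)
    ?_ ⟨0, by simp⟩ ?_ ?_ hx
  · rintro _ ⟨l, hl, hd, rfl⟩
    obtain ⟨a, rfl⟩ := List.length_eq_one_iff.mp hl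
    obtain rfl : a.1 = d := by simpa using hd
    exact ⟨a.2, by simp [listProd]⟩
  · rintro x y _ _ ⟨a, rfl⟩ ⟨b, rfl⟩
    exact ⟨a + b, by rw [map_add]⟩
  · rintro c x _ ⟨a, rfl⟩
    exact ⟨c • a, by rw [map_smul]⟩

variable (K V) in
/-- The part of `S(V) ⊗ S(V)` of weight `n` and degree `d`. -/
def tensorPart (n : ℕ) (d : ℤ) : Submodule K (Sym K V ⊗[K] Sym K V) :=
  Submodule.span K
    {t | ∃ i j a b x y, i + j = n ∧ a + b = d ∧ x ∈ homPart K V i a ∧ y ∈ homPart K V j b ∧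
      t = x ⊗ₜ y}

theorem comulAct_mem (i : ℤ) (v : V i) {n : ℕ} {d : ℤ} {t : Sym K V ⊗[K] Sym K V}
    (ht : t ∈ tensorPart K V n d) :
    comulAct K V (DirectSum.lof K ℤ V i v) t ∈ tensorPart K V (n + 1) (i + d) := by
  refine Submodule.span_induction (p := fun t _ => comulAct K V (DirectSum.lof K ℤ V i v) t ∈
    tensorPart K V (n + 1) (i + d)) ?_ (by simp)
    (fun x y _ _ hx hy => by rw [map_add]; exact add_mem hx hy)
    (fun c x _ hx => by rw [map_smul]; exact Submodule.smul_mem _ c hx) ht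
  rintro _ ⟨k, l, a, b, x, y, rfl, rfl, hx, hy, rfl⟩
  rw [comulAct_lof]
  refine add_mem (Submodule.subset_span ⟨k + 1, l, i + a, b, _, y, by omega, by ring,
    gen_mul_mem_homPart i v hx, hy, rfl⟩) (Submodule.subset_span ⟨k, l + 1, a, i + b, _, _,
      by omega, by ring, ?_, gen_mul_mem_homPart i v hy, rfl⟩)
  rw [sign_of_mem i hx, Units.smul_def, ← Int.cast_smul_eq_zsmul K]
  exact Submodule.smul_mem _ _ hx

theorem comul_mem {n : ℕ} {d : ℤ} {x : Sym K V} (hx : x ∈ homPart K V n d) :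
    comul K V x ∈ tensorPart K V n d := by
  refine Submodule.span_induction (p := fun x _ => comul K V x ∈ tensorPart K V n d) ?_ (by simp)
    (fun x y _ _ hx hy => by rw [map_add]; exact add_mem hx hy)
    (fun c x _ hx => by rw [map_smul]; exact Submodule.smul_mem _ c hx) hx
  rintro _ ⟨l, rfl, rfl, rfl⟩
  clear hx
  induction l with
  | nil =>
    rw [listProd_nil, comul_one]
    exact Submodule.subset_span ⟨0, 0, 0, 0, 1, 1, rfl, rfl, one_mem_homPart, one_mem_homPart, rfl⟩
  | cons a l ih =>
    rw [listProd_cons, comul_gen_mul]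
    exact comulAct_mem a.1 a.2 ih

/-- To control a linear map on `Δ x` it suffices to control it on homogeneous tensors. -/
theorem apply_comul_mem {M : Type*} [AddCommGroup M] [Module K M] (N : Submodule K M)
    (f : Sym K V ⊗[K] Sym K V →ₗ[K] M) {n : ℕ} {d : ℤ} {x : Sym K V} (hx : x ∈ homPart K V n d)
    (h : ∀ i j a b x y, i + j = n → a + b = d → x ∈ homPart K V i a → y ∈ homPart K V j b →
      f (x ⊗ₜ y) ∈ N) : f (comul K V x) ∈ N := by
  have : tensorPart K V n d ≤ N.comap f := by
    refine Submodule.span_le.mpr ?_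
    rintro _ ⟨i, j, a, b, x, y, hn, hd, hx, hy, rfl⟩
    exact h i j a b x y hn hd hx hy
  exact this (comul_mem hx)

theorem comul_sign (k : ℤ) (x : Sym K V) :
    comul K V (sign K V k x) =
      TensorProduct.map (sign K V k).toLinearMap (sign K V k).toLinearMap (comul K V x) := by
  induction x using sym_induction with
  | one => simp [comul_one]
  | add x y hx hy => simp only [map_add, hx, hy]
  | smul c x hx => simp only [map_smul, hx]
  | gen_mul i v x hx =>
    rw [map_mul, sign_gen, comul_gen_mul, Units.smul_def, smul_mul_assoc, map_zsmul, comul_gen_mul,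
      hx]
    generalize comul K V x = t
    induction t using TensorProduct.induction_on with
    | zero => simp
    | add s t hs ht => simp only [map_add, smul_add, hs, ht]
    | tmul a b =>
      simp only [TensorProduct.map_tmul, comulAct_lof, map_add, AlgHom.toLinearMap_apply, map_mul,
        sign_gen, Units.smul_def, smul_mul_assoc, TensorProduct.smul_tmul', smul_add,
        TensorProduct.tmul_smul, sign_comm K V k i]

end Homogeneous

/-! ### Coassociativity and graded cocommutativity. -/

section Coassociativity

variable {K : Type u} [Field K] {V : ℤ → Type v} [∀ i, AddCommGroup (V i)] [∀ i, Module K (V i)]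

/-- Left multiplication by `v ⊗ 1 ⊗ 1 + 1 ⊗ v ⊗ 1 + 1 ⊗ 1 ⊗ v`. -/
def comulActThree (i : ℤ) (v : V i) :
    Sym K V ⊗[K] (Sym K V ⊗[K] Sym K V) →ₗ[K] Sym K V ⊗[K] (Sym K V ⊗[K] Sym K V) :=
  TensorProduct.map (LinearMap.mulLeft K (gen K V i v)) LinearMap.id +
    TensorProduct.map (sign K V i).toLinearMap (comulAct K V (DirectSum.lof K ℤ V i v))

theorem coassoc_aux_right (i : ℤ) (v : V i) (t : Sym K V ⊗[K] Sym K V) :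
    TensorProduct.map LinearMap.id (comul K V) (comulAct K V (DirectSum.lof K ℤ V i v) t) =
      comulActThree i v (TensorProduct.map LinearMap.id (comul K V) t) := by
  induction t using TensorProduct.induction_on with
  | zero => simp
  | add s t hs ht => simp only [map_add, hs, ht]
  | tmul a b => simp [comulActThree, comulAct_lof, comul_gen_mul]

theorem coassoc_aux_left (i : ℤ) (v : V i) (t : Sym K V ⊗[K] Sym K V) :
    TensorProduct.assoc K _ _ _
        (TensorProduct.map (comul K V) LinearMap.id (comulAct K V (DirectSum.lof K ℤ V i v) t)) =
      comulActThree i v (TensorProduct.assoc K _ _ _ (TensorProduct.map (comul K V) LinearMap.id t)) := by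
  induction t using TensorProduct.induction_on with
  | zero => simp
  | add s t hs ht => simp only [map_add, hs, ht]
  | tmul a b =>
    simp only [comulAct_lof, map_add, TensorProduct.map_tmul, comul_gen_mul, LinearMap.id_apply,
      comul_sign]
    generalize comul K V a = u
    induction u using TensorProduct.induction_on with
    | zero => simp
    | add s t hs ht =>
      simp only [map_add, TensorProduct.add_tmul, ← hs, ← ht]
      abel
    | tmul a₁ a₂ =>
      simp only [comulActThree, comulAct_lof, TensorProduct.add_tmul, map_add,
        TensorProduct.map_tmul, TensorProduct.assoc_tmul, LinearMap.add_apply, LinearMap.mulLeft_apply,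
        LinearMap.id_apply, AlgHom.toLinearMap_apply, TensorProduct.tmul_add]
      abel

/-- Both iterated coproducts turn left multiplication by v into `comulActThree`, and they agree at
1. -/
theorem comul_coassoc (x : Sym K V) :
    TensorProduct.assoc K _ _ _ (TensorProduct.map (comul K V) LinearMap.id (comul K V x)) =
      TensorProduct.map LinearMap.id (comul K V) (comul K V x) := by
  induction x using sym_induction with
  | one => simp [comul_one]
  | add x y hx hy => simp only [map_add, hx, hy]
  | smul c x hx => simp only [map_smul, hx]
  | gen_mul i v x hx => rw [comul_gen_mul, coassoc_aux_left, coassoc_aux_right, hx]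

variable (K V) in
/-- The graded flip `a ⊗ b ↦ (-1)^{|a||b|} b ⊗ a`. -/
def braid : Sym K V ⊗[K] Sym K V →ₗ[K] Sym K V ⊗[K] Sym K V :=
  -- The Koszul sign depends only on parities. The maps (1 ± sign)/2 project onto the even and odd
  -- parts, and b receives its sign only beside an odd a.
  (TensorProduct.comm K _ _).toLinearMap ∘ₗ
    (TensorProduct.map ((2 : K)⁻¹ • (LinearMap.id + (sign K V 1).toLinearMap)) LinearMap.id +
      TensorProduct.map ((2 : K)⁻¹ • (LinearMap.id - (sign K V 1).toLinearMap))
        (sign K V 1).toLinearMap)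

theorem braid_tmul [CharZero K] {d : ℤ} {a : Sym K V} (ha : a ∈ degPart K V d) (b : Sym K V) :
    braid K V (a ⊗ₜ b) = sign K V d b ⊗ₜ a := by
  have h2 : (2 : K)⁻¹ • (a + a) = a := by
    rw [← two_smul K a, smul_smul, inv_mul_cancel₀ two_ne_zero, one_smul]
  have h1 := sign_of_mem_degPart 1 ha
  rcases Int.even_or_odd d with hd | hd
  · rw [one_mul, Int.negOnePow_even d hd, one_smul] at h1
    rw [smul_add] at h2
    simp [braid, h1, h2, sign_of_even hd]
  · rw [one_mul, Int.negOnePow_odd d hd, Units.neg_smul, one_smul] at h1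
    simp [braid, h1, h2, sign_of_odd hd]

theorem braid_comulAct [CharZero K] (i : ℤ) (v : V i) (t : Sym K V ⊗[K] Sym K V) :
    braid K V (comulAct K V (DirectSum.lof K ℤ V i v) t) =
      comulAct K V (DirectSum.lof K ℤ V i v) (braid K V t) := by
  refine LinearMap.congr_fun (f := braid K V ∘ₗ comulAct K V (DirectSum.lof K ℤ V i v))
    (g := comulAct K V (DirectSum.lof K ℤ V i v) ∘ₗ braid K V) (tensor_ext_hom ?_) t
  intro n d m e a ha b hb
  have hv := homPart_le_degPart _ _ (gen_mul_mem_homPart i v ha)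
  have ha' := homPart_le_degPart _ _ ha
  simp only [LinearMap.comp_apply, comulAct_lof, map_add, braid_tmul ha', braid_tmul hv,
    sign_of_mem _ ha, sign_of_mem _ hb, Units.smul_def, ← TensorProduct.smul_tmul', map_zsmul,
    map_mul, sign_gen, smul_mul_assoc, mul_smul_comm, smul_smul]
  rw [add_comm, smul_add, smul_smul]
  simp only [← Units.val_mul, ← Int.negOnePow_add, ← Units.smul_def]
  congr 2
  · rw [Int.negOnePow_eq_iff]
    exact ⟨d * i, by ring⟩
  · rw [Int.negOnePow_eq_iff]
    exact ⟨0, by ring⟩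

/-- The flip fixes 1 ⊗ 1 and commutes with the action of v ⊗ 1 + 1 ⊗ v, from which Δ is built. -/
theorem braid_comul [CharZero K] (x : Sym K V) : braid K V (comul K V x) = comul K V x := by
  induction x using sym_induction with
  | one =>
    rw [comul_one, braid_tmul (homPart_le_degPart 0 0 one_mem_homPart), map_one]
  | add x y hx hy => simp only [map_add, hx, hy]
  | smul c x hx => simp only [map_smul, hx]
  | gen_mul i v x hx => rw [comul_gen_mul, braid_comulAct, hx]

theorem comul_counit (x : Sym K V) :
    TensorProduct.rid K (Sym K V) (TensorProduct.map LinearMap.id (counit K V) (comul K V x)) =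
      x := by
  induction x using sym_induction with
  | one => simp [comul_one, counit_one]
  | add x y hx hy => simp only [map_add, hx, hy]
  | smul c x hx => simp only [map_smul, hx]
  | gen_mul i v x hx =>
    rw [comul_gen_mul]
    conv_rhs => rw [← hx]
    generalize comul K V x = t
    induction t using TensorProduct.induction_on with
    | zero => simp
    | add s t hs ht => simp only [map_add, hs, ht, mul_add]
    | tmul a b => simp [comulAct_lof, counit_gen_mul]

theorem ι_mul_induction {P : Sym K V → Prop} (x : ⨁ i, V i) (y : Sym K V) (zero : P 0)
    (add : ∀ a b, P a → P b → P (a + b)) (gen : ∀ i v, P (gen K V i v * y)) :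
    P (ι K V x * y) := by
  induction x using DirectSum.induction_on with
  | zero => simpa using zero
  | of i v => exact gen i v
  | add a b ha hb => rw [map_add, add_mul]; exact add _ _ ha hb

theorem counit_ι_mul (x : ⨁ i, V i) (y : Sym K V) : counit K V (ι K V x * y) = 0 := by
  refine ι_mul_induction (P := fun z => counit K V z = 0) x y (by simp) ?_ ?_
  · intro a b ha hb; rw [map_add, ha, hb, add_zero]
  · intro i v; exact counit_gen_mul i v y

theorem proj_ι_mul (x : ⨁ i, V i) (y : Sym K V) :
    proj K V (ι K V x * y) = counit K V y • x := by
  induction x using DirectSum.induction_on with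
  | zero => simp
  | of i v => exact proj_gen_mul i v y
  | add a b ha hb => rw [map_add, add_mul, map_add, ha, hb, smul_add]

theorem comul_ι_mul (x : ⨁ i, V i) (y : Sym K V) :
    comul K V (ι K V x * y) = comulAct K V x (comul K V y) := by
  induction x using DirectSum.induction_on with
  | zero => simp
  | of i v => exact comul_gen_mul i v y
  | add a b ha hb => rw [map_add, add_mul, map_add, ha, hb, map_add, LinearMap.add_apply]

theorem euler_ι_mul (x : ⨁ i, V i) (y : Sym K V) :
    euler (ι K V x * y) = ι K V x * y + ι K V x * euler y := by
  induction x using DirectSum.induction_on with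
  | zero => simp
  | of i v => exact euler_gen_mul i v y
  | add a b ha hb =>
    simp only [map_add, add_mul, ha, hb]
    abel

end Coassociativity

/-! ### The Euler operator and uniqueness in characteristic zero. -/

section Euler

variable {K : Type u} [Field K] {V : ℤ → Type v} [∀ i, AddCommGroup (V i)] [∀ i, Module K (V i)]

variable (K V) in
/-- The projection `S(V) → V^{⊙ n}`. -/
def weightComp (n : ℕ) : Sym K V →ₗ[K] Sym K V where
  toFun x := (weight x).coeff n
  map_add' x y := by simp
  map_smul' c x := by simp

theorem weightComp_of_mem {n m : ℕ} {d : ℤ} {x : Sym K V} (hx : x ∈ homPart K V n d) :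
    weightComp K V m x = if m = n then x else 0 := by
  change (weight x).coeff m = _
  rw [weight_of_mem hx, Polynomial.coeff_monomial]
  simp only [eq_comm]

theorem weightComp_euler (n : ℕ) (x : Sym K V) :
    weightComp K V n (euler x) = (n : K) • weightComp K V n x :=
  weight_euler x n

theorem weightComp_zero (x : Sym K V) : weightComp K V 0 x = counit K V x • 1 := by
  rw [← Algebra.algebraMap_eq_smul_one]
  exact weight_coeff_zero x

theorem euler_of_mem {n : ℕ} {d : ℤ} {x : Sym K V} (hx : x ∈ homPart K V n d) :
    euler x = (n : K) • x := by
  refine Submodule.span_induction (p := fun x _ => euler x = (n : K) • x)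
    ?_ (by simp) (fun x y _ _ hx hy => by simp [hx, hy])
    (fun c x _ hx => by rw [map_smul, hx, smul_comm]) hx
  rintro _ ⟨l, rfl, rfl, rfl⟩
  clear hx
  induction l with
  | nil => simp [listProd_nil, euler, comul_one, proj_one]
  | cons a l ih =>
    rw [listProd_cons, euler_gen_mul, ih, List.length_cons, mul_smul_comm]
    push_cast
    rw [add_smul, one_smul, add_comm]

theorem exists_sum_weightComp (x : Sym K V) :
    ∃ N, ∀ M, N ≤ M → ∑ n ∈ Finset.range M, weightComp K V n x = x := by
  induction x using hom_induction with
  | zero => exact ⟨0, by simp⟩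
  | add x y hx hy =>
    obtain ⟨N, hN⟩ := hx
    obtain ⟨N', hN'⟩ := hy
    refine ⟨max N N', fun M hM => ?_⟩
    simp only [map_add, Finset.sum_add_distrib, hN M (le_trans (le_max_left _ _) hM),
      hN' M (le_trans (le_max_right _ _) hM)]
  | hom n d x hx =>
    refine ⟨n + 1, fun M hM => ?_⟩
    simp only [weightComp_of_mem hx, Finset.sum_ite_eq', Finset.mem_range]
    rw [if_pos (by omega)]

theorem eq_zero_of_weightComp {x : Sym K V} (h : ∀ n, weightComp K V n x = 0) : x = 0 := by
  obtain ⟨N, hN⟩ := exists_sum_weightComp x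
  rw [← hN N le_rfl]
  simp [h]

/-- In characteristic zero the Euler operator detects every weight except 0, and the counit detects
that one. -/
theorem eq_zero_of_euler [CharZero K] {x : Sym K V} (he : euler x = 0) (hc : counit K V x = 0) :
    x = 0 := by
  refine eq_zero_of_weightComp fun n => ?_
  rcases Nat.eq_zero_or_pos n with rfl | hn
  · rw [weightComp_zero, hc, zero_smul]
  · have h := weightComp_euler n x
    rw [he, map_zero] at h
    exact (smul_eq_zero.mp h.symm).resolve_left (by exact_mod_cast hn.ne')

theorem eq_zero_of_map_weightComp {t : Sym K V ⊗[K] Sym K V}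
    (h : ∀ m n, TensorProduct.map (weightComp K V m) (weightComp K V n) t = 0) : t = 0 := by
  have key : ∃ N, ∀ M, N ≤ M → ∑ m ∈ Finset.range M, ∑ n ∈ Finset.range M,
      TensorProduct.map (weightComp K V m) (weightComp K V n) t = t := by
    clear h
    induction t using TensorProduct.induction_on with
    | zero => exact ⟨0, by simp⟩
    | tmul a b =>
      obtain ⟨N, hN⟩ := exists_sum_weightComp a
      obtain ⟨N', hN'⟩ := exists_sum_weightComp b
      refine ⟨max N N', fun M hM => ?_⟩
      simp only [TensorProduct.map_tmul, ← TensorProduct.tmul_sum, ← TensorProduct.sum_tmul,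
        hN M (le_trans (le_max_left _ _) hM), hN' M (le_trans (le_max_right _ _) hM)]
    | add s t hs ht =>
      obtain ⟨N, hN⟩ := hs
      obtain ⟨N', hN'⟩ := ht
      refine ⟨max N N', fun M hM => ?_⟩
      simp only [map_add, Finset.sum_add_distrib, hN M (le_trans (le_max_left _ _) hM),
        hN' M (le_trans (le_max_right _ _) hM)]
  obtain ⟨N, hN⟩ := key
  rw [← hN N le_rfl]
  simp [h]

variable (K V) in
/-- The Euler operator of `S(V) ⊗ S(V)`. -/
def eulerTensor : Sym K V ⊗[K] Sym K V →ₗ[K] Sym K V ⊗[K] Sym K V :=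
  TensorProduct.map euler LinearMap.id + TensorProduct.map LinearMap.id euler

theorem eq_zero_of_eulerTensor [CharZero K] {t : Sym K V ⊗[K] Sym K V}
    (he : eulerTensor K V t = 0) (hc : TensorProduct.map (counit K V) (counit K V) t = 0) :
    t = 0 := by
  refine eq_zero_of_map_weightComp fun m n => ?_
  have key : ∀ t, TensorProduct.map (weightComp K V m) (weightComp K V n) (eulerTensor K V t) =
      ((m + n : ℕ) : K) • TensorProduct.map (weightComp K V m) (weightComp K V n) t := by
    intro t
    induction t using TensorProduct.induction_on with
    | zero => simp
    | add s t hs ht => simp only [map_add, hs, ht, smul_add]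
    | tmul a b =>
      simp only [eulerTensor, LinearMap.add_apply, TensorProduct.map_tmul, LinearMap.id_apply,
        map_add, weightComp_euler, Nat.cast_add, add_smul, TensorProduct.tmul_smul,
        TensorProduct.smul_tmul']
  have h := key t
  rw [he, map_zero] at h
  rcases Nat.eq_zero_or_pos (m + n) with h0 | h0
  · obtain ⟨rfl, rfl⟩ : m = 0 ∧ n = 0 := by omega
    have h1 : weightComp K V 0 = LinearMap.toSpanSingleton K _ 1 ∘ₗ counit K V :=
      LinearMap.ext fun x => weightComp_zero x
    rw [h1, TensorProduct.map_comp, LinearMap.comp_apply, hc, map_zero]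
  · exact (smul_eq_zero.mp h.symm).resolve_left (by exact_mod_cast h0.ne')

theorem sign_euler (k : ℤ) (x : Sym K V) : sign K V k (euler x) = euler (sign K V k x) := by
  induction x using hom_induction with
  | zero => simp
  | add x y hx hy => simp only [map_add, hx, hy]
  | hom n d x hx =>
    rw [sign_of_mem k hx, euler_of_mem hx, map_smul, sign_of_mem k hx, Units.smul_def, map_zsmul,
      euler_of_mem hx, smul_comm]

/-- Infinitesimal form of the fact that Δ preserves the total weight. -/
theorem comul_euler (x : Sym K V) : comul K V (euler x) = eulerTensor K V (comul K V x) := by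
  have he1 : euler (1 : Sym K V) = 0 := by simp [euler, comul_one, proj_one]
  induction x using sym_induction with
  | one => simp [comul_one, eulerTensor, he1]
  | add x y hx hy => simp only [map_add, hx, hy]
  | smul c x hx => simp only [map_smul, hx]
  | gen_mul i v x hx =>
    rw [euler_gen_mul, map_add, comul_gen_mul, comul_gen_mul, hx]
    generalize comul K V x = t
    induction t using TensorProduct.induction_on with
    | zero => simp
    | add s t hs ht =>
      simp only [map_add, ← hs, ← ht]
      abel
    | tmul a b =>
      simp only [eulerTensor, comulAct_lof, LinearMap.add_apply, map_add, TensorProduct.map_tmul,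
        LinearMap.id_apply, euler_gen_mul, TensorProduct.add_tmul, TensorProduct.tmul_add,
        sign_euler]
      abel

end Euler

/-! ### Cofree extension as a convolution exponential. -/

section Cofree

variable {K : Type u} [Field K]
variable {V : ℤ → Type v} [∀ i, AddCommGroup (V i)] [∀ i, Module K (V i)]
variable {W : ℤ → Type w} [∀ i, AddCommGroup (W i)] [∀ i, Module K (W i)]

/-- The convolution product of `f : S(V) → W` and `Y : S(V) → S(W)`. -/
def conv (f : Sym K V →ₗ[K] ⨁ i, W i) (Y : Sym K V →ₗ[K] Sym K W) : Sym K V →ₗ[K] Sym K W :=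
  LinearMap.mul' K (Sym K W) ∘ₗ TensorProduct.map (ι K W ∘ₗ f) Y ∘ₗ comul K V

/-- The map `S(V) → W` preserves degrees. -/
def IsDegreeZero (f : Sym K V →ₗ[K] ⨁ i, W i) : Prop :=
  ∀ d, ∀ x ∈ degPart K V d, f x ∈ LinearMap.range (DirectSum.lof K ℤ W d)

/-- A morphism `S(V) → S(W)` of graded counital coaugmented coalgebras. -/
structure IsCoalgHom (F : Sym K V →ₗ[K] Sym K W) : Prop where
  degree_zero : ∀ d, ∀ x ∈ degPart K V d, F x ∈ degPart K W d
  map_comul : comul K W ∘ₗ F = TensorProduct.map F F ∘ₗ comul K V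
  map_counit : counit K W ∘ₗ F = counit K V
  map_unit : F 1 = 1

theorem tensor_map_sub_right {A B C D : Type*} [AddCommGroup A] [Module K A] [AddCommGroup B]
    [Module K B] [AddCommGroup C] [Module K C] [AddCommGroup D] [Module K D] (f : A →ₗ[K] B)
    (g h : C →ₗ[K] D) :
    TensorProduct.map f (g - h) = TensorProduct.map f g - TensorProduct.map f h :=
  TensorProduct.ext' fun a b => by simp [TensorProduct.tmul_sub]

theorem map_counit_comul (x : Sym K V) :
    TensorProduct.map (counit K V) (counit K V) (comul K V x) = counit K V x • (1 ⊗ₜ 1) := by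
  have h := counit_comul x
  rw [← LinearEquiv.eq_symm_apply] at h
  have h' := congrArg (TensorProduct.map LinearMap.id (counit K V)) h
  rw [← LinearMap.comp_apply, ← TensorProduct.map_comp] at h'
  simp only [LinearMap.id_comp, LinearMap.comp_id, TensorProduct.lid_symm_apply,
    TensorProduct.map_tmul, LinearMap.id_apply] at h'
  rw [h', ← TensorProduct.tmul_smul, smul_eq_mul, mul_one]

theorem conv_sub (f : Sym K V →ₗ[K] ⨁ i, W i) (Y Z : Sym K V →ₗ[K] Sym K W) :
    conv f (Y - Z) = conv f Y - conv f Z := by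
  simp only [conv, tensor_map_sub_right, LinearMap.sub_comp, LinearMap.comp_sub]

theorem conv_sum (f : Sym K V →ₗ[K] ⨁ i, W i) {α : Type*} (s : Finset α)
    (Y : α → Sym K V →ₗ[K] Sym K W) : conv f (∑ a ∈ s, Y a) = ∑ a ∈ s, conv f (Y a) := by
  classical
  induction s using Finset.induction_on with
  | empty => simp [conv]
  | insert a s ha ih =>
    rw [Finset.sum_insert ha, Finset.sum_insert ha, ← ih]
    simp only [conv, TensorProduct.map_add_right, LinearMap.add_comp, LinearMap.comp_add]

/-- Since f kills weight 0, the factor f consumes at least one unit of weight, so vanishing of Y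
below n extends to f * Y in weight n. This is the induction step of the uniqueness arguments. -/
theorem conv_eq_zero {f : Sym K V →ₗ[K] ⨁ i, W i} (hf : f 1 = 0) {Y : Sym K V →ₗ[K] Sym K W}
    {n : ℕ} (hY : ∀ m d, m < n → ∀ x ∈ homPart K V m d, Y x = 0) {m : ℕ} {d : ℤ} (hm : m ≤ n)
    {x : Sym K V} (hx : x ∈ homPart K V m d) : conv f Y x = 0 := by
  refine (Submodule.mem_bot K).mp (apply_comul_mem ⊥
    (LinearMap.mul' K (Sym K W) ∘ₗ TensorProduct.map (ι K W ∘ₗ f) Y) hx ?_)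
  intro i j a b x y hij _ hx hy
  rw [Submodule.mem_bot, LinearMap.comp_apply, TensorProduct.map_tmul, LinearMap.mul'_apply]
  rcases Nat.eq_zero_or_pos i with rfl | hi
  · obtain ⟨c, rfl⟩ := exists_smul_one_of_mem hx
    simp [hf]
  · rw [hY j b (by omega) y hy, mul_zero]

theorem euler_conv (f : Sym K V →ₗ[K] ⨁ i, W i) (Y : Sym K V →ₗ[K] Sym K W) (x : Sym K V) :
    euler (conv f Y x) = conv f Y x + conv f (euler ∘ₗ Y) x := by
  simp only [conv, LinearMap.comp_apply]
  generalize comul K V x = t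
  induction t using TensorProduct.induction_on with
  | zero => simp
  | add s t hs ht =>
    simp only [map_add, hs, ht]
    abel
  | tmul a b => simp [euler_ι_mul]

theorem counit_conv (f : Sym K V →ₗ[K] ⨁ i, W i) (Y : Sym K V →ₗ[K] Sym K W) (x : Sym K V) :
    counit K W (conv f Y x) = 0 := by
  simp only [conv, LinearMap.comp_apply]
  generalize comul K V x = t
  induction t using TensorProduct.induction_on with
  | zero => simp
  | add s t hs ht => simp only [map_add, hs, ht, add_zero]
  | tmul a b => simp [counit_ι_mul]

/-- A product v ⊙ y has a component in V only through the counit of y. The relevant values are c = 1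
for the convolution unit and c = 0 for maps with vanishing counit. -/
theorem proj_conv {f : Sym K V →ₗ[K] ⨁ i, W i} {Y : Sym K V →ₗ[K] Sym K W} (c : K)
    (hY : counit K W ∘ₗ Y = c • counit K V) (x : Sym K V) :
    proj K W (conv f Y x) = c • f x := by
  have key : ∀ t, proj K W (LinearMap.mul' K (Sym K W) (TensorProduct.map (ι K W ∘ₗ f) Y t)) =
      c • f (TensorProduct.rid K (Sym K V) (TensorProduct.map LinearMap.id (counit K V) t)) := by
    intro t
    induction t using TensorProduct.induction_on with
    | zero => simp
    | add s t hs ht => simp only [map_add, hs, ht, smul_add]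
    | tmul a b =>
      have h := LinearMap.congr_fun hY b
      simp only [LinearMap.comp_apply, LinearMap.smul_apply] at h
      simp [proj_ι_mul, h, mul_smul]
  rw [conv, LinearMap.comp_apply, LinearMap.comp_apply, key, comul_counit]

theorem conv_mem {f : Sym K V →ₗ[K] ⨁ i, W i} (hf : IsDegreeZero f) {Y : Sym K V →ₗ[K] Sym K W}
    (hY : ∀ m d, ∀ x ∈ homPart K V m d, Y x ∈ degPart K W d) (m : ℕ) (d : ℤ) (x : Sym K V)
    (hx : x ∈ homPart K V m d) : conv f Y x ∈ degPart K W d := by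
  refine apply_comul_mem _ (LinearMap.mul' K (Sym K W) ∘ₗ TensorProduct.map (ι K W ∘ₗ f) Y) hx ?_
  rintro i j a b x y - rfl hx hy
  obtain ⟨w, hw⟩ := hf a x (homPart_le_degPart _ _ hx)
  rw [LinearMap.comp_apply, TensorProduct.map_tmul, LinearMap.mul'_apply, LinearMap.comp_apply,
    ← hw]
  change gen K W a w * _ ∈ _
  refine degPart_induction (P := fun y => gen K W a w * y ∈ degPart K W (a + b)) (by simp) ?_ ?_
    (hY j b y hy)
  · intro x y hx hy
    rw [mul_add]
    exact add_mem hx hy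
  · intro n z hz
    exact homPart_le_degPart _ _ (gen_mul_mem_homPart a w hz)

/-- The `n`-th term of the convolution exponential of `f`. -/
def expTerm (f : Sym K V →ₗ[K] ⨁ i, W i) : ℕ → Sym K V →ₗ[K] Sym K W
  | 0 => Algebra.linearMap K (Sym K W) ∘ₗ counit K V
  | n + 1 => ((n + 1 : ℕ) : K)⁻¹ • conv f (expTerm f n)

theorem expTerm_eq_zero {f : Sym K V →ₗ[K] ⨁ i, W i} (hf : f 1 = 0) (n : ℕ) :
    ∀ m d, m < n → ∀ x ∈ homPart K V m d, expTerm f n x = 0 := by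
  induction n with
  | zero => intro m d hm; omega
  | succ n ih =>
    intro m d hm x hx
    rw [expTerm, LinearMap.smul_apply, conv_eq_zero hf ih (by omega) hx, smul_zero]

theorem expTerm_mem {f : Sym K V →ₗ[K] ⨁ i, W i} (hf : IsDegreeZero f) (n : ℕ) :
    ∀ m d, ∀ x ∈ homPart K V m d, expTerm f n x ∈ degPart K W d := by
  induction n with
  | zero =>
    intro m d x hx
    rcases eq_or_ne m 0 with rfl | hm
    · rcases eq_or_ne d 0 with rfl | hd
      · rw [expTerm, LinearMap.comp_apply, Algebra.linearMap_apply, Algebra.algebraMap_eq_smul_one]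
        exact Submodule.smul_mem _ _ (homPart_le_degPart 0 0 one_mem_homPart)
      · have : homPart K V 0 d = ⊥ := by
          refine Submodule.span_eq_bot.mpr ?_
          rintro _ ⟨l, hl, hd', rfl⟩
          rw [List.length_eq_zero_iff.mp hl] at hd'
          exact absurd hd'.symm (by simpa using hd)
        rw [this, Submodule.mem_bot] at hx
        simp [hx]
    · rw [expTerm, LinearMap.comp_apply, counit_of_mem hx hm, map_zero]
      exact zero_mem _
  | succ n ih =>
    intro m d x hx
    exact Submodule.smul_mem _ _ (conv_mem hf ih m d x hx)

/-- The convolution power f^{*n} / n! has values in weight n. -/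
theorem euler_expTerm [CharZero K] (f : Sym K V →ₗ[K] ⨁ i, W i) (n : ℕ) :
    euler ∘ₗ expTerm f n = (n : K) • expTerm f n := by
  induction n with
  | zero =>
    ext x
    simp [expTerm, Algebra.algebraMap_eq_smul_one, euler_of_mem one_mem_homPart]
  | succ n ih =>
    have h0 : ((n + 1 : ℕ) : K) ≠ 0 := by exact_mod_cast n.succ_ne_zero
    ext x
    have h1 : conv f ((n : K) • expTerm f n) = (n : K) • conv f (expTerm f n) := by
      simp only [conv, TensorProduct.map_smul_right, LinearMap.smul_comp, LinearMap.comp_smul]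
    rw [LinearMap.comp_apply, expTerm, LinearMap.smul_apply, map_smul, euler_conv, ih, h1,
      LinearMap.smul_apply, LinearMap.smul_apply, LinearMap.smul_apply, smul_smul,
      mul_inv_cancel₀ h0, one_smul, smul_add, smul_smul, ← add_smul]
    have : ((n + 1 : ℕ) : K)⁻¹ + ((n + 1 : ℕ) : K)⁻¹ * (n : K) = 1 := by
      rw [← mul_one_add, add_comm (1 : K), ← Nat.cast_succ, inv_mul_cancel₀ h0]
    rw [this, one_smul]

/-- The convolution exponential of `f`, the cofree extension of `f` to a map of coalgebras. -/
def cofree (f : Sym K V →ₗ[K] ⨁ i, W i) : Sym K V →ₗ[K] Sym K W :=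
  -- On weight k the terms with n > k vanish as soon as f 1 = 0, so the exponential can be cut off
  -- there.
  Polynomial.lsum (fun k => ∑ n ∈ Finset.range (k + 1), expTerm f n) ∘ₗ
    (weight (K := K) (V := V)).toLinearMap

theorem cofree_of_mem {f : Sym K V →ₗ[K] ⨁ i, W i} (hf : f 1 = 0) {m : ℕ} {d : ℤ} {x : Sym K V}
    (hx : x ∈ homPart K V m d) {N : ℕ} (hN : m < N) :
    cofree f x = (∑ n ∈ Finset.range N, expTerm f n) x := by
  have h : cofree f x = (∑ n ∈ Finset.range (m + 1), expTerm f n) x := by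
    rw [cofree, LinearMap.comp_apply, AlgHom.toLinearMap_apply, weight_of_mem hx]
    simp [Polynomial.lsum_apply, Polynomial.sum_monomial_index]
  rw [h, LinearMap.sum_apply, LinearMap.sum_apply]
  refine Finset.sum_subset (Finset.range_subset_range.mpr hN) fun n _ hn => ?_
  exact expTerm_eq_zero hf n m d (by simpa using hn) x hx

theorem cofree_one {f : Sym K V →ₗ[K] ⨁ i, W i} (hf : f 1 = 0) : cofree f 1 = 1 := by
  rw [cofree_of_mem hf one_mem_homPart Nat.zero_lt_one]
  simp [expTerm, counit_one]

theorem counit_cofree {f : Sym K V →ₗ[K] ⨁ i, W i} (hf : f 1 = 0) :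
    counit K W ∘ₗ cofree f = counit K V := by
  refine linearMap_ext_hom fun n d x hx => ?_
  rw [LinearMap.comp_apply, cofree_of_mem hf hx (Nat.lt_succ_self n), LinearMap.sum_apply,
    Finset.sum_range_succ', map_add, map_sum, Finset.sum_eq_zero, zero_add, expTerm]
  · simp [Algebra.algebraMap_eq_smul_one, counit_one]
  · intro n _
    rw [expTerm, LinearMap.smul_apply, map_smul, counit_conv, smul_zero]

theorem cofree_mem {f : Sym K V →ₗ[K] ⨁ i, W i} (hf : f 1 = 0) (hd : IsDegreeZero f) (d : ℤ)
    (x : Sym K V) (hx : x ∈ degPart K V d) : cofree f x ∈ degPart K W d := by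
  refine degPart_induction (P := fun x => cofree f x ∈ degPart K W d) (by simp) ?_ ?_ hx
  · intro x y hx hy
    rw [map_add]
    exact add_mem hx hy
  · intro n x hx
    rw [cofree_of_mem hf hx (Nat.lt_succ_self n), LinearMap.sum_apply]
    exact sum_mem fun k _ => expTerm_mem hd k n d x hx

theorem proj_cofree [CharZero K] {f : Sym K V →ₗ[K] ⨁ i, W i} (hf : f 1 = 0) :
    proj K W ∘ₗ cofree f = f := by
  refine linearMap_ext_hom fun n d x hx => ?_
  rcases Nat.eq_zero_or_pos n with rfl | hn
  · obtain ⟨c, rfl⟩ := exists_smul_one_of_mem hx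
    simp [cofree_one hf, proj_one, hf]
  · rw [LinearMap.comp_apply, cofree_of_mem hf hx (Nat.lt_succ_self n), LinearMap.sum_apply,
      map_sum, Finset.sum_eq_single 1]
    · rw [expTerm, LinearMap.smul_apply, map_smul, proj_conv 1, one_smul]
      · simp
      · ext x
        simp [expTerm, Algebra.algebraMap_eq_smul_one, counit_one]
    · intro k _ hk
      match k, hk with
      | 0, _ => simp [expTerm, Algebra.algebraMap_eq_smul_one, proj_one]
      | k + 2, _ =>
        rw [expTerm, LinearMap.smul_apply, map_smul, proj_conv 0, zero_smul, smul_zero]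
        ext x
        simp [expTerm, counit_conv]
    · intro h
      exact absurd (Finset.mem_range.mpr (by omega)) h

/-- The differential equation of the exponential, from n · fⁿ/n! = f · fⁿ⁻¹/(n-1)!. -/
theorem euler_cofree [CharZero K] {f : Sym K V →ₗ[K] ⨁ i, W i} (hf : f 1 = 0) :
    euler ∘ₗ cofree f = conv f (cofree f) := by
  refine linearMap_ext_hom fun n d x hx => ?_
  have h1 : conv f (cofree f) x = conv f (∑ k ∈ Finset.range n, expTerm f k) x := by
    rw [← sub_eq_zero, ← LinearMap.sub_apply, ← conv_sub]
    refine conv_eq_zero hf ?_ le_rfl hx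
    intro m e hm y hy
    rw [LinearMap.sub_apply, cofree_of_mem hf hy hm, sub_self]
  rw [h1, conv_sum, LinearMap.comp_apply, cofree_of_mem hf hx (Nat.lt_succ_self n),
    LinearMap.sum_apply, LinearMap.sum_apply, map_sum, Finset.sum_range_succ']
  have h2 : ∀ k, euler (expTerm f k x) = (k : K) • expTerm f k x := fun k =>
    LinearMap.congr_fun (euler_expTerm f k) x
  simp only [h2]
  rw [Nat.cast_zero, zero_smul, add_zero]
  refine Finset.sum_congr rfl fun k _ => ?_
  rw [expTerm, LinearMap.smul_apply, smul_smul, mul_inv_cancel₀, one_smul]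
  exact_mod_cast k.succ_ne_zero

/-- The convolution product of `f : S(V) → W` and `Y : S(V) → S(W) ⊗ S(W)`. -/
def convTensor (f : Sym K V →ₗ[K] ⨁ i, W i) (Y : Sym K V →ₗ[K] Sym K W ⊗[K] Sym K W) :
    Sym K V →ₗ[K] Sym K W ⊗[K] Sym K W :=
  TensorProduct.lift (comulAct K W) ∘ₗ TensorProduct.map f Y ∘ₗ comul K V

theorem convTensor_eq_zero {f : Sym K V →ₗ[K] ⨁ i, W i} (hf : f 1 = 0)
    {Y : Sym K V →ₗ[K] Sym K W ⊗[K] Sym K W} {n : ℕ}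
    (hY : ∀ m d, m < n → ∀ x ∈ homPart K V m d, Y x = 0) {d : ℤ}
    {x : Sym K V} (hx : x ∈ homPart K V n d) : convTensor f Y x = 0 := by
  refine (Submodule.mem_bot K).mp (apply_comul_mem ⊥
    (TensorProduct.lift (comulAct K W) ∘ₗ TensorProduct.map f Y) hx ?_)
  intro i j a b x y hij _ hx hy
  rw [Submodule.mem_bot, LinearMap.comp_apply, TensorProduct.map_tmul, TensorProduct.lift.tmul]
  rcases Nat.eq_zero_or_pos i with rfl | hi
  · obtain ⟨c, rfl⟩ := exists_smul_one_of_mem hx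
    simp [hf]
  · rw [hY j b (by omega) y hy, map_zero]

theorem comul_conv (f : Sym K V →ₗ[K] ⨁ i, W i) (Y : Sym K V →ₗ[K] Sym K W) :
    comul K W ∘ₗ conv f Y = convTensor f (comul K W ∘ₗ Y) := by
  simp only [conv, convTensor, ← LinearMap.comp_assoc]
  congr 1
  refine TensorProduct.ext' fun a b => ?_
  simp [comul_ι_mul]

theorem map_sign_of_degree_zero {F : Sym K V →ₗ[K] Sym K W}
    (hF : ∀ d, ∀ x ∈ degPart K V d, F x ∈ degPart K W d) (k : ℤ) (x : Sym K V) :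
    F (sign K V k x) = sign K W k (F x) := by
  induction x using hom_induction with
  | zero => simp
  | add x y hx hy => simp only [map_add, hx, hy]
  | hom n d x hx =>
    rw [sign_of_mem k hx, sign_of_mem_degPart k (hF d x (homPart_le_degPart n d hx)),
      Units.smul_def, map_zsmul, Units.smul_def]

/-- The values of f act on a tensor product as v ⊗ 1 + 1 ⊗ v, hence by a Leibniz rule. Acting on the
first factor needs coassociativity; acting on the second also needs cocommutativity, because the
argument of f has to pass that of the first F. -/
theorem convTensor_map [CharZero K] {f : Sym K V →ₗ[K] ⨁ i, W i} (hf : IsDegreeZero f)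
    {F : Sym K V →ₗ[K] Sym K W} (hF : ∀ d, ∀ x ∈ degPart K V d, F x ∈ degPart K W d) :
    convTensor f (TensorProduct.map F F ∘ₗ comul K V) =
      (TensorProduct.map (conv f F) F + TensorProduct.map F (conv f F)) ∘ₗ comul K V := by
  set m : Sym K V ⊗[K] Sym K V →ₗ[K] Sym K W :=
    LinearMap.mul' K (Sym K W) ∘ₗ TensorProduct.map (ι K W ∘ₗ f) F with hm
  have key : TensorProduct.lift (comulAct K W) ∘ₗ TensorProduct.map f (TensorProduct.map F F) =
      TensorProduct.map m F ∘ₗ (TensorProduct.assoc K _ _ _).symm.toLinearMap +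
      TensorProduct.map F m ∘ₗ (TensorProduct.assoc K _ _ _).toLinearMap ∘ₗ
        TensorProduct.map (braid K V) LinearMap.id ∘ₗ
          (TensorProduct.assoc K _ _ _).symm.toLinearMap := by
    refine TensorProduct.ext (linearMap_ext_hom fun n d a ha => TensorProduct.ext' fun b c => ?_)
    have ha' := homPart_le_degPart _ _ ha
    obtain ⟨w, hw⟩ := hf d a ha'
    simp [← hw, comulAct_lof, hm, braid_tmul ha', map_sign_of_degree_zero hF]
    simp [gen]
  have hb : braid K V ∘ₗ comul K V = comul K V := LinearMap.ext braid_comul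
  ext x
  have hx := comul_coassoc x
  have h1 : TensorProduct.map f (TensorProduct.map F F ∘ₗ comul K V) (comul K V x) =
      TensorProduct.map f (TensorProduct.map F F)
        (TensorProduct.map LinearMap.id (comul K V) (comul K V x)) := by
    rw [← LinearMap.comp_apply (TensorProduct.map f (TensorProduct.map F F)),
      ← TensorProduct.map_comp, LinearMap.comp_id]
  have h2 := LinearMap.congr_fun key (TensorProduct.map LinearMap.id (comul K V) (comul K V x))
  simp only [LinearMap.comp_apply, LinearMap.add_apply, LinearEquiv.coe_coe] at h2
  rw [convTensor, LinearMap.comp_apply, LinearMap.comp_apply, h1, h2, ← hx,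
    LinearEquiv.symm_apply_apply, ← LinearMap.comp_apply (TensorProduct.map (braid K V) _),
    ← TensorProduct.map_comp, hb, LinearMap.comp_id, hx,
    ← LinearMap.comp_apply (TensorProduct.map m F), ← TensorProduct.map_comp,
    ← LinearMap.comp_apply (TensorProduct.map F m), ← TensorProduct.map_comp]
  rfl

/-- With F the exponential of f, both Δ ∘ F and (F ⊗ F) ∘ Δ solve E Y = f * Y and have the same
counit. Their difference X vanishes by induction on the weight. -/
theorem comul_cofree [CharZero K] {f : Sym K V →ₗ[K] ⨁ i, W i} (hf : f 1 = 0)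
    (hd : IsDegreeZero f) :
    comul K W ∘ₗ cofree f = TensorProduct.map (cofree f) (cofree f) ∘ₗ comul K V := by
  set F := cofree f with hF
  set X := comul K W ∘ₗ F - TensorProduct.map F F ∘ₗ comul K V with hX
  have hE : eulerTensor K W ∘ₗ X = convTensor f X := by
    have h1 : eulerTensor K W ∘ₗ comul K W ∘ₗ F = convTensor f (comul K W ∘ₗ F) := by
      rw [← comul_conv, ← euler_cofree hf]
      ext x
      exact (comul_euler _).symm
    have h2 : eulerTensor K W ∘ₗ TensorProduct.map F F ∘ₗ comul K V =
        convTensor f (TensorProduct.map F F ∘ₗ comul K V) := by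
      rw [convTensor_map hd (cofree_mem hf hd), ← euler_cofree hf, ← LinearMap.comp_assoc]
      congr 1
      refine TensorProduct.ext' fun a b => ?_
      simp [eulerTensor, hF]
    rw [hX, LinearMap.comp_sub, h1, h2]
    simp only [convTensor, tensor_map_sub_right, LinearMap.sub_comp, LinearMap.comp_sub]
  have hC : TensorProduct.map (counit K W) (counit K W) ∘ₗ X = 0 := by
    have hcF := counit_cofree hf
    rw [← hF] at hcF
    ext x
    have h := LinearMap.congr_fun hcF x
    rw [LinearMap.comp_apply] at h
    rw [hX, LinearMap.comp_apply, LinearMap.sub_apply, map_sub, LinearMap.comp_apply,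
      map_counit_comul, LinearMap.comp_apply,
      ← LinearMap.comp_apply (TensorProduct.map (counit K W) (counit K W)),
      ← TensorProduct.map_comp, hcF, map_counit_comul, h, sub_self, LinearMap.zero_apply]
  have h0 : ∀ n d, ∀ x ∈ homPart K V n d, X x = 0 := by
    intro n
    induction n using Nat.strong_induction_on with
    | _ n ih =>
      intro d x hx
      refine eq_zero_of_eulerTensor ?_ (LinearMap.congr_fun hC x)
      rw [← LinearMap.comp_apply, hE]
      exact convTensor_eq_zero hf (fun m d hm => ih m hm d) hx
  exact sub_eq_zero.mp (linearMap_ext_hom (g := 0) fun n d x hx => h0 n d x hx)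

theorem isCoalgHom_cofree [CharZero K] {f : Sym K V →ₗ[K] ⨁ i, W i} (hf : f 1 = 0)
    (hd : IsDegreeZero f) : IsCoalgHom (cofree f) where
  degree_zero := cofree_mem hf hd
  map_comul := comul_cofree hf hd
  map_counit := counit_cofree hf
  map_unit := cofree_one hf

/-- A map with vanishing counit satisfying `E X = f * X` vanishes. -/
theorem eq_zero_of_euler_eq_conv [CharZero K] {f : Sym K V →ₗ[K] ⨁ i, W i} (hf : f 1 = 0)
    {X : Sym K V →ₗ[K] Sym K W} (hE : euler ∘ₗ X = conv f X) (hc : counit K W ∘ₗ X = 0) :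
    X = 0 := by
  have h0 : ∀ n d, ∀ x ∈ homPart K V n d, X x = 0 := by
    intro n
    induction n using Nat.strong_induction_on with
    | _ n ih =>
      intro d x hx
      refine eq_zero_of_euler ?_ (LinearMap.congr_fun hc x)
      rw [← LinearMap.comp_apply, hE]
      exact conv_eq_zero hf (fun m d hm => ih m hm d) le_rfl hx
  exact linearMap_ext_hom fun n d x hx => by simpa using h0 n d x hx

/-- E is built from Δ and p alone, so compatibility with Δ forces the Euler equation with the Taylor
coefficients pF. -/
theorem IsCoalgHom.euler_comp {F : Sym K V →ₗ[K] Sym K W} (hF : IsCoalgHom F) :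
    euler ∘ₗ F = conv (proj K W ∘ₗ F) F := by
  rw [euler, LinearMap.comp_assoc, LinearMap.comp_assoc, hF.map_comul, ← LinearMap.comp_assoc _ _
    (TensorProduct.map _ _), ← TensorProduct.map_comp, LinearMap.id_comp]
  rfl

theorem IsCoalgHom.proj_one {F : Sym K V →ₗ[K] Sym K W} (hF : IsCoalgHom F) :
    (proj K W ∘ₗ F) 1 = 0 := by
  rw [LinearMap.comp_apply, hF.map_unit, LInf.proj_one]

theorem IsCoalgHom.isDegreeZero {F : Sym K V →ₗ[K] Sym K W} (hF : IsCoalgHom F) :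
    IsDegreeZero (proj K W ∘ₗ F) := fun d x hx =>
  proj_mem_of_mem_degPart d _ (hF.degree_zero d x hx)

theorem IsCoalgHom.comp {U : ℤ → Type*} [∀ i, AddCommGroup (U i)] [∀ i, Module K (U i)]
    {G : Sym K W →ₗ[K] Sym K U} {F : Sym K V →ₗ[K] Sym K W} (hG : IsCoalgHom G)
    (hF : IsCoalgHom F) : IsCoalgHom (G ∘ₗ F) where
  degree_zero d x hx := hG.degree_zero d _ (hF.degree_zero d x hx)
  map_comul := by
    rw [← LinearMap.comp_assoc, hG.map_comul, LinearMap.comp_assoc, hF.map_comul,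
      ← LinearMap.comp_assoc, ← TensorProduct.map_comp]
  map_counit := by rw [← LinearMap.comp_assoc, hG.map_counit, hF.map_counit]
  map_unit := by rw [LinearMap.comp_apply, hF.map_unit, hG.map_unit]

theorem IsCoalgHom.id : IsCoalgHom (LinearMap.id : Sym K V →ₗ[K] Sym K V) where
  degree_zero _ _ hx := hx
  map_comul := by simp
  map_counit := by simp
  map_unit := rfl

end Cofree

/-! ### The weight filtration and unipotent maps. -/

section Filtration

variable {K : Type u} [Field K]
variable {V : ℤ → Type v} [∀ i, AddCommGroup (V i)] [∀ i, Module K (V i)]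
variable {W : ℤ → Type w} [∀ i, AddCommGroup (W i)] [∀ i, Module K (W i)]

variable (K V) in
/-- The elements of `S(V)` of weight less than `n`. -/
def filt (n : ℕ) : Submodule K (Sym K V) where
  carrier := {x | ∀ m, n ≤ m → weightComp K V m x = 0}
  add_mem' hx hy m hm := by rw [map_add, hx m hm, hy m hm, add_zero]
  zero_mem' m _ := by rw [map_zero]
  smul_mem' c x hx m hm := by rw [map_smul, hx m hm, smul_zero]

theorem filt_mono {m n : ℕ} (h : m ≤ n) : filt K V m ≤ filt K V n :=
  fun _ hx k hk => hx k (h.trans hk)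

theorem eq_zero_of_mem_filt_zero {x : Sym K V} (hx : x ∈ filt K V 0) : x = 0 :=
  eq_zero_of_weightComp fun n => hx n n.zero_le

theorem exists_mem_filt (x : Sym K V) : ∃ n, x ∈ filt K V n := by
  refine ⟨(weight x).natDegree + 1, fun m hm => ?_⟩
  exact Polynomial.coeff_eq_zero_of_natDegree_lt (Nat.lt_of_succ_le hm)

theorem homPart_le_filt {m n : ℕ} (h : m < n) (d : ℤ) : homPart K V m d ≤ filt K V n := by
  intro x hx k hk
  rw [weightComp_of_mem hx, if_neg (by omega)]

theorem gen_mul_mem_filt (i : ℤ) (v : V i) {n : ℕ} {x : Sym K V} (hx : x ∈ filt K V n) :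
    gen K V i v * x ∈ filt K V (n + 1) := by
  intro m hm
  obtain ⟨m, rfl⟩ : ∃ k, m = k + 1 := ⟨m - 1, by omega⟩
  change (weight _).coeff _ = 0
  have h : (weight x).coeff m = 0 := hx m (by omega)
  rw [weight_gen_mul, Polynomial.coeff_monomial_mul, h, mul_zero]

theorem ι_mul_mem_filt (a : ⨁ i, V i) {n : ℕ} {x : Sym K V} (hx : x ∈ filt K V n) :
    ι K V a * x ∈ filt K V (n + 1) :=
  ι_mul_induction (P := fun z => z ∈ filt K V (n + 1)) a x (zero_mem _)
    (fun _ _ => add_mem) fun i v => gen_mul_mem_filt i v hx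

/-- The bound is n + 1 because E is blind to weight 0, which must therefore lie in the filtration
step. -/
theorem mem_filt_of_euler [CharZero K] {n : ℕ} {x : Sym K V} (hx : euler x ∈ filt K V (n + 1)) :
    x ∈ filt K V (n + 1) := by
  intro m hm
  have h := hx m hm
  rw [weightComp_euler] at h
  exact (smul_eq_zero.mp h).resolve_left (by exact_mod_cast (by omega : m ≠ 0))

theorem weightComp_mem (n : ℕ) (x : Sym K V) : weightComp K V n x ∈ ⨆ d, homPart K V n d := by
  induction x using hom_induction with
  | zero => simp
  | add x y hx hy => rw [map_add]; exact add_mem hx hy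
  | hom m d x hx =>
    rw [weightComp_of_mem hx]
    split_ifs with h
    · subst h
      exact Submodule.mem_iSup_of_mem d hx
    · exact zero_mem _

theorem apply_mem_of_mem_filt {M : Type*} [AddCommGroup M] [Module K M] (N : Submodule K M)
    (f : Sym K V →ₗ[K] M) {n : ℕ} (h : ∀ m d, m < n → ∀ x ∈ homPart K V m d, f x ∈ N)
    {x : Sym K V} (hx : x ∈ filt K V n) : f x ∈ N := by
  obtain ⟨k, hk⟩ := exists_sum_weightComp x
  rw [← hk k le_rfl, map_sum]
  refine sum_mem fun m _ => ?_
  rcases lt_or_ge m n with hm | hm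
  · refine Submodule.iSup_induction (motive := fun z => f z ∈ N) _ (weightComp_mem m x) ?_ ?_ ?_
    · exact fun d z hz => h m d hm z hz
    · rw [map_zero]; exact zero_mem _
    · intro y z hy hz
      rw [map_add]; exact add_mem hy hz
  · rw [hx m hm, map_zero]; exact zero_mem _

theorem conv_mem_filt {f : Sym K V →ₗ[K] ⨁ i, W i} {Y : Sym K V →ₗ[K] Sym K W} {n k : ℕ}
    {d : ℤ} {x : Sym K V} (hx : x ∈ homPart K V n d)
    (h : ∀ i j a b x y, i + j = n → x ∈ homPart K V i a → y ∈ homPart K V j b →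
      f x = 0 ∨ Y y ∈ filt K W k) : conv f Y x ∈ filt K W (k + 1) := by
  refine apply_comul_mem _ (LinearMap.mul' K (Sym K W) ∘ₗ TensorProduct.map (ι K W ∘ₗ f) Y) hx ?_
  intro i j a b x y hij _ hx hy
  rw [LinearMap.comp_apply, TensorProduct.map_tmul, LinearMap.mul'_apply, LinearMap.comp_apply]
  rcases h i j a b x y hij hx hy with h0 | h0
  · rw [h0, map_zero, zero_mul]; exact zero_mem _
  · exact ι_mul_mem_filt _ h0

/-- A map `X` with `E X = a * Y + b * X` lowers weights if `a` vanishes on `K ⊕ V` and `Y` does not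
raise weights. -/
theorem lowers_of_euler_eq [CharZero K] {a b : Sym K V →ₗ[K] ⨁ i, W i}
    {X Y : Sym K V →ₗ[K] Sym K W} (hE : euler ∘ₗ X = conv a Y + conv b X) (ha : a 1 = 0)
    (ha1 : a ∘ₗ ι K V = 0) (hb : b 1 = 0) (hX : X 1 = 0)
    (hY : ∀ n d, ∀ x ∈ homPart K V n d, Y x ∈ filt K W (n + 1)) (n : ℕ) (d : ℤ) (x : Sym K V)
    (hx : x ∈ homPart K V n d) : X x ∈ filt K W n := by
  induction n using Nat.strong_induction_on generalizing d x with
  | _ n ih =>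
    rcases Nat.eq_zero_or_pos n with rfl | hn
    · obtain ⟨c, rfl⟩ := exists_smul_one_of_mem hx
      rw [map_smul, hX, smul_zero]
      exact zero_mem _
    obtain ⟨n, rfl⟩ : ∃ k, n = k + 1 := ⟨n - 1, by omega⟩
    refine mem_filt_of_euler ?_
    rw [← LinearMap.comp_apply, hE, LinearMap.add_apply]
    refine add_mem (conv_mem_filt hx ?_) (conv_mem_filt hx ?_)
    · intro i j e e' x y hij hx hy
      -- Unless a kills it, the first factor has weight at least 2 while its value has weight 1.
      -- This spare unit makes X lower weights strictly.
      match i, hx with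
      | 0, hx =>
        obtain ⟨c, rfl⟩ := exists_smul_one_of_mem hx
        exact Or.inl (by rw [map_smul, ha, smul_zero])
      | 1, hx =>
        obtain ⟨v, rfl⟩ := exists_gen_of_mem hx
        exact Or.inl (LinearMap.congr_fun ha1 _)
      | i + 2, _ => exact Or.inr (filt_mono (by omega) (hY j e' y hy))
    · intro i j e e' x y hij hx hy
      rcases Nat.eq_zero_or_pos i with rfl | hi
      · obtain ⟨c, rfl⟩ := exists_smul_one_of_mem hx
        exact Or.inl (by rw [map_smul, hb, smul_zero])
      · exact Or.inr (filt_mono (by omega) (ih j (by omega) e' y hy))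

/-- In E F = (pF) * F the factor pF consumes at least one unit of weight and returns exactly one, so
weights are not raised. -/
theorem IsCoalgHom.mem_filt [CharZero K] {F : Sym K V →ₗ[K] Sym K W} (hF : IsCoalgHom F) (n : ℕ)
    (d : ℤ) (x : Sym K V) (hx : x ∈ homPart K V n d) : F x ∈ filt K W (n + 1) := by
  induction n using Nat.strong_induction_on generalizing d x with
  | _ n ih =>
    rcases Nat.eq_zero_or_pos n with rfl | hn
    · obtain ⟨c, rfl⟩ := exists_smul_one_of_mem hx
      rw [map_smul, hF.map_unit]
      exact Submodule.smul_mem _ _ (homPart_le_filt Nat.zero_lt_one 0 one_mem_homPart)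
    refine mem_filt_of_euler ?_
    rw [← LinearMap.comp_apply, hF.euler_comp]
    refine conv_mem_filt hx ?_
    intro i j e e' x y hij hx hy
    rcases Nat.eq_zero_or_pos i with rfl | hi
    · obtain ⟨c, rfl⟩ := exists_smul_one_of_mem hx
      exact Or.inl (by rw [map_smul, hF.proj_one, smul_zero])
    · exact Or.inr (filt_mono (by omega) (ih j (by omega) e' y hy))

/-- Subtracting the Euler equations gives E(F - G) = (pF - pG) * F + pG * (F - G), where pF - pG
kills weights 0 and 1. -/
theorem IsCoalgHom.sub_lowers [CharZero K] {F G : Sym K V →ₗ[K] Sym K W} (hF : IsCoalgHom F)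
    (hG : IsCoalgHom G) (h : proj K W ∘ₗ F ∘ₗ ι K V = proj K W ∘ₗ G ∘ₗ ι K V) (n : ℕ) (d : ℤ)
    (x : Sym K V) (hx : x ∈ homPart K V n d) : (F - G) x ∈ filt K W n := by
  refine lowers_of_euler_eq (a := proj K W ∘ₗ F - proj K W ∘ₗ G) (b := proj K W ∘ₗ G) (Y := F)
    ?_ ?_ ?_ hG.proj_one ?_ hF.mem_filt n d x hx
  · rw [LinearMap.comp_sub, hF.euler_comp, hG.euler_comp, conv_sub]
    have : conv (proj K W ∘ₗ F - proj K W ∘ₗ G) F =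
        conv (proj K W ∘ₗ F) F - conv (proj K W ∘ₗ G) F := by
      rw [eq_sub_iff_add_eq]
      simp only [conv, ← LinearMap.comp_add, ← LinearMap.add_comp, ← TensorProduct.map_add_left,
        sub_add_cancel]
    rw [this]
    abel
  · rw [LinearMap.sub_apply, hF.proj_one, hG.proj_one, sub_self]
  · rw [LinearMap.sub_comp, LinearMap.comp_assoc, LinearMap.comp_assoc, h, sub_self]
  · rw [LinearMap.sub_apply, hF.map_unit, hG.map_unit, sub_self]

theorem sub_mem_filt_of_lowers {T : Sym K V →ₗ[K] Sym K V}
    (hT : ∀ n d, ∀ x ∈ homPart K V n d, T x - x ∈ filt K V n)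
    {n : ℕ} {x : Sym K V} (hx : x ∈ filt K V (n + 1)) :
    T x - x ∈ filt K V n :=
  apply_mem_of_mem_filt (filt K V n) (T - LinearMap.id)
    (fun m d hm x hx => filt_mono (by omega) (hT m d x hx)) hx

theorem injective_of_lowers {T : Sym K V →ₗ[K] Sym K V}
    (hT : ∀ n d, ∀ x ∈ homPart K V n d, T x - x ∈ filt K V n) : Function.Injective T := by
  refine (injective_iff_map_eq_zero _).mpr fun x hx => ?_
  obtain ⟨n, hn⟩ := exists_mem_filt x
  induction n with
  | zero => exact eq_zero_of_mem_filt_zero hn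
  | succ n ih =>
    have h := sub_mem_filt_of_lowers hT hn
    rw [hx, zero_sub] at h
    exact ih (neg_mem_iff.mp h)

/-- Back substitution along the filtration: if T x = T y - y, then T (y - x) = y. Solving inside an
arbitrary stable N shows later that inverses preserve degrees. -/
theorem exists_of_lowers {T : Sym K V →ₗ[K] Sym K V}
    (hT : ∀ n d, ∀ x ∈ homPart K V n d, T x - x ∈ filt K V n)
    (N : Submodule K (Sym K V)) (hN : ∀ x ∈ N, T x ∈ N) (y : Sym K V)
    (hy : y ∈ N) : ∃ x ∈ N, T x = y := by
  obtain ⟨n, hn⟩ := exists_mem_filt y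
  induction n generalizing y with
  | zero => exact ⟨0, zero_mem _, by rw [map_zero, eq_zero_of_mem_filt_zero hn]⟩
  | succ n ih =>
    obtain ⟨x, hx, hxy⟩ := ih (T y - y) (sub_mem (hN y hy) hy) (sub_mem_filt_of_lowers hT hn)
    exact ⟨y - x, sub_mem hy hx, by rw [map_sub, hxy, sub_sub_cancel]⟩

theorem bijective_of_lowers {T : Sym K V →ₗ[K] Sym K V}
    (hT : ∀ n d, ∀ x ∈ homPart K V n d, T x - x ∈ filt K V n) : Function.Bijective T :=
  ⟨injective_of_lowers hT, fun y =>
    (exists_of_lowers hT ⊤ (fun _ _ => trivial) y trivial).imp fun _ h => h.2⟩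

end Filtration

/-! ### Functoriality of S(V) and inversion of coalgebra morphisms. -/

section Functoriality

variable {K : Type u} [Field K]
variable {V : ℤ → Type v} [∀ i, AddCommGroup (V i)] [∀ i, Module K (V i)]
variable {W : ℤ → Type w} [∀ i, AddCommGroup (W i)] [∀ i, Module K (W i)]

/-- The map of symmetric coalgebras induced by a map of graded vector spaces. -/
def symMap (g : ∀ i, V i →ₗ[K] W i) : Sym K V →ₐ[K] Sym K W :=
  lift (ι K W ∘ₗ DirectSum.lmap g) fun i j v w => by
    simp only [LinearMap.comp_apply, DirectSum.lmap_lof]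
    exact gen_mul_gen i j (g i v) (g j w)

theorem symMap_gen (g : ∀ i, V i →ₗ[K] W i) (i : ℤ) (v : V i) :
    symMap g (gen K V i v) = gen K W i (g i v) := by
  rw [symMap, lift_gen, LinearMap.comp_apply, DirectSum.lmap_lof]
  rfl

theorem symMap_ι (g : ∀ i, V i →ₗ[K] W i) (x : ⨁ i, V i) :
    symMap g (ι K V x) = ι K W (DirectSum.lmap g x) := lift_ι _ _ x

theorem symMap_mem (g : ∀ i, V i →ₗ[K] W i) (n : ℕ) (d : ℤ) (x : Sym K V)
    (hx : x ∈ homPart K V n d) : symMap g x ∈ homPart K W n d := by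
  refine Submodule.span_induction (p := fun x _ => symMap g x ∈ homPart K W n d) ?_ (by simp)
    (fun x y _ _ hx hy => by rw [map_add]; exact add_mem hx hy)
    (fun c x _ hx => by rw [map_smul]; exact Submodule.smul_mem _ c hx) hx
  rintro _ ⟨l, rfl, rfl, rfl⟩
  clear hx
  induction l with
  | nil => rw [listProd_nil, map_one]; exact one_mem_homPart
  | cons a l ih =>
    rw [listProd_cons, map_mul, symMap_gen]
    exact gen_mul_mem_homPart _ _ ih

theorem counit_symMap (g : ∀ i, V i →ₗ[K] W i) (x : Sym K V) :
    counit K W (symMap g x) = counit K V x := by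
  induction x using sym_induction with
  | one => rw [map_one, counit_one, counit_one]
  | add x y hx hy => simp only [map_add, hx, hy]
  | smul c x hx => simp only [map_smul, hx]
  | gen_mul i v x hx => rw [map_mul, symMap_gen, counit_gen_mul, counit_gen_mul]

theorem proj_symMap (g : ∀ i, V i →ₗ[K] W i) (x : Sym K V) :
    proj K W (symMap g x) = DirectSum.lmap g (proj K V x) := by
  induction x using sym_induction with
  | one => rw [map_one, proj_one, proj_one, map_zero]
  | add x y hx hy => simp only [map_add, hx, hy]
  | smul c x hx => simp only [map_smul, hx]
  | gen_mul i v x hx =>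
    rw [map_mul, symMap_gen, proj_gen_mul, proj_gen_mul, counit_symMap, map_smul,
      DirectSum.lmap_lof]

theorem isCoalgHom_symMap (g : ∀ i, V i →ₗ[K] W i) : IsCoalgHom (symMap g).toLinearMap where
  degree_zero d x hx := by
    refine degPart_induction (P := fun x => symMap g x ∈ degPart K W d) (by simp) ?_ ?_ hx
    · intro x y hx hy
      rw [map_add]; exact add_mem hx hy
    · intro n x hx
      exact homPart_le_degPart _ _ (symMap_mem g n d x hx)
  map_comul := by
    ext x
    simp only [LinearMap.comp_apply, AlgHom.toLinearMap_apply]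
    induction x using sym_induction with
    | one => simp [comul_one]
    | add x y hx hy => simp only [map_add, hx, hy]
    | smul c x hx => simp only [map_smul, hx]
    | gen_mul i v x hx =>
      have hs : ∀ a, symMap g (sign K V i a) = sign K W i (symMap g a) := by
        intro a
        induction a using hom_induction with
        | zero => simp
        | add x y hx hy => simp only [map_add, hx, hy]
        | hom n d a ha =>
          rw [sign_of_mem i ha, sign_of_mem i (symMap_mem g n d a ha), Units.smul_def, map_zsmul,
            Units.smul_def]
      rw [map_mul, symMap_gen, comul_gen_mul, comul_gen_mul, hx]
      generalize comul K V x = t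
      induction t using TensorProduct.induction_on with
      | zero => simp
      | add s t hs ht => simp only [map_add, hs, ht]
      | tmul a b => simp [comulAct_lof, symMap_gen, hs]
  map_counit := LinearMap.ext (counit_symMap g)
  map_unit := map_one (symMap g)

theorem symMap_comp {U : ℤ → Type*} [∀ i, AddCommGroup (U i)] [∀ i, Module K (U i)]
    (g : ∀ i, V i →ₗ[K] W i) (h : ∀ i, W i →ₗ[K] U i) (x : Sym K V) :
    symMap h (symMap g x) = symMap (fun i => h i ∘ₗ g i) x := by
  induction x using sym_induction with
  | one => simp only [map_one]
  | add x y hx hy => simp only [map_add, hx, hy]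
  | smul c x hx => simp only [map_smul, hx]
  | gen_mul i v x hx => simp only [map_mul, hx, symMap_gen, LinearMap.comp_apply]

theorem symMap_id (x : Sym K V) : symMap (fun i => (LinearMap.id : V i →ₗ[K] V i)) x = x := by
  induction x using sym_induction with
  | one => simp only [map_one]
  | add x y hx hy => simp only [map_add, hx, hy]
  | smul c x hx => simp only [map_smul, hx]
  | gen_mul i v x hx => simp only [map_mul, hx, symMap_gen, LinearMap.id_apply]

/-- The linear part in degree `i` of a coalgebra morphism. -/
def linPart (F : Sym K V →ₗ[K] Sym K W) (i : ℤ) : V i →ₗ[K] W i :=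
  DirectSum.component K ℤ W i ∘ₗ proj K W ∘ₗ F ∘ₗ gen K V i

theorem IsCoalgHom.proj_gen {F : Sym K V →ₗ[K] Sym K W} (hF : IsCoalgHom F) (i : ℤ) (v : V i) :
    proj K W (F (gen K V i v)) = DirectSum.lof K ℤ W i (linPart F i v) := by
  obtain ⟨w, hw⟩ := hF.isDegreeZero i _ (gen_mem_degPart i v)
  rw [LinearMap.comp_apply] at hw
  rw [linPart, LinearMap.comp_apply, LinearMap.comp_apply, LinearMap.comp_apply, ← hw,
    DirectSum.component.lof_self]

/-- A coalgebra morphism with invertible linear part is invertible. -/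
theorem IsCoalgHom.exists_inverse [CharZero K] {F : Sym K V →ₗ[K] Sym K W} (hF : IsCoalgHom F)
    (hb : ∀ i, Function.Bijective (linPart F i)) :
    ∃ G : Sym K W →ₗ[K] Sym K V, IsCoalgHom G ∧ F ∘ₗ G = LinearMap.id ∧ G ∘ₗ F = LinearMap.id := by
  let e : ∀ i, V i ≃ₗ[K] W i := fun i => LinearEquiv.ofBijective (linPart F i) (hb i)
  let S : Sym K W →ₗ[K] Sym K V := (symMap fun i => ((e i).symm : W i →ₗ[K] V i)).toLinearMap
  let S' : Sym K V →ₗ[K] Sym K W := (symMap fun i => ((e i) : V i →ₗ[K] W i)).toLinearMap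
  have hS : IsCoalgHom S := isCoalgHom_symMap _
  have hSS' : ∀ x, S (S' x) = x := fun x => by
    change symMap _ (symMap _ x) = x
    rw [symMap_comp]
    simp [symMap_id]
  have hS'S : ∀ x, S' (S x) = x := fun x => by
    change symMap _ (symMap _ x) = x
    rw [symMap_comp]
    simp [symMap_id]
  have hT : IsCoalgHom (S ∘ₗ F) := hS.comp hF
  -- After composing with S of the inverse linear part, the linear part is the identity, so S ∘ F is
  -- unipotent for the weight filtration.
  have hlow : ∀ n d, ∀ x ∈ homPart K V n d, (S ∘ₗ F) x - x ∈ filt K V n := by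
    intro n d x hx
    refine hT.sub_lowers IsCoalgHom.id ?_ n d x hx
    refine DirectSum.linearMap_ext K fun i => LinearMap.ext fun v => ?_
    have h : proj K W (F (ι K V (DirectSum.lof K ℤ V i v))) =
      DirectSum.lof K ℤ W i (linPart F i v) := hF.proj_gen i v
    simp only [LinearMap.comp_apply, LinearMap.id_apply, LInf.proj_ι]
    change proj K V (symMap _ _) = _
    rw [proj_symMap, h, DirectSum.lmap_lof]
    congr 1
    exact (e i).symm_apply_apply v
  let E := LinearEquiv.ofBijective (S ∘ₗ F) (bijective_of_lowers hlow)
  have hE : ∀ x, E.symm (S (F x)) = x := fun x => E.symm_apply_apply x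
  have hE' : ∀ x, S (F (E.symm x)) = x := fun x => E.apply_symm_apply x
  have hGF : ((E.symm : Sym K V →ₗ[K] Sym K V) ∘ₗ S) ∘ₗ F = LinearMap.id := LinearMap.ext hE
  have hFG : F ∘ₗ ((E.symm : Sym K V →ₗ[K] Sym K V) ∘ₗ S) = LinearMap.id := LinearMap.ext fun x => by
    change F (E.symm (S x)) = x
    rw [← hS'S (F _), hE', hS'S]
  refine ⟨(E.symm : Sym K V →ₗ[K] Sym K V) ∘ₗ S, ⟨?_, ?_, ?_, ?_⟩, hFG, hGF⟩
  · intro d x hx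
    obtain ⟨y, hy, hxy⟩ := exists_of_lowers hlow (degPart K V d) (hT.degree_zero d) (S x)
      (hS.degree_zero d x hx)
    change E.symm (S x) ∈ _
    rw [← hxy]
    exact (hE y).symm ▸ hy
  · set G := (E.symm : Sym K V →ₗ[K] Sym K V) ∘ₗ S
    calc comul K V ∘ₗ G = TensorProduct.map (G ∘ₗ F) (G ∘ₗ F) ∘ₗ comul K V ∘ₗ G := by
          rw [hGF, TensorProduct.map_id, LinearMap.id_comp]
      _ = TensorProduct.map G G ∘ₗ (TensorProduct.map F F ∘ₗ comul K V) ∘ₗ G := by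
          rw [TensorProduct.map_comp]; rfl
      _ = TensorProduct.map G G ∘ₗ comul K W ∘ₗ F ∘ₗ G := by
          rw [← hF.map_comul]; rfl
      _ = TensorProduct.map G G ∘ₗ comul K W := by rw [hFG, LinearMap.comp_id]
  · rw [← hF.map_counit, LinearMap.comp_assoc, hFG, LinearMap.comp_id]
  · change E.symm (S 1) = 1
    have h := hE 1
    rwa [hF.map_unit] at h

end Functoriality

/-! ### Coderivations along morphisms; composition, transport and inversion of algebras. -/

section Coderivations

variable {K : Type u} [Field K]
variable {V : ℤ → Type v} [∀ i, AddCommGroup (V i)] [∀ i, Module K (V i)]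
variable {W : ℤ → Type w} [∀ i, AddCommGroup (W i)] [∀ i, Module K (W i)]
variable {U : ℤ → Type*} [∀ i, AddCommGroup (U i)] [∀ i, Module K (U i)]

/-- `X` is an odd coderivation along the coalgebra morphism `F`. -/
def IsCoderAlong (F X : Sym K V →ₗ[K] Sym K W) : Prop :=
  comul K W ∘ₗ X =
    (TensorProduct.map X F + TensorProduct.map (F ∘ₗ (sign K V 1).toLinearMap) X) ∘ₗ comul K V

theorem map_counit_left {M : Type*} [AddCommGroup M] [Module K M] (g : Sym K V →ₗ[K] M)
    (x : Sym K V) : TensorProduct.map (counit K V) g (comul K V x) = 1 ⊗ₜ g x := by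
  have h := counit_comul x
  rw [← LinearEquiv.eq_symm_apply] at h
  have h' := congrArg (TensorProduct.map LinearMap.id g) h
  rw [← LinearMap.comp_apply, ← TensorProduct.map_comp] at h'
  simpa using h'

theorem map_counit_right {M : Type*} [AddCommGroup M] [Module K M] (g : Sym K V →ₗ[K] M)
    (x : Sym K V) : TensorProduct.map g (counit K V) (comul K V x) = g x ⊗ₜ 1 := by
  have h := comul_counit x
  rw [← LinearEquiv.eq_symm_apply] at h
  have h' := congrArg (TensorProduct.map g LinearMap.id) h
  rw [← LinearMap.comp_apply, ← TensorProduct.map_comp] at h'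
  simpa using h'

theorem IsCoderAlong.sub {F X Y : Sym K V →ₗ[K] Sym K W} (hX : IsCoderAlong F X)
    (hY : IsCoderAlong F Y) : IsCoderAlong F (X - Y) := by
  have h : TensorProduct.map (X - Y) F = TensorProduct.map X F - TensorProduct.map Y F :=
    TensorProduct.ext' fun a b => by simp [TensorProduct.sub_tmul]
  rw [IsCoderAlong, LinearMap.comp_sub, hX, hY, h, tensor_map_sub_right, ← LinearMap.sub_comp]
  congr 1
  abel

/-- Applying ε ⊗ ε to the co-Leibniz rule gives ε X = ε X + ε X. -/
theorem IsCoderAlong.counit_comp {F X : Sym K V →ₗ[K] Sym K W} (hF : IsCoalgHom F)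
    (hX : IsCoderAlong F X) : counit K W ∘ₗ X = 0 := by
  ext x
  have h1 := LinearMap.congr_fun hX x
  have h2 := congrArg (TensorProduct.map (counit K W) (counit K W)) h1
  have hs : counit K V ∘ₗ (sign K V 1).toLinearMap = counit K V := LinearMap.ext (counit_sign 1)
  rw [LinearMap.comp_apply, map_counit_comul, LinearMap.comp_apply, LinearMap.add_apply, map_add,
    ← LinearMap.comp_apply _ (TensorProduct.map X F), ← TensorProduct.map_comp,
    ← LinearMap.comp_apply _ (TensorProduct.map _ X),
    ← TensorProduct.map_comp, hF.map_counit, ← LinearMap.comp_assoc, hF.map_counit, hs,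
    map_counit_left, map_counit_right] at h2
  have h3 := congrArg (TensorProduct.lid K K) h2
  simp only [map_smul, map_add, TensorProduct.lid_tmul, LinearMap.comp_apply, smul_eq_mul,
    mul_one, one_mul] at h3
  simpa using h3

/-- A coderivation along a coalgebra morphism is determined by its Taylor coefficients. -/
theorem IsCoderAlong.eq_zero [CharZero K] {F X : Sym K V →ₗ[K] Sym K W} (hF : IsCoalgHom F)
    (hX : IsCoderAlong F X) (h : proj K W ∘ₗ X = 0) : X = 0 := by
  -- The co-Leibniz rule gives E X = (pX) * F + (pF ∘ sign) * X, and the first term is zero by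
  -- hypothesis.
  refine eq_zero_of_euler_eq_conv (f := proj K W ∘ₗ F ∘ₗ (sign K V 1).toLinearMap) ?_ ?_ ?_
  · simp [hF.map_unit, LInf.proj_one]
  · rw [euler, LinearMap.comp_assoc, LinearMap.comp_assoc, hX, LinearMap.add_comp,
      LinearMap.comp_add, ← LinearMap.comp_assoc _ _ (TensorProduct.map _ _),
      ← TensorProduct.map_comp, ← LinearMap.comp_assoc _ _ (TensorProduct.map _ _),
      ← TensorProduct.map_comp, LinearMap.comp_assoc, h, LinearMap.comp_zero,
      TensorProduct.map_zero_left, LinearMap.zero_comp, zero_add]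
    rfl
  · exact hX.counit_comp hF

theorem IsCoderAlong.ext [CharZero K] {F X Y : Sym K V →ₗ[K] Sym K W} (hF : IsCoalgHom F)
    (hX : IsCoderAlong F X) (hY : IsCoderAlong F Y) (h : proj K W ∘ₗ X = proj K W ∘ₗ Y) : X = Y :=
  sub_eq_zero.mp ((hX.sub hY).eq_zero hF (by rw [LinearMap.comp_sub, h, sub_self]))

theorem IsCoalgHom.comp_sign {F : Sym K V →ₗ[K] Sym K W} (hF : IsCoalgHom F) (k : ℤ) :
    F ∘ₗ (sign K V k).toLinearMap = (sign K W k).toLinearMap ∘ₗ F :=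
  LinearMap.ext (map_sign_of_degree_zero hF.degree_zero k)

theorem IsCoderAlong.comp_left {F X : Sym K V →ₗ[K] Sym K W} (hX : IsCoderAlong F X)
    {G : Sym K W →ₗ[K] Sym K U} (hG : IsCoalgHom G) : IsCoderAlong (G ∘ₗ F) (G ∘ₗ X) := by
  rw [IsCoderAlong, ← LinearMap.comp_assoc, hG.map_comul, LinearMap.comp_assoc, hX,
    LinearMap.comp_assoc, TensorProduct.map_comp, TensorProduct.map_comp, ← LinearMap.comp_add]
  rfl

theorem IsCoderAlong.comp_right {F X : Sym K W →ₗ[K] Sym K U} (hX : IsCoderAlong F X)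
    {G : Sym K V →ₗ[K] Sym K W} (hG : IsCoalgHom G) : IsCoderAlong (F ∘ₗ G) (X ∘ₗ G) := by
  rw [IsCoderAlong, ← LinearMap.comp_assoc, hX, LinearMap.comp_assoc, hG.map_comul,
    LinearMap.comp_assoc _ G F, hG.comp_sign, ← LinearMap.comp_assoc G, TensorProduct.map_comp,
    TensorProduct.map_comp, ← LinearMap.add_comp]
  rfl

theorem Alg.isCoderAlong (A : Alg K V) : IsCoderAlong LinearMap.id A.Q := A.coderivation

theorem Hom.isCoalgHom {A : Alg K V} {B : Alg K W} (F : Hom A B) : IsCoalgHom F.F :=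
  ⟨F.degree_zero, F.map_comul, F.map_counit, F.map_unit⟩

/-- A coalgebra morphism is an `L∞[1]` morphism if it is compatible with the Taylor coefficients. -/
def Hom.ofProj [CharZero K] {A : Alg K V} {B : Alg K W} (F : Sym K V →ₗ[K] Sym K W)
    (hF : IsCoalgHom F) (h : proj K W ∘ₗ F ∘ₗ A.Q = proj K W ∘ₗ B.Q ∘ₗ F) : Hom A B where
  F := F
  degree_zero := hF.degree_zero
  map_comul := hF.map_comul
  map_counit := hF.map_counit
  map_unit := hF.map_unit
  map_Q := IsCoderAlong.ext hF (A.isCoderAlong.comp_left hF) (B.isCoderAlong.comp_right hF) h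

/-- Composition of `L∞[1]` morphisms. -/
def Hom.comp {A : Alg K V} {B : Alg K W} {C : Alg K U} (G : Hom B C) (F : Hom A B) : Hom A C where
  F := G.F ∘ₗ F.F
  degree_zero := (G.isCoalgHom.comp F.isCoalgHom).degree_zero
  map_comul := (G.isCoalgHom.comp F.isCoalgHom).map_comul
  map_counit := (G.isCoalgHom.comp F.isCoalgHom).map_counit
  map_unit := (G.isCoalgHom.comp F.isCoalgHom).map_unit
  map_Q := by
    rw [LinearMap.comp_assoc, F.map_Q, ← LinearMap.comp_assoc, G.map_Q, LinearMap.comp_assoc]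

theorem Hom.f₁_comp [CharZero K] {A : Alg K V} {B : Alg K W} {C : Alg K U} (G : Hom B C)
    (F : Hom A B) (x : ⨁ i, V i) : (G.comp F).f₁ x = G.f₁ (F.f₁ x) := by
  change proj K U (G.F (F.F (ι K V x))) = _
  rw [F.F_ι]
  rfl

theorem Hom.f₁Deg_comp [CharZero K] {A : Alg K V} {B : Alg K W} {C : Alg K U} (G : Hom B C)
    (F : Hom A B) (i : ℤ) (x : V i) : (G.comp F).f₁Deg i x = G.f₁Deg i (F.f₁Deg i x) := by
  have h := (G.comp F).f₁_lof i x
  rw [f₁_comp, f₁_lof, f₁_lof] at h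
  exact DirectSum.of_injective (β := U) i h.symm

theorem Hom.mapH_comp [CharZero K] {A : Alg K V} {B : Alg K W} {C : Alg K U} (G : Hom B C)
    (F : Hom A B) (i : ℤ) : (G.comp F).mapH i = G.mapH i ∘ₗ F.mapH i := by
  refine LinearMap.ext fun x => ?_
  obtain ⟨x, rfl⟩ := Submodule.mkQ_surjective _ x
  change C.cls i _ = C.cls i _
  congr 1
  exact Subtype.ext (f₁Deg_comp G F i x)

theorem Hom.mapH_eq_id [CharZero K] {A : Alg K V} (F : Hom A A)
    (h : ∀ i x, F.f₁Deg i x = x) (i : ℤ) : F.mapH i = LinearMap.id := by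
  refine LinearMap.ext fun x => ?_
  obtain ⟨x, rfl⟩ := Submodule.mkQ_surjective _ x
  change A.cls i _ = A.cls i _
  congr 1
  exact Subtype.ext (h i x)

theorem Hom.f₁Deg_eq_of_F_eq_id {A : Alg K V} (F : Hom A A) (h : F.F = LinearMap.id) (i : ℤ)
    (x : V i) : F.f₁Deg i x = x := by
  change DirectSum.component K ℤ V i (proj K V (F.F (gen K V i x))) = x
  rw [h, LinearMap.id_apply, LInf.proj_gen, DirectSum.component.lof_self]

theorem Hom.IsWeakEquiv.comp [CharZero K] {A : Alg K V} {B : Alg K W} {C : Alg K U}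
    {G : Hom B C} {F : Hom A B} (hG : G.IsWeakEquiv) (hF : F.IsWeakEquiv) :
    (G.comp F).IsWeakEquiv := fun i => by
  rw [mapH_comp, LinearMap.coe_comp]
  exact (hG i).comp (hF i)

theorem Hom.isWeakEquiv_of_comp_eq_id [CharZero K] {A : Alg K V} {B : Alg K W} {G : Hom B A}
    {F : Hom A B} (h : G.F ∘ₗ F.F = LinearMap.id) (hF : F.IsWeakEquiv) : G.IsWeakEquiv := by
  intro i
  have h1 : (G.comp F).mapH i = LinearMap.id :=
    mapH_eq_id _ (fun i x => f₁Deg_eq_of_F_eq_id (G.comp F) h i x) i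
  rw [mapH_comp] at h1
  have h2 : Function.LeftInverse (G.mapH i) (F.mapH i) := fun x => LinearMap.congr_fun h1 x
  refine ⟨?_, h2.surjective⟩
  intro x y hxy
  obtain ⟨x, rfl⟩ := (hF i).surjective x
  obtain ⟨y, rfl⟩ := (hF i).surjective y
  rw [h2, h2] at hxy
  rw [hxy]

theorem Hom.isWeakEquiv_of_inverse [CharZero K] {A : Alg K V} {B : Alg K W} {G : Hom B A}
    {F : Hom A B} (h : G.F ∘ₗ F.F = LinearMap.id) (h' : F.F ∘ₗ G.F = LinearMap.id) :
    F.IsWeakEquiv := by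
  intro i
  have h1 : (G.comp F).mapH i = LinearMap.id :=
    mapH_eq_id _ (fun i x => f₁Deg_eq_of_F_eq_id (G.comp F) h i x) i
  have h2 : (F.comp G).mapH i = LinearMap.id :=
    mapH_eq_id _ (fun i x => f₁Deg_eq_of_F_eq_id (F.comp G) h' i x) i
  rw [mapH_comp] at h1 h2
  exact ⟨Function.LeftInverse.injective (g := G.mapH i) fun x => LinearMap.congr_fun h1 x,
    Function.RightInverse.surjective (g := G.mapH i) fun x => LinearMap.congr_fun h2 x⟩

/-- The structure transported along an isomorphism of coalgebras. -/
def Alg.transport [CharZero K] (A : Alg K V) {F : Sym K V →ₗ[K] Sym K W}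
    {G : Sym K W →ₗ[K] Sym K V} (hF : IsCoalgHom F) (hG : IsCoalgHom G)
    (hFG : F ∘ₗ G = LinearMap.id) (hGF : G ∘ₗ F = LinearMap.id) : Alg K W where
  Q := F ∘ₗ A.Q ∘ₗ G
  degree_one d x hx := hF.degree_zero _ _ (A.degree_one _ _ (hG.degree_zero d x hx))
  coderivation := by
    have h := (A.isCoderAlong.comp_right hG).comp_left hF
    rwa [LinearMap.id_comp, hFG] at h
  constant_part := by
    rw [LinearMap.comp_apply, LinearMap.comp_apply, hG.map_unit, A.Q_one, map_zero, map_zero]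
  square_zero := by
    have h : ∀ x, G (F x) = x := LinearMap.congr_fun hGF
    ext x
    simp only [LinearMap.comp_apply, h, LinearMap.zero_apply]
    rw [← LinearMap.comp_apply A.Q, A.square_zero, LinearMap.zero_apply, map_zero]

/-- The isomorphism from an algebra to a transported one. -/
def Alg.toTransport [CharZero K] (A : Alg K V) {F : Sym K V →ₗ[K] Sym K W}
    {G : Sym K W →ₗ[K] Sym K V} (hF : IsCoalgHom F) (hG : IsCoalgHom G)
    (hFG : F ∘ₗ G = LinearMap.id) (hGF : G ∘ₗ F = LinearMap.id) :
    Hom A (A.transport hF hG hFG hGF) where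
  F := F
  degree_zero := hF.degree_zero
  map_comul := hF.map_comul
  map_counit := hF.map_counit
  map_unit := hF.map_unit
  map_Q := by
    change _ = F ∘ₗ A.Q ∘ₗ G ∘ₗ F
    rw [hGF, LinearMap.comp_id]

/-- The inverse of an `L∞[1]` morphism which is an isomorphism of coalgebras. -/
def Hom.inverse {A : Alg K V} {B : Alg K W} (F : Hom A B) {G : Sym K W →ₗ[K] Sym K V}
    (hG : IsCoalgHom G) (hFG : F.F ∘ₗ G = LinearMap.id) (hGF : G ∘ₗ F.F = LinearMap.id) :
    Hom B A where
  F := G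
  degree_zero := hG.degree_zero
  map_comul := hG.map_comul
  map_counit := hG.map_counit
  map_unit := hG.map_unit
  map_Q := by
    calc G ∘ₗ B.Q = G ∘ₗ B.Q ∘ₗ F.F ∘ₗ G := by rw [hFG, LinearMap.comp_id]
      _ = (G ∘ₗ F.F) ∘ₗ A.Q ∘ₗ G := by
        rw [← LinearMap.comp_assoc _ _ B.Q, ← F.map_Q]; rfl
      _ = A.Q ∘ₗ G := by rw [hGF, LinearMap.id_comp]

theorem Alg.toTransport_isWeakEquiv [CharZero K] (A : Alg K V) {F : Sym K V →ₗ[K] Sym K W}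
    {G : Sym K W →ₗ[K] Sym K V} (hF : IsCoalgHom F) (hG : IsCoalgHom G)
    (hFG : F ∘ₗ G = LinearMap.id) (hGF : G ∘ₗ F = LinearMap.id) :
    (A.toTransport hF hG hFG hGF).IsWeakEquiv :=
  Hom.isWeakEquiv_of_inverse (G := (A.toTransport hF hG hFG hGF).inverse hG hFG hGF) hGF hFG

theorem Alg.IsMinimal.mem_cocycles {A : Alg K V} (hA : A.IsMinimal) (i : ℤ) (x : V i) :
    x ∈ A.cocycles i := by
  change A.d _ = 0
  rw [show A.d = 0 from hA, LinearMap.zero_apply]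

/-- For a minimal algebra the cohomology is the underlying space. -/
def Alg.IsMinimal.toH {A : Alg K V} (hA : A.IsMinimal) (i : ℤ) : V i →ₗ[K] A.H i :=
  A.cls i ∘ₗ LinearMap.id.codRestrict (A.cocycles i) (hA.mem_cocycles i)

theorem Alg.IsMinimal.toH_bijective {A : Alg K V} (hA : A.IsMinimal) (i : ℤ) :
    Function.Bijective (hA.toH i) := by
  constructor
  · refine (injective_iff_map_eq_zero _).mpr fun x hx => ?_
    obtain ⟨y, hy⟩ := (Submodule.Quotient.mk_eq_zero _).mp hx
    rw [show A.d = 0 from hA] at hy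
    exact (DirectSum.of_injective (β := V) i) (by rw [map_zero]; exact hy.symm)
  · intro y
    obtain ⟨x, rfl⟩ := Submodule.mkQ_surjective _ y
    exact ⟨x, rfl⟩

/-- With zero differentials the linear part is itself the map on cohomology. Hence weak equivalences
of minimal algebras are isomorphisms. -/
theorem Hom.f₁Deg_bijective [CharZero K] {A : Alg K V} {B : Alg K W} (hA : A.IsMinimal)
    (hB : B.IsMinimal) {F : Hom A B} (hF : F.IsWeakEquiv) (i : ℤ) :
    Function.Bijective (F.f₁Deg i) := by
  have h : F.mapH i ∘ hA.toH i = hB.toH i ∘ F.f₁Deg i := rfl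
  have h1 : Function.Bijective (hB.toH i ∘ F.f₁Deg i) :=
    h ▸ (hF i).comp (hA.toH_bijective i)
  exact ((hB.toH_bijective i).of_comp_iff' _).mp h1

/-- An `L∞[1]` morphism with invertible linear part is invertible. -/
theorem Hom.exists_inverse [CharZero K] {A : Alg K V} {B : Alg K W} (F : Hom A B)
    (h : ∀ i, Function.Bijective (F.f₁Deg i)) :
    ∃ G : Hom B A, F.F ∘ₗ G.F = LinearMap.id ∧ G.F ∘ₗ F.F = LinearMap.id := by
  obtain ⟨G, hG, hFG, hGF⟩ := F.isCoalgHom.exists_inverse h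
  exact ⟨F.inverse hG hFG hGF, hFG, hGF⟩

end Coderivations

/-! ### Coderivations with only a linear Taylor coefficient. -/

section LinearCoderivations

variable {K : Type u} [Field K] {V : ℤ → Type v} [∀ i, AddCommGroup (V i)] [∀ i, Module K (V i)]

/-- The linear map `g` on `V` has degree `k`. -/
def HasDegree (g : (⨁ i, V i) →ₗ[K] ⨁ i, V i) (k : ℤ) : Prop :=
  ∀ i (v : V i), ∃ w : V (i + k), g (DirectSum.lof K ℤ V i v) = DirectSum.lof K ℤ V (i + k) w

/-- The extension of a linear map `V → V` to a coderivation, and derivation, of `S(V)`. -/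
def linCoder (g : (⨁ i, V i) →ₗ[K] ⨁ i, V i) : Sym K V →ₗ[K] Sym K V :=
  conv (g ∘ₗ proj K V) LinearMap.id

variable {g : (⨁ i, V i) →ₗ[K] ⨁ i, V i} {k : ℤ}

theorem linCoder_one : linCoder g 1 = 0 := by
  simp [linCoder, conv, comul_one, proj_one]

theorem HasDegree.signV_comm (hg : HasDegree g k) (i : ℤ) (v : V i) (x : ⨁ i, V i) :
    ι K V (g (signV K V i x)) * gen K V i v =
      (k * i).negOnePow • (gen K V i v * ι K V (g x)) := by
  induction x using DirectSum.induction_on with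
  | zero => simp
  | of j w =>
    change ι K V (g (signV K V i (DirectSum.lof K ℤ V j w))) * _ =
      _ • (_ * ι K V (g (DirectSum.lof K ℤ V j w)))
    obtain ⟨u, hu⟩ := hg j w
    rw [signV_lof, Units.smul_def, map_zsmul, map_zsmul, hu]
    change _ • gen K V _ u * _ = _ • (_ * gen K V _ u)
    rw [smul_mul_assoc, gen_mul_gen, ← Units.smul_def, smul_smul, ← Int.negOnePow_add]
    congr 1
    rw [Int.negOnePow_eq_iff]
    exact ⟨i * j, by ring⟩
  | add x y hx hy => simp only [map_add, add_mul, mul_add, hx, hy, smul_add]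

/-- A coderivation with only a linear coefficient is also a graded derivation of the product; this
recursion computes it on generators. -/
theorem HasDegree.linCoder_gen_mul (hg : HasDegree g k) (i : ℤ) (v : V i) (x : Sym K V) :
    linCoder g (gen K V i v * x) = ι K V (g (DirectSum.lof K ℤ V i v)) * x +
      (k * i).negOnePow • (gen K V i v * linCoder g x) := by
  have key : ∀ t : Sym K V ⊗[K] Sym K V,
      LinearMap.mul' K (Sym K V) (TensorProduct.map (ι K V ∘ₗ g ∘ₗ proj K V) LinearMap.id
        (comulAct K V (DirectSum.lof K ℤ V i v) t)) =
      ι K V (g (DirectSum.lof K ℤ V i v)) * TensorProduct.lid K (Sym K V)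
        (TensorProduct.map (counit K V) LinearMap.id t) +
      (k * i).negOnePow • (gen K V i v * LinearMap.mul' K (Sym K V)
        (TensorProduct.map (ι K V ∘ₗ g ∘ₗ proj K V) LinearMap.id t)) := by
    intro t
    induction t using TensorProduct.induction_on with
    | zero => simp
    | add s t hs ht =>
      simp only [map_add, hs, ht, mul_add, smul_add]
      abel
    | tmul a b =>
      simp only [comulAct_lof, map_add, TensorProduct.map_tmul, LinearMap.comp_apply,
        proj_gen_mul, proj_sign, LinearMap.id_apply, LinearMap.mul'_apply, ← mul_assoc,
        hg.signV_comm, TensorProduct.lid_tmul, map_smul, smul_mul_assoc, mul_smul_comm,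
        Units.smul_def]
  change LinearMap.mul' K (Sym K V) (TensorProduct.map (ι K V ∘ₗ g ∘ₗ proj K V) LinearMap.id
    (comul K V (gen K V i v * x))) = _
  rw [comul_gen_mul, key, counit_comul]
  rfl

theorem linCoder_ι (hg : HasDegree g k) (x : ⨁ i, V i) :
    linCoder g (ι K V x) = ι K V (g x) := by
  induction x using DirectSum.induction_on with
  | zero => simp
  | of i v =>
    have h := hg.linCoder_gen_mul i v 1
    rw [linCoder_one, mul_one, mul_one, mul_zero, smul_zero, add_zero] at h
    exact h
  | add x y hx hy => simp only [map_add, hx, hy]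

theorem proj_linCoder (x : Sym K V) : proj K V (linCoder g x) = g (proj K V x) := by
  rw [linCoder, proj_conv 1 (by simp), one_smul, LinearMap.comp_apply]

theorem HasDegree.linCoder_mem (hg : HasDegree g k) {n : ℕ} {d : ℤ} {x : Sym K V}
    (hx : x ∈ homPart K V n d) : linCoder g x ∈ homPart K V n (d + k) := by
  refine Submodule.span_induction (p := fun x _ => linCoder g x ∈ homPart K V n (d + k)) ?_
    (by simp) (fun x y _ _ hx hy => by rw [map_add]; exact add_mem hx hy)
    (fun c x _ hx => by rw [map_smul]; exact Submodule.smul_mem _ c hx) hx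
  rintro _ ⟨l, rfl, rfl, rfl⟩
  clear hx
  induction l with
  | nil => rw [listProd_nil, linCoder_one]; exact zero_mem _
  | cons a l ih =>
    obtain ⟨w, hw⟩ := hg a.1 a.2
    rw [listProd_cons, hg.linCoder_gen_mul, hw, List.map_cons, List.sum_cons, List.length_cons]
    refine add_mem ?_ ?_
    · have h := gen_mul_mem_homPart (a.1 + k) w (listProd_mem (K := K) l)
      rwa [add_right_comm] at h
    · rw [Units.smul_def, ← Int.cast_smul_eq_zsmul K, add_assoc]
      exact Submodule.smul_mem _ _ (gen_mul_mem_homPart _ _ ih)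

theorem HasDegree.linCoder_mem_degPart (hg : HasDegree g k) {d : ℤ} {x : Sym K V}
    (hx : x ∈ degPart K V d) : linCoder g x ∈ degPart K V (d + k) := by
  refine degPart_induction (P := fun x => linCoder g x ∈ degPart K V (d + k)) (by simp) ?_ ?_ hx
  · intro x y hx hy
    rw [map_add]; exact add_mem hx hy
  · intro n x hx
    exact homPart_le_degPart _ _ (hg.linCoder_mem hx)

theorem HasDegree.linCoder_sign (hg : HasDegree g k) (m : ℤ) (x : Sym K V) :
    linCoder g (sign K V m x) = (k * m).negOnePow • sign K V m (linCoder g x) := by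
  induction x using hom_induction with
  | zero => simp
  | add x y hx hy => simp only [map_add, hx, hy, smul_add]
  | hom n d x hx =>
    rw [sign_of_mem m hx, sign_of_mem m (hg.linCoder_mem hx), Units.smul_def, map_zsmul,
      ← Units.smul_def, smul_smul, ← Int.negOnePow_add]
    congr 1
    rw [Int.negOnePow_eq_iff]
    exact ⟨-(m * k), by ring⟩

theorem sign_add (k l : ℤ) (x : Sym K V) : sign K V (k + l) x = sign K V k (sign K V l x) := by
  induction x using hom_induction with
  | zero => simp
  | add x y hx hy => simp only [map_add, hx, hy]
  | hom n d x hx =>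
    rw [sign_of_mem _ hx, sign_of_mem l hx, Units.smul_def, Units.smul_def, map_zsmul,
      sign_of_mem k hx, ← Units.smul_def, ← Units.smul_def, smul_smul, ← Int.negOnePow_add]
    congr 2
    ring

theorem HasDegree.comul_linCoder (hg : HasDegree g k) (x : Sym K V) :
    comul K V (linCoder g x) = TensorProduct.map (linCoder g) LinearMap.id (comul K V x) +
      TensorProduct.map (sign K V k).toLinearMap (linCoder g) (comul K V x) := by
  induction x using sym_induction with
  | one => simp [comul_one, linCoder_one]
  | add x y hx hy =>
    simp only [map_add, hx, hy]
    abel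
  | smul c x hx => simp only [map_smul, hx, smul_add]
  | gen_mul i v x hx =>
    obtain ⟨w, hw⟩ := hg i v
    rw [hg.linCoder_gen_mul, map_add, comul_ι_mul, Units.smul_def, map_zsmul, comul_gen_mul,
      comul_gen_mul, hx, hw]
    generalize comul K V x = t
    induction t using TensorProduct.induction_on with
    | zero => simp
    | add s t hs ht =>
      simp only [map_add, smul_add] at hs ht ⊢
      rw [add_add_add_comm, add_add_add_comm (TensorProduct.map _ _ _), ← hs, ← ht]
      abel
    | tmul a b =>
      have hc : sign K V (i + k) a = sign K V k (sign K V i a) := by rw [add_comm, sign_add]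
      simp only [comulAct_lof, map_add, TensorProduct.map_tmul,
        LinearMap.id_apply, hg.linCoder_gen_mul, TensorProduct.add_tmul, TensorProduct.tmul_add,
        AlgHom.toLinearMap_apply, map_mul, sign_gen, hw, hg.linCoder_sign, hc, Units.smul_def,
        smul_mul_assoc, smul_add, TensorProduct.smul_tmul', TensorProduct.tmul_smul,
        sign_comm K V i k]
      change _ = (gen K V (i + k) w * a) ⊗ₜ[K] b + _ + _ + (_ + (_ ⊗ₜ[K] (gen K V (i + k) w * b) + _))
      abel

end LinearCoderivations

/-! ### Counting factors in one summand of V. -/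

section Splitting

variable {K : Type u} [Field K] {V : ℤ → Type v} [∀ i, AddCommGroup (V i)] [∀ i, Module K (V i)]

theorem hasDegree_lmap (f : ∀ i, V i →ₗ[K] V i) : HasDegree (DirectSum.lmap f) 0 := by
  intro i v
  have h : ∀ j, j = i → ∃ w : V j,
      DirectSum.lmap f (DirectSum.lof K ℤ V i v) = DirectSum.lof K ℤ V j w := by
    rintro j rfl
    exact ⟨f j v, DirectSum.lmap_lof _ _ _⟩
  exact h _ (add_zero i)

theorem linCoder_lmap_gen_mul (f : ∀ i, V i →ₗ[K] V i) (i : ℤ) (v : V i) (x : Sym K V) :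
    linCoder (DirectSum.lmap f) (gen K V i v * x) =
      gen K V i (f i v) * x + gen K V i v * linCoder (DirectSum.lmap f) x := by
  rw [(hasDegree_lmap f).linCoder_gen_mul, DirectSum.lmap_lof, zero_mul, Int.negOnePow_zero,
    one_smul]
  rfl

/-- The algebra map `S(V) → S(V)[t]` with `v ↦ e v + (f v) t`. -/
def splitHom (e f : ∀ i, V i →ₗ[K] V i) : Sym K V →ₐ[K] Polynomial (Sym K V) :=
  lift
    { toFun := fun v => Polynomial.monomial 0 (ι K V (DirectSum.lmap e v)) +
        Polynomial.monomial 1 (ι K V (DirectSum.lmap f v))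
      map_add' := fun v w => by
        simp only [map_add]
        abel
      map_smul' := fun c v => by
        simp only [map_smul, RingHom.id_apply, ← Polynomial.smul_monomial, smul_add] }
    (by
      intro i j v w
      have h1 := gen_mul_gen (K := K) i j (e i v) (e j w)
      have h2 := gen_mul_gen (K := K) i j (e i v) (f j w)
      have h3 := gen_mul_gen (K := K) i j (f i v) (e j w)
      have h4 := gen_mul_gen (K := K) i j (f i v) (f j w)
      simp only [LinearMap.coe_mk, AddHom.coe_mk, DirectSum.lmap_lof, add_mul, mul_add,
        Polynomial.monomial_mul_monomial]
      change Polynomial.monomial _ (gen K V i (e i v) * gen K V j (e j w)) +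
        Polynomial.monomial _ (gen K V i (f i v) * gen K V j (e j w)) +
        (Polynomial.monomial _ (gen K V i (e i v) * gen K V j (f j w)) +
        Polynomial.monomial _ (gen K V i (f i v) * gen K V j (f j w))) = _ • (
        Polynomial.monomial _ (gen K V j (e j w) * gen K V i (e i v)) +
        Polynomial.monomial _ (gen K V j (f j w) * gen K V i (e i v)) +
        (Polynomial.monomial _ (gen K V j (e j w) * gen K V i (f i v)) +
        Polynomial.monomial _ (gen K V j (f j w) * gen K V i (f i v))))
      rw [h1, h2, h3, h4]
      simp only [Units.smul_def, map_zsmul, smul_add]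
      abel)

variable {e f : ∀ i, V i →ₗ[K] V i}

theorem splitHom_gen_mul (i : ℤ) (v : V i) (x : Sym K V) :
    splitHom e f (gen K V i v * x) =
      (Polynomial.monomial 0 (gen K V i (e i v)) + Polynomial.monomial 1 (gen K V i (f i v))) *
        splitHom e f x := by
  rw [map_mul]
  congr 1
  rw [splitHom, lift_gen]
  simp only [LinearMap.coe_mk, AddHom.coe_mk, DirectSum.lmap_lof]
  rfl

theorem coeff_splitHom_zero (x : Sym K V) : (splitHom e f x).coeff 0 = symMap e x := by
  induction x using sym_induction with
  | one => simp
  | add x y hx hy => simp only [map_add, Polynomial.coeff_add, hx, hy]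
  | smul c x hx => simp only [map_smul, Polynomial.coeff_smul, hx]
  | gen_mul i v x hx =>
    rw [splitHom_gen_mul, Polynomial.mul_coeff_zero, hx, map_mul, symMap_gen]
    simp [Polynomial.coeff_monomial]

theorem coeff_splitHom_succ (i : ℤ) (v : V i) (x : Sym K V) (k : ℕ) :
    (splitHom e f (gen K V i v * x)).coeff (k + 1) =
      gen K V i (e i v) * (splitHom e f x).coeff (k + 1) +
        gen K V i (f i v) * (splitHom e f x).coeff k := by
  rw [splitHom_gen_mul, add_mul, Polynomial.coeff_add, Polynomial.monomial_zero_left,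
    Polynomial.coeff_C_mul, Polynomial.coeff_monomial_mul]

theorem coeff_splitHom_mem (k : ℕ) {n : ℕ} {d : ℤ} {x : Sym K V} (hx : x ∈ homPart K V n d) :
    (splitHom e f x).coeff k ∈ homPart K V n d := by
  refine Submodule.span_induction (p := fun x _ => (splitHom e f x).coeff k ∈ homPart K V n d) ?_
    (by simp) (fun x y _ _ hx hy => by rw [map_add, Polynomial.coeff_add]; exact add_mem hx hy)
    (fun c x _ hx => by
      rw [map_smul, Polynomial.coeff_smul]; exact Submodule.smul_mem _ c hx) hx
  rintro _ ⟨l, rfl, rfl, rfl⟩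
  clear hx
  induction l generalizing k with
  | nil =>
    rw [listProd_nil, map_one, Polynomial.coeff_one]
    split_ifs
    · exact one_mem_homPart
    · exact zero_mem _
  | cons a l ih =>
    rw [listProd_cons]
    cases k with
    | zero =>
      rw [coeff_splitHom_zero, map_mul, symMap_gen, ← coeff_splitHom_zero (f := f)]
      exact gen_mul_mem_homPart _ _ (ih 0)
    | succ k =>
      rw [coeff_splitHom_succ]
      exact add_mem (gen_mul_mem_homPart _ _ (ih _)) (gen_mul_mem_homPart _ _ (ih _))

/-- `e` and `f` are complementary idempotents. -/
structure IsSplitting (e f : ∀ i, V i →ₗ[K] V i) : Prop where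
  add : ∀ i v, e i v + f i v = v
  e_f : ∀ i v, e i (f i v) = 0
  f_e : ∀ i v, f i (e i v) = 0

theorem IsSplitting.f_f (h : IsSplitting e f) (i : ℤ) (v : V i) : f i (f i v) = f i v := by
  have := h.add i (f i v)
  rwa [h.e_f, zero_add] at this

/-- The coefficient of t^k collects the terms with exactly k factors in the image of f, and the
derivation extending f counts those factors. -/
theorem IsSplitting.coeff_splitHom_linCoder (h : IsSplitting e f) (x : Sym K V) (k : ℕ) :
    (splitHom e f (linCoder (DirectSum.lmap f) x)).coeff k =
      (k : K) • (splitHom e f x).coeff k := by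
  induction x using sym_induction generalizing k with
  | one =>
    rw [linCoder_one, map_zero, map_one, Polynomial.coeff_one]
    split_ifs with h
    · simp [h]
    · simp
  | add x y hx hy => simp only [map_add, Polynomial.coeff_add, hx, hy, smul_add]
  | smul c x hx => simp only [map_smul, Polynomial.coeff_smul, hx, smul_comm c]
  | gen_mul i v x hx =>
    rw [linCoder_lmap_gen_mul, map_add, Polynomial.coeff_add]
    cases k with
    | zero =>
      have := hx 0
      simp only [coeff_splitHom_zero, Nat.cast_zero, zero_smul] at this ⊢
      rw [map_mul, map_mul, symMap_gen, h.e_f, map_zero, zero_mul, this, mul_zero, add_zero]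
    | succ k =>
      simp only [coeff_splitHom_succ, hx, h.e_f, h.f_f, map_zero, zero_mul, zero_add,
        mul_smul_comm, smul_add]
      push_cast
      rw [add_smul _ (1 : K) (gen K V i (f i v) * _), one_smul]
      abel

theorem IsSplitting.linCoder_coeff_splitHom (h : IsSplitting e f) (x : Sym K V) (k : ℕ) :
    linCoder (DirectSum.lmap f) ((splitHom e f x).coeff k) =
      (k : K) • (splitHom e f x).coeff k := by
  induction x using sym_induction generalizing k with
  | one =>
    rw [map_one, Polynomial.coeff_one]
    split_ifs with h
    · simp [h, linCoder_one]
    · simp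
  | add x y hx hy => simp only [map_add, Polynomial.coeff_add, hx, hy, smul_add]
  | smul c x hx => simp only [map_smul, Polynomial.coeff_smul, hx, smul_comm c]
  | gen_mul i v x hx =>
    cases k with
    | zero =>
      have := hx 0
      simp only [coeff_splitHom_zero, Nat.cast_zero, zero_smul] at this ⊢
      rw [map_mul, symMap_gen, linCoder_lmap_gen_mul, h.f_e, map_zero, zero_mul, this, mul_zero,
        add_zero]
    | succ k =>
      simp only [coeff_splitHom_succ, map_add, linCoder_lmap_gen_mul, hx, h.f_e, h.f_f, map_zero,
        zero_mul, zero_add, mul_smul_comm, smul_add]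
      push_cast
      rw [add_smul _ (1 : K) (gen K V i (f i v) * _), one_smul]
      abel

theorem IsSplitting.sum_coeff (h : IsSplitting e f) (x : Sym K V) :
    (splitHom e f x).sum (fun _ c => c) = x := by
  let ev : Polynomial (Sym K V) →ₐ[K] Sym K V :=
    Polynomial.eval₂AlgHom (AlgHom.id K (Sym K V)) 1 fun a => Commute.one_right a
  have hev : ∀ q, ev q = q.sum fun _ c => c := by
    intro q
    change Polynomial.eval₂ _ _ _ = _
    rw [Polynomial.eval₂_eq_sum]
    simp
  rw [← hev]
  induction x using sym_induction with
  | one => simp only [map_one]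
  | add x y hx hy => simp only [map_add, hx, hy]
  | smul c x hx => simp only [map_smul, hx]
  | gen_mul i v x hx =>
    have hm : ∀ n a, ev (Polynomial.monomial n a) = a := by
      intro n a
      rw [hev, Polynomial.sum_monomial_index _ _ rfl]
    rw [splitHom_gen_mul, map_mul, hx, map_add, hm, hm, ← map_add, h.add]

variable (e f) in
/-- The inverse of the extension of `f` on the elements of positive `f`-weight. -/
def splitInv : Sym K V →ₗ[K] Sym K V :=
  -- Since 0⁻¹ = 0 in K, the part without factors from the image of f is discarded.
  Polynomial.lsum (fun k => (k : K)⁻¹ • LinearMap.id) ∘ₗ (splitHom e f).toLinearMap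

theorem splitInv_apply (x : Sym K V) :
    splitInv e f x = (splitHom e f x).sum fun k c => (k : K)⁻¹ • c := by
  simp [splitInv, Polynomial.lsum_apply]

theorem splitInv_mem {n : ℕ} {d : ℤ} {x : Sym K V} (hx : x ∈ homPart K V n d) :
    splitInv e f x ∈ homPart K V n d := by
  rw [splitInv_apply, Polynomial.sum_def]
  exact sum_mem fun k _ => Submodule.smul_mem _ _ (coeff_splitHom_mem k hx)

/-- The factor k⁻¹ k is 1 except at k = 0, where it is 0. The sum of the coefficients thus loses
exactly the constant one, which is S(e) x. -/
theorem IsSplitting.sum_ne_zero [CharZero K] (h : IsSplitting e f) (x : Sym K V) (N : ℕ)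
    (hN : (splitHom e f x).natDegree < N) :
    ∑ k ∈ Finset.range N, ((k : K)⁻¹ * (k : K)) • (splitHom e f x).coeff k = x - symMap e x := by
  have h1 := h.sum_coeff x
  rw [Polynomial.sum_over_range' _ (by simp) N hN] at h1
  obtain ⟨M, rfl⟩ : ∃ M, N = M + 1 := ⟨N - 1, by omega⟩
  rw [Finset.sum_range_succ', coeff_splitHom_zero] at h1
  rw [eq_sub_iff_add_eq, Finset.sum_range_succ', Nat.cast_zero, mul_zero, zero_smul, add_zero]
  conv_rhs => rw [← h1]
  congr 1
  refine Finset.sum_congr rfl fun k _ => ?_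
  rw [inv_mul_cancel₀ (by exact_mod_cast k.succ_ne_zero), one_smul]

theorem IsSplitting.linCoder_splitInv [CharZero K] (h : IsSplitting e f) (x : Sym K V) :
    linCoder (DirectSum.lmap f) (splitInv e f x) = x - symMap e x := by
  rw [splitInv_apply, Polynomial.sum_over_range _ (by simp), map_sum,
    ← h.sum_ne_zero x _ (Nat.lt_succ_self _)]
  refine Finset.sum_congr rfl fun k _ => ?_
  rw [map_smul, h.linCoder_coeff_splitHom, smul_smul]

theorem IsSplitting.splitInv_linCoder [CharZero K] (h : IsSplitting e f) (x : Sym K V) :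
    splitInv e f (linCoder (DirectSum.lmap f) x) = x - symMap e x := by
  rw [splitInv_apply, Polynomial.sum_over_range' _ (by simp)
    (max (splitHom e f (linCoder (DirectSum.lmap f) x)).natDegree (splitHom e f x).natDegree + 1)
    (Nat.lt_succ_of_le (le_max_left _ _)),
    ← h.sum_ne_zero x _ (Nat.lt_succ_of_le (le_max_right _ _))]
  refine Finset.sum_congr rfl fun k _ => ?_
  rw [h.coeff_splitHom_linCoder, smul_smul]

end Splitting

/-! ### The retraction onto a strong deformation retract. -/

section Retraction

variable {K : Type u} [Field K]
variable {V : ℤ → Type v} [∀ i, AddCommGroup (V i)] [∀ i, Module K (V i)]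
variable {M : ℤ → Type w} [∀ i, AddCommGroup (M i)] [∀ i, Module K (M i)]

theorem tensor_map_map {A B C A' B' C' : Type*} [AddCommGroup A] [Module K A] [AddCommGroup B]
    [Module K B] [AddCommGroup C] [Module K C] [AddCommGroup A'] [Module K A'] [AddCommGroup B']
    [Module K B'] [AddCommGroup C'] [Module K C'] (f : B →ₗ[K] C) (f' : B' →ₗ[K] C')
    (g : A →ₗ[K] B) (g' : A' →ₗ[K] B') (t : A ⊗[K] A') :
    TensorProduct.map f f' (TensorProduct.map g g' t) =
      TensorProduct.map (f ∘ₗ g) (f' ∘ₗ g') t := by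
  rw [TensorProduct.map_comp, LinearMap.comp_apply]

theorem Alg.Q_sign (A : Alg K V) (x : Sym K V) : A.Q (sign K V 1 x) = -sign K V 1 (A.Q x) := by
  induction x using hom_induction with
  | zero => simp
  | add x y hx hy => simp only [map_add, hx, hy, neg_add]
  | hom n d x hx =>
    rw [sign_of_mem 1 hx, sign_of_mem_degPart 1 (A.degree_one d x (homPart_le_degPart n d hx)),
      Units.smul_def, map_zsmul, ← Units.smul_def, one_mul, one_mul, Int.negOnePow_succ,
      Units.neg_smul, neg_neg]

theorem Alg.comul_Q (A : Alg K V) (x : Sym K V) :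
    comul K V (A.Q x) = TensorProduct.map A.Q LinearMap.id (comul K V x) +
      TensorProduct.map (sign K V 1).toLinearMap A.Q (comul K V x) :=
  LinearMap.congr_fun A.coderivation x

theorem Alg.counit_Q (A : Alg K V) (x : Sym K V) : counit K V (A.Q x) = 0 :=
  LinearMap.congr_fun (A.isCoderAlong.counit_comp IsCoalgHom.id) x

/-- The commutator of the codifferential and the coderivation extending a map of degree `-1`. -/
def Alg.lie (A : Alg K V) (h : (⨁ i, V i) →ₗ[K] ⨁ i, V i) : Sym K V →ₗ[K] Sym K V :=
  A.Q ∘ₗ linCoder h + linCoder h ∘ₗ A.Q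

/-- The graded commutator of two coderivations is again a coderivation. Its degree is 0, so no sign
remains. -/
theorem Alg.comul_lie (A : Alg K V) {h : (⨁ i, V i) →ₗ[K] ⨁ i, V i} (hh : HasDegree h (-1))
    (x : Sym K V) : comul K V (A.lie h x) = TensorProduct.map (A.lie h) LinearMap.id (comul K V x) +
      TensorProduct.map LinearMap.id (A.lie h) (comul K V x) := by
  have hs : (sign K V (-1)).toLinearMap = (sign K V 1).toLinearMap :=
    LinearMap.ext fun x => sign_of_odd (by decide) x
  have h2 : ∀ x, linCoder h (sign K V 1 x) = -sign K V 1 (linCoder h x) := by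
    intro x
    rw [hh.linCoder_sign]
    simp
  rw [lie, LinearMap.add_apply, LinearMap.comp_apply, LinearMap.comp_apply, map_add, A.comul_Q,
    hh.comul_linCoder, hh.comul_linCoder, A.comul_Q, hs]
  generalize comul K V x = t
  induction t using TensorProduct.induction_on with
  | zero => simp
  | add s t hs ht =>
    simp only [map_add] at hs ht ⊢
    rw [add_add_add_comm (TensorProduct.map _ _ s), ← hs, ← ht]
    abel
  | tmul a b =>
    simp only [TensorProduct.map_tmul, map_add, LinearMap.id_apply, AlgHom.toLinearMap_apply,
      A.Q_sign, h2, sign_sign, LinearMap.add_apply, LinearMap.comp_apply, TensorProduct.add_tmul,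
      TensorProduct.tmul_add, TensorProduct.neg_tmul]
    abel

theorem Alg.lie_ι [CharZero K] (A : Alg K V) {h : (⨁ i, V i) →ₗ[K] ⨁ i, V i}
    (hh : HasDegree h (-1)) (x : ⨁ i, V i) :
    A.lie h (ι K V x) = ι K V (A.d (h x) + h (A.d x)) := by
  rw [lie, LinearMap.add_apply, LinearMap.comp_apply, LinearMap.comp_apply, linCoder_ι hh, A.Q_ι,
    A.Q_ι, linCoder_ι hh, map_add]

theorem Alg.lie_mem (A : Alg K V) {h : (⨁ i, V i) →ₗ[K] ⨁ i, V i} (hh : HasDegree h (-1))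
    {d : ℤ} {x : Sym K V} (hx : x ∈ degPart K V d) : A.lie h x ∈ degPart K V d := by
  refine add_mem ?_ ?_
  · have := A.degree_one _ _ (hh.linCoder_mem_degPart hx)
    rwa [neg_add_cancel_right] at this
  · have := hh.linCoder_mem_degPart (A.degree_one _ _ hx)
    rwa [add_neg_cancel_right] at this

/-- The co-Leibniz rule gives E X = (pX) * id + p * X, with pX zero on weights 0 and 1. -/
theorem lowers_of_coder [CharZero K] {X : Sym K V →ₗ[K] Sym K V} (h0 : X 1 = 0)
    (h1 : ∀ x, proj K V (X (ι K V x)) = 0)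
    (hc : ∀ x, comul K V (X x) = TensorProduct.map X LinearMap.id (comul K V x) +
      TensorProduct.map LinearMap.id X (comul K V x)) (n : ℕ) (d : ℤ) (x : Sym K V)
    (hx : x ∈ homPart K V n d) : X x ∈ filt K V n := by
  refine lowers_of_euler_eq (a := proj K V ∘ₗ X) (b := proj K V) (Y := LinearMap.id)
    ?_ ?_ ?_ proj_one h0 (fun n d x hx => homPart_le_filt (Nat.lt_succ_self n) d hx) n d x hx
  · ext x
    change LinearMap.mul' K (Sym K V) (TensorProduct.map (ι K V ∘ₗ proj K V) LinearMap.id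
      (comul K V (X x))) = _
    rw [hc, map_add, map_add, ← LinearMap.comp_apply _ (TensorProduct.map X _),
      ← TensorProduct.map_comp, ← LinearMap.comp_apply _ (TensorProduct.map _ X),
      ← TensorProduct.map_comp]
    rfl
  · rw [LinearMap.comp_apply, h0, map_zero]
  · exact LinearMap.ext h1

/-- The inclusion of a strong deformation retract has a left inverse. -/
theorem Alg.exists_retraction [CharZero K] (A : Alg K V) (B : Alg K M) (σ : ∀ i, M i →ₗ[K] V i)
    (π : ∀ i, V i →ₗ[K] M i) (hπσ : ∀ i x, π i (σ i x) = x)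
    (hσ : (symMap σ).toLinearMap ∘ₗ B.Q = A.Q ∘ₗ (symMap σ).toLinearMap)
    {h : (⨁ i, V i) →ₗ[K] ⨁ i, V i} (hh : HasDegree h (-1))
    (hhσ : ∀ i x, h (DirectSum.lof K ℤ V i (σ i x)) = 0)
    (hc : ∀ x, A.d (h x) + h (A.d x) = x - DirectSum.lmap (fun i => σ i ∘ₗ π i) x) :
    ∃ P : Hom A B, P.F ∘ₗ (symMap σ).toLinearMap = LinearMap.id := by
  set e : ∀ i, V i →ₗ[K] V i := fun i => σ i ∘ₗ π i with he
  set f : ∀ i, V i →ₗ[K] V i := fun i => LinearMap.id - e i with hf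
  have hs : IsSplitting e f := by
    refine ⟨fun i v => ?_, fun i v => ?_, fun i v => ?_⟩
    · simp [hf]
    · simp [hf, he, hπσ]
    · simp [hf, he, hπσ]
  -- L is a coderivation commuting with Q, with linear part d h + h d = f; N is its purely linear
  -- model. The retraction will be the projection to the image of S(σ) along the image of L.
  set L := A.lie h with hL
  set N := linCoder (DirectSum.lmap f) with hN
  have hLσ : ∀ x, L (symMap σ x) = 0 := by
    -- A coderivation along S(σ) whose Taylor coefficients vanish because h σ = 0.
    have hθ : ∀ x, linCoder h (symMap σ x) = 0 := by
      have h1 : IsCoderAlong LinearMap.id (linCoder h) := by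
        refine LinearMap.ext fun x => ?_
        rw [LinearMap.comp_apply, hh.comul_linCoder]
        have : (sign K V (-1)).toLinearMap = (sign K V 1).toLinearMap :=
          LinearMap.ext fun x => sign_of_odd (by decide) x
        rw [this]
        rfl
      have h2 := h1.comp_right (isCoalgHom_symMap σ)
      refine LinearMap.congr_fun (h2.eq_zero (isCoalgHom_symMap σ) ?_)
      refine LinearMap.ext fun x => ?_
      change proj K V (linCoder h (symMap σ x)) = 0
      rw [proj_linCoder, proj_symMap]
      generalize proj K M x = y
      induction y using DirectSum.induction_on with
      | zero => simp
      | of i v =>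
        change h (DirectSum.lmap σ (DirectSum.lof K ℤ M i v)) = 0
        rw [DirectSum.lmap_lof, hhσ]
      | add x y hx hy => simp only [map_add, hx, hy, add_zero]
    intro x
    have hx : A.Q (symMap σ x) = symMap σ (B.Q x) := (LinearMap.congr_fun hσ x).symm
    rw [hL, lie, LinearMap.add_apply, LinearMap.comp_apply, LinearMap.comp_apply, hθ, hx, hθ,
      map_zero, add_zero]
  have hNσ : ∀ x, N (symMap σ x) = 0 := by
    intro x
    have hex : symMap e (symMap σ x) = symMap σ x := by
      rw [symMap_comp]
      congr 2
      funext i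
      ext v
      simp [he, hπσ]
    have h1 := hs.linCoder_coeff_splitHom (symMap σ x) 0
    rw [coeff_splitHom_zero, hex, Nat.cast_zero, zero_smul] at h1
    exact h1
  set Λ := L - N with hΛ
  have hΛlow : ∀ n d, ∀ x ∈ homPart K V n d, Λ x ∈ filt K V n := by
    refine lowers_of_coder ?_ ?_ ?_
    · have h1 := hLσ 1
      rw [map_one] at h1
      rw [hΛ, LinearMap.sub_apply, h1, hN, linCoder_one, sub_self]
    · intro x
      rw [hΛ, LinearMap.sub_apply, hL, A.lie_ι hh, hN, linCoder_ι (hasDegree_lmap f), hc,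
        ← map_sub, proj_ι]
      have : DirectSum.lmap f x = x - DirectSum.lmap e x := by
        induction x using DirectSum.induction_on with
        | zero => simp
        | of i v =>
          change DirectSum.lmap f (DirectSum.lof K ℤ V i v) = DirectSum.lof K ℤ V i v -
            DirectSum.lmap e (DirectSum.lof K ℤ V i v)
          rw [DirectSum.lmap_lof, DirectSum.lmap_lof, ← map_sub]
          rfl
        | add x y hx hy =>
          simp only [map_add, hx, hy]
          abel
      rw [this, sub_self]
    · intro x
      have h1 := (hasDegree_lmap f).comul_linCoder x
      have h2 : (sign K V 0).toLinearMap = LinearMap.id :=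
        LinearMap.ext fun x => sign_of_even (by decide) x
      rw [h2] at h1
      have h3 : TensorProduct.map (L - N) (LinearMap.id : Sym K V →ₗ[K] Sym K V) =
          TensorProduct.map L LinearMap.id - TensorProduct.map N LinearMap.id :=
        TensorProduct.ext' fun a b => by simp [TensorProduct.sub_tmul]
      rw [hΛ, LinearMap.sub_apply, map_sub, hL, A.comul_lie hh, hN, h1, ← hN, ← hL, h3,
        tensor_map_sub_right, LinearMap.sub_apply, LinearMap.sub_apply]
      abel
  set S := splitInv e f with hS
  -- T is unipotent, satisfies T N = L and fixes the image of S(σ). It carries the evident splitting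
  -- for N to one for L.
  set T : Sym K V →ₗ[K] Sym K V := LinearMap.id + Λ ∘ₗ S with hT
  have hTlow : ∀ n d, ∀ x ∈ homPart K V n d, T x - x ∈ filt K V n := by
    intro n d x hx
    rw [hT, LinearMap.add_apply, LinearMap.id_apply, add_sub_cancel_left]
    exact hΛlow n d _ (splitInv_mem hx)
  have hNS : ∀ x, N (S x) = x - symMap e x := hs.linCoder_splitInv
  have hSN : ∀ x, S (N x) = x - symMap e x := hs.splitInv_linCoder
  have heσ : ∀ x, symMap e x = symMap σ (symMap π x) := fun x => (symMap_comp π σ x).symm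
  have hTN : ∀ x, T (N x) = L x := by
    intro x
    have h1 : Λ (symMap e x) = 0 := by
      rw [heσ, hΛ, LinearMap.sub_apply, hLσ, hNσ, sub_self]
    rw [hT, LinearMap.add_apply, LinearMap.id_apply, LinearMap.comp_apply, hSN, map_sub, h1,
      sub_zero, hΛ, LinearMap.sub_apply, add_sub_cancel]
  have hSσ : ∀ x, S (symMap σ x) = 0 := by
    intro x
    rw [hS, splitInv_apply]
    have h1 : splitHom e f (symMap σ x) = Polynomial.C (symMap σ x) := by
      refine Polynomial.ext fun k => ?_
      rcases Nat.eq_zero_or_pos k with rfl | hk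
      · rw [coeff_splitHom_zero, Polynomial.coeff_C_zero, symMap_comp]
        congr 2
        funext i
        ext v
        simp [he, hπσ]
      · have h2 := hs.coeff_splitHom_linCoder (symMap σ x) k
        rw [← hN, hNσ, map_zero, Polynomial.coeff_zero] at h2
        rw [(smul_eq_zero.mp h2.symm).resolve_left (by exact_mod_cast hk.ne'),
          Polynomial.coeff_C_of_ne_zero hk.ne']
    rw [h1, Polynomial.sum_C_index] <;> simp
  have hTσ : ∀ x, T (symMap σ x) = symMap σ x := by
    intro x
    rw [hT, LinearMap.add_apply, LinearMap.id_apply, LinearMap.comp_apply, hSσ, map_zero, add_zero]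
  have hTb := bijective_of_lowers hTlow
  let Te := LinearEquiv.ofBijective T hTb
  have hTe : ∀ x, Te.symm (T x) = x := fun x => Te.symm_apply_apply x
  have hspan : ∀ x, ∃ y z, x = symMap σ y + L z := by
    intro x
    obtain ⟨x, rfl⟩ := hTb.surjective x
    -- Unfolding the definition, T x = L (S x) + x - N (S x) = L (S x) + S(e) x, with S(e) factoring
    -- as S(σ) S(π).
    refine ⟨symMap π x, S x, ?_⟩
    rw [hT, LinearMap.add_apply, LinearMap.id_apply, LinearMap.comp_apply, hΛ,
      LinearMap.sub_apply, hNS, ← heσ]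
    abel
  let P : Sym K V →ₗ[K] Sym K M := (symMap π).toLinearMap ∘ₗ (Te.symm : Sym K V →ₗ[K] Sym K V)
  have hPσ : ∀ x, P (symMap σ x) = x := by
    intro x
    change symMap π (Te.symm (symMap σ x)) = x
    rw [← hTσ x, hTe, symMap_comp]
    have : (fun i => π i ∘ₗ σ i) = fun i => (LinearMap.id : M i →ₗ[K] M i) := by
      funext i
      ext v
      exact hπσ i v
    rw [this, symMap_id]
  have hPL : ∀ x, P (L x) = 0 := by
    intro x
    change symMap π (Te.symm (L x)) = 0
    rw [← hTN, hTe]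
    have h1 : ∀ y, symMap π (N y) = 0 := by
      intro y
      induction y using sym_induction with
      | one => rw [hN, linCoder_one, map_zero]
      | add x y hx hy => rw [map_add, map_add, hx, hy, add_zero]
      | smul c x hx => rw [map_smul, map_smul, hx, smul_zero]
      | gen_mul i v y hy =>
        have : π i (f i v) = 0 := by simp [hf, he, hπσ]
        rw [hN, linCoder_lmap_gen_mul, ← hN, map_add, map_mul, map_mul, hy, mul_zero, symMap_gen,
          this, map_zero, zero_mul, add_zero]
    exact h1 x
  -- By Q² = 0 both sides equal Q θ Q, with θ the extension of h.
  have hQL : ∀ x, A.Q (L x) = L (A.Q x) := by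
    intro x
    have h1 : ∀ x, A.Q (A.Q x) = 0 := LinearMap.congr_fun A.square_zero
    simp only [hL, lie, LinearMap.add_apply, LinearMap.comp_apply, map_add, h1, map_zero, zero_add,
      add_zero]
  -- Compatibility with Δ, the counit and Q is checked separately on S(σ) y and on L z. For the
  -- second, Δ (L z) has a factor in the image of L, so P ⊗ P kills it.
  refine ⟨⟨P, ?_, ?_, ?_, ?_, ?_⟩, LinearMap.ext hPσ⟩
  · intro d x hx
    have hTd : ∀ x ∈ degPart K V d, T x ∈ degPart K V d := by
      intro x hx
      refine degPart_induction (P := fun x => T x ∈ degPart K V d) (by simp) ?_ ?_ hx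
      · intro x y hx hy
        rw [map_add]; exact add_mem hx hy
      · intro n x hx
        have h1 := homPart_le_degPart _ _ (splitInv_mem (e := e) (f := f) hx)
        have h2 := (hasDegree_lmap f).linCoder_mem_degPart h1
        rw [add_zero] at h2
        exact add_mem (homPart_le_degPart _ _ hx) (sub_mem (A.lie_mem hh h1) h2)
    obtain ⟨y, hy, hxy⟩ := exists_of_lowers hTlow _ hTd x hx
    change symMap π (Te.symm x) ∈ _
    rw [← hxy, hTe]
    exact (isCoalgHom_symMap π).degree_zero d y hy
  · ext x
    obtain ⟨y, z, rfl⟩ := hspan x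
    have h1 : comul K V (symMap σ y) = TensorProduct.map (symMap σ).toLinearMap
      (symMap σ).toLinearMap (comul K M y) :=
        LinearMap.congr_fun (isCoalgHom_symMap σ).map_comul y
    have hPσ' : P ∘ₗ (symMap σ).toLinearMap = LinearMap.id := LinearMap.ext hPσ
    have hPL' : P ∘ₗ L = 0 := LinearMap.ext hPL
    simp only [LinearMap.comp_apply, map_add, hPσ, hPL, map_zero, add_zero]
    rw [h1, hL, A.comul_lie hh, ← hL, map_add, tensor_map_map, tensor_map_map, tensor_map_map,
      hPσ', hPL', TensorProduct.map_zero_left, TensorProduct.map_zero_right, TensorProduct.map_id]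
    simp
  · ext x
    obtain ⟨y, z, rfl⟩ := hspan x
    have h1 : counit K V (L z) = 0 := by
      rw [hL, lie, LinearMap.add_apply, map_add, LinearMap.comp_apply, A.counit_Q, zero_add,
        LinearMap.comp_apply, linCoder, counit_conv]
    rw [LinearMap.comp_apply, map_add, hPσ, hPL, add_zero, map_add, h1, counit_symMap, add_zero]
  · have := hPσ 1
    rwa [map_one] at this
  · ext x
    obtain ⟨y, z, rfl⟩ := hspan x
    have h1 : A.Q (symMap σ y) = symMap σ (B.Q y) := (LinearMap.congr_fun hσ y).symm
    simp only [LinearMap.comp_apply, map_add, h1, hPσ, hQL, hPL, map_zero]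

end Retraction

/-! ### Contractions of the tangent complex. -/

section Contraction

variable {K : Type u} [Field K] {V : ℤ → Type v} [∀ i, AddCommGroup (V i)] [∀ i, Module K (V i)]

theorem exists_lof_of_eq {i j : ℤ} (hij : i = j) {x : ⨁ i, V i}
    (h : ∃ w : V i, x = DirectSum.lof K ℤ V i w) : ∃ w : V j, x = DirectSum.lof K ℤ V j w := by
  subst hij
  exact h

theorem HasDegree.comp {f g : (⨁ i, V i) →ₗ[K] ⨁ i, V i} {k l m : ℤ} (hg : HasDegree g k)
    (hf : HasDegree f l) (hm : l + k = m) : HasDegree (g ∘ₗ f) m := by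
  intro i v
  obtain ⟨w, hw⟩ := hf i v
  obtain ⟨u, hu⟩ := hg _ w
  exact exists_lof_of_eq (by rw [add_assoc, hm]) ⟨u, by rw [LinearMap.comp_apply, hw, hu]⟩

theorem HasDegree.sub {f g : (⨁ i, V i) →ₗ[K] ⨁ i, V i} {k : ℤ} (hf : HasDegree f k)
    (hg : HasDegree g k) : HasDegree (f - g) k := by
  intro i v
  obtain ⟨w, hw⟩ := hf i v
  obtain ⟨u, hu⟩ := hg i v
  exact ⟨w - u, by rw [LinearMap.sub_apply, hw, hu, map_sub]⟩

theorem HasDegree.add {f g : (⨁ i, V i) →ₗ[K] ⨁ i, V i} {k : ℤ} (hf : HasDegree f k)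
    (hg : HasDegree g k) : HasDegree (f + g) k := by
  intro i v
  obtain ⟨w, hw⟩ := hf i v
  obtain ⟨u, hu⟩ := hg i v
  exact ⟨w + u, by rw [LinearMap.add_apply, hw, hu, map_add]⟩

theorem HasDegree.id : HasDegree (LinearMap.id : (⨁ i, V i) →ₗ[K] ⨁ i, V i) 0 := fun i v =>
  exists_lof_of_eq (add_zero i).symm ⟨v, rfl⟩

theorem Alg.hasDegree_d (A : Alg K V) : HasDegree A.d 1 := by
  intro i v
  obtain ⟨w, hw⟩ := proj_mem_of_mem_degPart (i + 1) _ (A.degree_one i _ (gen_mem_degPart i v))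
  exact ⟨w, hw.symm⟩

theorem Alg.d_comp_d [CharZero K] (A : Alg K V) : A.d ∘ₗ A.d = 0 := by
  ext1 x
  refine LinearMap.ext fun v => ?_
  have h := LinearMap.congr_fun A.square_zero (ι K V (DirectSum.lof K ℤ V x v))
  rw [LinearMap.comp_apply, A.Q_ι, A.Q_ι] at h
  have h' := congrArg (proj K V) h
  rw [proj_ι] at h'
  simpa using h'

theorem exists_generalized_inverse {X Y : Type*} [AddCommGroup X] [Module K X] [AddCommGroup Y]
    [Module K Y] (δ : X →ₗ[K] Y) : ∃ g : Y →ₗ[K] X, ∀ x, δ (g (δ x)) = δ x := by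
  obtain ⟨s, hs⟩ := δ.rangeRestrict.exists_rightInverse_of_surjective δ.range_rangeRestrict
  obtain ⟨r, hr⟩ := (LinearMap.range δ).subtype.exists_leftInverse_of_injective
    (Submodule.ker_subtype _)
  refine ⟨s ∘ₗ r, fun x => ?_⟩
  have h1 : r (δ x) = δ.rangeRestrict x := LinearMap.congr_fun hr (δ.rangeRestrict x)
  have h2 := LinearMap.congr_fun hs (δ.rangeRestrict x)
  rw [LinearMap.comp_apply, h1]
  exact congrArg Subtype.val h2

/-- Over a field every differential has a generalized inverse, which can be normalized to the side
conditions of a strong deformation retract onto cohomology. -/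
theorem Alg.exists_contraction [CharZero K] (A : Alg K V) :
    ∃ h : (⨁ i, V i) →ₗ[K] ⨁ i, V i, HasDegree h (-1) ∧ (∀ x, h (h x) = 0) ∧
      (∀ x, h (A.d (h x)) = h x) ∧ ∀ x, A.d (h (A.d x)) = A.d x := by
  have hd : ∀ x, A.d (A.d x) = 0 := LinearMap.congr_fun A.d_comp_d
  let δ : ∀ j, V (j - 1) →ₗ[K] V j := fun j =>
    DirectSum.component K ℤ V j ∘ₗ A.d ∘ₗ DirectSum.lof K ℤ V (j - 1)
  have hδ : ∀ j v, A.d (DirectSum.lof K ℤ V (j - 1) v) = DirectSum.lof K ℤ V j (δ j v) := by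
    intro j v
    obtain ⟨w, hw⟩ := exists_lof_of_eq (sub_add_cancel j 1) (A.hasDegree_d (j - 1) v)
    simp only [δ, LinearMap.comp_apply, hw, DirectSum.component.lof_self]
  choose g hg using fun j => exists_generalized_inverse (δ j)
  let h₀ : (⨁ i, V i) →ₗ[K] ⨁ i, V i :=
    DirectSum.toModule K ℤ _ fun j => DirectSum.lof K ℤ V (j - 1) ∘ₗ g j
  have h₀_lof : ∀ j v, h₀ (DirectSum.lof K ℤ V j v) = DirectSum.lof K ℤ V (j - 1) (g j v) := by
    intro j v
    simp [h₀]
  have h₀_deg : HasDegree h₀ (-1) := fun i v => ⟨g i v, h₀_lof i v⟩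
  have hdh : ∀ x, A.d (h₀ (A.d x)) = A.d x := by
    intro x
    induction x using DirectSum.induction_on with
    | zero => simp
    | of i v =>
      obtain ⟨j, rfl⟩ : ∃ j, i = j - 1 := ⟨i + 1, by ring⟩
      change A.d (h₀ (A.d (DirectSum.lof K ℤ V (j - 1) v))) = A.d (DirectSum.lof K ℤ V (j - 1) v)
      rw [hδ, h₀_lof, hδ, hg]
    | add x y hx hy => simp only [map_add, hx, hy]
  -- From d h₀ d = d one gets h₁ d h₁ = h₁ while keeping d h₁ d = d.
  let h₁ := h₀ ∘ₗ A.d ∘ₗ h₀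
  have h₁_deg : HasDegree h₁ (-1) := h₀_deg.comp (A.hasDegree_d.comp h₀_deg rfl) rfl
  have e1 : ∀ x, A.d (h₁ (A.d x)) = A.d x := fun x => by
    simp only [h₁, LinearMap.comp_apply, hdh]
  have e2 : ∀ x, h₁ (A.d (h₁ x)) = h₁ x := fun x => by
    simp only [h₁, LinearMap.comp_apply, hdh]
  -- The correction makes h² = 0, and d² = 0 preserves the other two identities.
  refine ⟨h₁ - h₁ ∘ₗ h₁ ∘ₗ A.d, h₁_deg.sub (h₁_deg.comp (h₁_deg.comp A.hasDegree_d rfl) rfl),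
    fun x => ?_, fun x => ?_, fun x => ?_⟩
  · simp only [LinearMap.sub_apply, LinearMap.comp_apply, map_sub, e2, sub_self]
  · simp only [LinearMap.sub_apply, LinearMap.comp_apply, map_sub, e2, hd, map_zero, sub_zero]
  · simp only [LinearMap.sub_apply, LinearMap.comp_apply, e1, hd, map_zero, sub_zero]

end Contraction

/-! ### Minimal models and reversal of weak equivalences. -/

section MinimalModels

variable {K : Type u} [Field K] [CharZero K]
variable {V : ℤ → Type v} [∀ i, AddCommGroup (V i)] [∀ i, Module K (V i)]

theorem IsCoalgHom.apply_ι {W : ℤ → Type*} [∀ i, AddCommGroup (W i)] [∀ i, Module K (W i)]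
    {F : Sym K V →ₗ[K] Sym K W} (hF : IsCoalgHom F) (x : ⨁ i, V i) :
    F (ι K V x) = ι K W (proj K W (F (ι K V x))) := by
  refine eq_ι_of_primitive _ ?_
  have h := LinearMap.congr_fun hF.map_comul (ι K V x)
  simpa [comul_ι, hF.map_unit] using h

/-- Up to isomorphism, the part of the Taylor coefficients in the contractible direction is
linear. -/
theorem Alg.exists_linearized (A : Alg K V) {h : (⨁ i, V i) →ₗ[K] ⨁ i, V i}
    (hdeg : HasDegree h (-1)) (hh : ∀ x, h (h x) = 0)
    (dhd : ∀ x, A.d (h (A.d x)) = A.d x) :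
    ∃ A' : Alg K V, A'.d = A.d ∧
      (∀ x, A.d (h (proj K V (A'.Q x))) + h (A.d (proj K V (A'.Q x))) =
        A.d (proj K V x)) ∧
      ∃ (F : Hom A A') (G : Hom A' A), F.IsWeakEquiv ∧ G.IsWeakEquiv := by
  have hdd : ∀ x, A.d (A.d x) = 0 := LinearMap.congr_fun A.d_comp_d
  have hQQ : ∀ x, A.Q (A.Q x) = 0 := LinearMap.congr_fun A.square_zero
  -- The linear part is the identity, as h p Q restricts to h d on V. By h² = 0 and d h d = d, one
  -- has d φ = d h p Q: in the new coordinates, d applied to the coordinate of a point already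
  -- records the higher terms.
  let φ : Sym K V →ₗ[K] ⨁ i, V i :=
    proj K V - h ∘ₗ A.d ∘ₗ proj K V + h ∘ₗ proj K V ∘ₗ A.Q
  have hφ : ∀ x, φ x = proj K V x - h (A.d (proj K V x)) + h (proj K V (A.Q x)) := fun x => rfl
  have hφ1 : φ 1 = 0 := by simp [hφ, proj_one, A.Q_one]
  have hφd : IsDegreeZero φ := by
    intro d x hx
    obtain ⟨a, ha⟩ := proj_mem_of_mem_degPart d x hx
    obtain ⟨b, hb⟩ := proj_mem_of_mem_degPart _ _ (A.degree_one d x hx)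
    obtain ⟨c, hc⟩ := exists_lof_of_eq (by ring) ((hdeg.comp A.hasDegree_d rfl) d a)
    obtain ⟨c', hc'⟩ := exists_lof_of_eq (by ring) (hdeg (d + 1) b)
    rw [LinearMap.comp_apply] at hc
    refine ⟨a - c + c', ?_⟩
    rw [hφ, ← ha, ← hb, hc, hc', map_add, map_sub]
  have hF := isCoalgHom_cofree hφ1 hφd
  have hpF : ∀ x, proj K V (cofree φ x) = φ x := LinearMap.congr_fun (proj_cofree hφ1)
  have hφι : ∀ x, φ (ι K V x) = x := by
    intro x
    rw [hφ, proj_ι, A.Q_ι, proj_ι, sub_add_cancel]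
  have hlin : ∀ i, Function.Bijective (linPart (cofree φ) i) := by
    intro i
    have : linPart (cofree φ) i = LinearMap.id := by
      ext v
      change DirectSum.component K ℤ V i (proj K V (cofree φ (ι K V (DirectSum.lof K ℤ V i v)))) = v
      rw [hpF, hφι, DirectSum.component.lof_self]
    rw [this]
    exact Function.bijective_id
  obtain ⟨G, hG, hFG, hGF⟩ := hF.exists_inverse hlin
  have hFG' : ∀ x, cofree φ (G x) = x := LinearMap.congr_fun hFG
  have hGF' : ∀ x, G (cofree φ x) = x := LinearMap.congr_fun hGF
  refine ⟨A.transport hF hG hFG hGF, ?_, ?_, A.toTransport hF hG hFG hGF,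
    (A.toTransport hF hG hFG hGF).inverse hG hFG hGF, A.toTransport_isWeakEquiv hF hG hFG hGF,
    Hom.isWeakEquiv_of_inverse (G := A.toTransport hF hG hFG hGF) hFG hGF⟩
  · refine LinearMap.ext fun x => ?_
    change proj K V (cofree φ (A.Q (G (ι K V x)))) = A.d x
    have hGι : G (ι K V x) = ι K V x := by
      have h0 : cofree φ (ι K V x) = ι K V x := by rw [hF.apply_ι, hpF, hφι]
      conv_lhs => rw [← h0]
      exact hGF' _
    rw [hGι, hpF, hφ, hQQ, map_zero, map_zero, add_zero, A.Q_ι, proj_ι, hdd, map_zero, sub_zero]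
  · intro x
    obtain ⟨x, rfl⟩ : ∃ y, x = cofree φ y := ⟨G x, (hFG' x).symm⟩
    change A.d (h (proj K V (cofree φ (A.Q (G (cofree φ x)))))) +
      h (A.d (proj K V (cofree φ (A.Q (G (cofree φ x)))))) = _
    -- The new coefficients at F x are φ (Q x) = p Q x - h d p Q x, as Q² = 0 removes the last term
    -- of φ.
    rw [hGF', hpF, hpF, hφ, hφ, hQQ]
    simp only [map_zero, add_zero, map_sub, map_add, dhd, hh, sub_self, sub_zero, zero_add]

/-- After linearizing the contractible directions, S of the harmonic space is stable under the
codifferential. The restriction is minimal, its inclusion is a weak equivalence, and the retraction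
provides a weak equivalence in the other direction. -/
theorem Alg.exists_minimalModel (A : Alg K V) :
    ∃ (M : MinimalModel A) (P : Hom A M.alg), P.IsWeakEquiv := by
  obtain ⟨h, hdeg, hh, hdh, dhd⟩ := A.exists_contraction
  obtain ⟨A', hA'd, hA', F, G, hF, hG⟩ := A.exists_linearized hdeg hh dhd
  have hdd : ∀ x, A.d (A.d x) = 0 := LinearMap.congr_fun A.d_comp_d
  -- E is the projection to the harmonic elements, on which both d and h vanish.
  let E : (⨁ i, V i) →ₗ[K] ⨁ i, V i := LinearMap.id - (A.d ∘ₗ h + h ∘ₗ A.d)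
  have hE : ∀ x, E x = x - (A.d (h x) + h (A.d x)) := fun x => rfl
  have hEdeg : HasDegree E 0 :=
    HasDegree.id.sub ((A.hasDegree_d.comp hdeg rfl).add (hdeg.comp A.hasDegree_d rfl))
  have hhE : ∀ x, h (E x) = 0 := fun x => by simp [hE, hdh, hh]
  have hdE : ∀ x, A.d (E x) = 0 := fun x => by simp [hE, hdd, dhd]
  have hEd : ∀ x, E (A.d x) = 0 := fun x => by simp [hE, hdd, dhd]
  have hEE : ∀ x, E (E x) = E x := fun x => by rw [hE (E x), hhE, hdE]; simp
  let e : ∀ i, V i →ₗ[K] V i := fun i =>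
    DirectSum.component K ℤ V i ∘ₗ E ∘ₗ DirectSum.lof K ℤ V i
  have he : ∀ i v, E (DirectSum.lof K ℤ V i v) = DirectSum.lof K ℤ V i (e i v) := by
    intro i v
    obtain ⟨w, hw⟩ := exists_lof_of_eq (add_zero i) (hEdeg i v)
    simp only [e, LinearMap.comp_apply, hw, DirectSum.component.lof_self]
  have hee : ∀ i v, e i (e i v) = e i v := by
    intro i v
    refine DirectSum.of_injective (β := V) i ?_
    change DirectSum.lof K ℤ V i _ = DirectSum.lof K ℤ V i _
    rw [← he, ← he, hEE]
  let σ : ∀ i, LinearMap.range (e i) →ₗ[K] V i := fun i => (LinearMap.range (e i)).subtype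
  let π : ∀ i, V i →ₗ[K] LinearMap.range (e i) := fun i => (e i).rangeRestrict
  have hπσ : ∀ i x, π i (σ i x) = x := by
    rintro i ⟨_, v, rfl⟩
    exact Subtype.ext (hee i v)
  have hσπ : ∀ x, DirectSum.lmap (fun i => σ i ∘ₗ π i) x = E x := by
    intro x
    induction x using DirectSum.induction_on with
    | zero => simp
    | of i v =>
      change DirectSum.lmap _ (DirectSum.lof K ℤ V i v) = E (DirectSum.lof K ℤ V i v)
      rw [DirectSum.lmap_lof, he]
      rfl
    | add x y hx hy => simp only [map_add, hx, hy]
  have hEσ : ∀ x, E (DirectSum.lmap σ x) = DirectSum.lmap σ x := by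
    intro x
    induction x using DirectSum.induction_on with
    | zero => simp
    | of i v =>
      change E (DirectSum.lmap σ (DirectSum.lof K ℤ _ i v)) =
        DirectSum.lmap σ (DirectSum.lof K ℤ _ i v)
      rw [DirectSum.lmap_lof, he]
      congr 1
      exact congrArg Subtype.val (hπσ i v)
    | add x y hx hy => simp only [map_add, hx, hy]
  have hσπ' : ∀ x, DirectSum.lmap σ (DirectSum.lmap π x) = E x := by
    intro x
    rw [← hσπ, DirectSum.lmap_comp]
    rfl
  have hSπσ : (symMap π).toLinearMap ∘ₗ (symMap σ).toLinearMap = LinearMap.id := by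
    refine LinearMap.ext fun x => ?_
    change symMap π (symMap σ x) = x
    rw [symMap_comp]
    have : (fun i => π i ∘ₗ σ i) = fun i => (LinearMap.id : _ →ₗ[K] LinearMap.range (e i)) := by
      funext i
      ext1 v
      exact hπσ i v
    rw [this, symMap_id]
  -- Both sides are coderivations along S(σ). On Taylor coefficients the claim is E p Q' = p Q' over
  -- harmonic elements, where (1 - E) p Q' = d p vanishes.
  have hstable : (symMap σ).toLinearMap ∘ₗ (symMap π).toLinearMap ∘ₗ A'.Q ∘ₗ
      (symMap σ).toLinearMap = A'.Q ∘ₗ (symMap σ).toLinearMap := by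
    have h1 := A'.isCoderAlong.comp_right (isCoalgHom_symMap σ)
    have h2 := (h1.comp_left (isCoalgHom_symMap π)).comp_left (isCoalgHom_symMap σ)
    rw [LinearMap.id_comp] at h1 h2
    rw [hSπσ, LinearMap.comp_id] at h2
    refine IsCoderAlong.ext (isCoalgHom_symMap σ) h2 h1 (LinearMap.ext fun x => ?_)
    change proj K V (symMap σ (symMap π (A'.Q (symMap σ x)))) = proj K V (A'.Q (symMap σ x))
    rw [proj_symMap, proj_symMap, hσπ', hE, hA', proj_symMap]
    rw [← hEσ, hdE, sub_zero]
  have hstable' : ∀ x, symMap σ (symMap π (A'.Q (symMap σ x))) = A'.Q (symMap σ x) :=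
    LinearMap.congr_fun hstable
  have hQQ : ∀ x, A'.Q (A'.Q x) = 0 := LinearMap.congr_fun A'.square_zero
  let B : Alg K fun i => LinearMap.range (e i) :=
    { Q := (symMap π).toLinearMap ∘ₗ A'.Q ∘ₗ (symMap σ).toLinearMap
      degree_one := fun d x hx => (isCoalgHom_symMap π).degree_zero _ _
        (A'.degree_one _ _ ((isCoalgHom_symMap σ).degree_zero d x hx))
      coderivation := by
        have h1 := (A'.isCoderAlong.comp_right (isCoalgHom_symMap σ)).comp_left
          (isCoalgHom_symMap π)
        rwa [LinearMap.id_comp, hSπσ] at h1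
      constant_part := by simp [A'.Q_one]
      square_zero := LinearMap.ext fun x => by
        change symMap π (A'.Q (symMap σ (symMap π (A'.Q (symMap σ x))))) = 0
        rw [hstable', hQQ, map_zero] }
  have hBmin : B.IsMinimal := by
    refine LinearMap.ext fun x => ?_
    change proj K _ (symMap π (A'.Q (symMap σ (ι K _ x)))) = 0
    rw [proj_symMap, symMap_ι, A'.Q_ι, proj_ι, hA'd, ← hEσ, hdE, map_zero]
  let I : Hom B A' := Hom.ofProj (symMap σ).toLinearMap (isCoalgHom_symMap σ) (by
    change _ ∘ₗ (symMap σ).toLinearMap ∘ₗ (symMap π).toLinearMap ∘ₗ A'.Q ∘ₗ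
      (symMap σ).toLinearMap = _
    rw [hstable])
  have hIf : ∀ i x, I.f₁Deg i x = σ i x := by
    intro i x
    change DirectSum.component K ℤ V i (proj K V (symMap σ (gen K _ i x))) = _
    rw [symMap_gen, proj_gen, DirectSum.component.lof_self]
  have hI : I.IsWeakEquiv := by
    intro i
    constructor
    · refine (injective_iff_map_eq_zero _).mpr fun x hx => ?_
      obtain ⟨x, rfl⟩ := (hBmin.toH_bijective i).surjective x
      obtain ⟨y, hy⟩ := (Submodule.Quotient.mk_eq_zero _).mp hx
      have hy' : A'.d y = DirectSum.lof K ℤ V i (σ i x) := by rw [hy]; exact congrArg _ (hIf i x)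
      have h1 := congrArg E hy'
      rw [hA'd, hEd, he] at h1
      have h2 : σ i x = 0 := by
        rw [← hπσ i x]
        exact (DirectSum.of_injective (β := V) i (by rw [map_zero]; exact h1)).symm
      have h3 : x = 0 := by rw [← hπσ i x, h2, map_zero]
      rw [h3, map_zero]
    · intro z
      obtain ⟨z, rfl⟩ := Submodule.mkQ_surjective _ z
      refine ⟨hBmin.toH i (π i z), ?_⟩
      change A'.cls i _ = A'.cls i z
      refine (Submodule.Quotient.eq _).mpr ?_
      change _ ∈ LinearMap.range A'.d
      rw [hA'd]
      have hz : A.d (DirectSum.lof K ℤ V i (z : V i)) = 0 := by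
        rw [← hA'd]
        exact z.2
      refine ⟨-h (DirectSum.lof K ℤ V i z), ?_⟩
      have h1 : (I.f₁Deg i (π i z) : V i) = e i z := hIf i (π i z)
      change _ = DirectSum.lof K ℤ V i (I.f₁Deg i (π i z) - z)
      rw [h1, map_sub, ← he, hE, hz, map_zero, map_neg]
      abel
  obtain ⟨P, hP⟩ := A'.exists_retraction B σ π hπσ hstable hdeg (h := h)
    (fun i x => by
      have h1 := hEσ (DirectSum.lof K ℤ _ i x)
      rw [DirectSum.lmap_lof] at h1
      rw [← h1, hhE])
    (fun x => by rw [hσπ, hE, hA'd, sub_sub_cancel])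
  have hPw : P.IsWeakEquiv := Hom.isWeakEquiv_of_comp_eq_id (F := I) hP hI
  exact ⟨⟨⟨(fun i => LinearMap.range (e i)), B⟩, hBmin, G.comp I, hG.comp hI⟩, P.comp F,
    hPw.comp hF⟩

/-- A weak equivalence from a minimal algebra has a weak equivalence in the opposite direction. -/
theorem MinimalModel.exists_weakEquiv {A : Alg K V} (M : MinimalModel A) :
    ∃ P : Hom A M.alg, P.IsWeakEquiv := by
  obtain ⟨N, P, hP⟩ := A.exists_minimalModel
  -- P lands in some particular minimal model N; the composite M ⇢ A ⇢ N is a weak equivalence of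
  -- minimal algebras, hence an isomorphism.
  obtain ⟨G, hG, hG'⟩ := (P.comp M.hom).exists_inverse
    (Hom.f₁Deg_bijective M.isMinimal N.isMinimal (hP.comp M.isWeakEquiv))
  exact ⟨G.comp P, (Hom.isWeakEquiv_of_inverse (G := P.comp M.hom) hG hG').comp hP⟩

/-- A homotopy abelian algebra has a weak equivalence to a trivial one. -/
theorem Alg.IsHomotopyAbelian.exists_weakEquiv {A : Alg K V} (hA : A.IsHomotopyAbelian) :
    ∃ (U : ℤ → Type v) (_ : ∀ i, AddCommGroup (U i)) (_ : ∀ i, Module K (U i))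
      (F : Hom A (trivial K U)), F.IsWeakEquiv := by
  obtain ⟨U, _, _, hU⟩ := hA
  let T : Obj.{u, v} K → Prop := fun X => ∃ F : Hom X.alg (trivial K U), F.IsWeakEquiv
  have key : ∀ X Y : Obj.{u, v} K, WeaklyEquivalent X Y → (T X ↔ T Y) := by
    intro X Y hXY
    induction hXY with
    | rel X Y h =>
      obtain ⟨F, hF⟩ := h
      constructor
      · rintro ⟨G, hG⟩
        -- The arrow X ⇢ Y is reversed through a minimal model of X, which is also a minimal model
        -- of Y by composition.
        obtain ⟨M, -⟩ := X.alg.exists_minimalModel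
        let M' : MinimalModel Y.alg :=
          { M.toObj with
            isMinimal := M.isMinimal
            hom := F.comp M.hom
            isWeakEquiv := hF.comp M.isWeakEquiv }
        obtain ⟨P, hP⟩ := M'.exists_weakEquiv
        exact ⟨(G.comp M.hom).comp P, (hG.comp M.isWeakEquiv).comp hP⟩
      · rintro ⟨G, hG⟩
        exact ⟨G.comp F, hG.comp hF⟩
    | refl X => rfl
    | symm X Y _ h => exact h.symm
    | trans X Y Z _ _ h1 h2 => exact h1.trans h2
  let id : Hom (trivial K U) (trivial K U) := ⟨LinearMap.id, fun _ _ hx => hx, by simp, by simp,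
    rfl, by simp⟩
  have hid : id.IsWeakEquiv := Hom.isWeakEquiv_of_inverse (G := id) rfl rfl
  exact ⟨U, _, _, (key ⟨V, A⟩ ⟨U, trivial K U⟩ hU).mpr ⟨id, hid⟩⟩

end MinimalModels

/-! ### Removing Taylor coefficients in degrees at least two. -/

section Reduction

variable {K : Type u} [Field K] [CharZero K]
variable {V : ℤ → Type v} [∀ i, AddCommGroup (V i)] [∀ i, Module K (V i)]

/-- An `L∞[1]` structure is transported along the coalgebra morphism with Taylor coefficients `φ`,
if the linear part of `φ` is bijective. -/
theorem Alg.exists_transport {W : ℤ → Type w} [∀ i, AddCommGroup (W i)] [∀ i, Module K (W i)]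
    (A : Alg K V) {φ : Sym K V →ₗ[K] ⨁ i, W i} (hφ1 : φ 1 = 0)
    (hφd : IsDegreeZero φ)
    (hb : ∀ i, Function.Bijective
      (DirectSum.component K ℤ W i ∘ₗ φ ∘ₗ gen K V i)) :
    ∃ (B : Alg K W) (F : Hom A B), F.IsWeakEquiv ∧ F.F = cofree φ ∧
      Function.Surjective F.F ∧ (∀ x, proj K W (F.F x) = φ x) ∧
      ∀ x, proj K W (B.Q (F.F x)) = φ (A.Q x) := by
  have hF := isCoalgHom_cofree hφ1 hφd
  have hpF : ∀ x, proj K W (cofree φ x) = φ x := LinearMap.congr_fun (proj_cofree hφ1)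
  have hlin : ∀ i, Function.Bijective (linPart (cofree φ) i) := by
    intro i
    convert hb i using 2
    refine LinearMap.ext fun v => ?_
    exact congrArg (DirectSum.component K ℤ W i) (hpF _)
  obtain ⟨G, hG, hFG, hGF⟩ := hF.exists_inverse hlin
  refine ⟨A.transport hF hG hFG hGF, A.toTransport hF hG hFG hGF,
    A.toTransport_isWeakEquiv hF hG hFG hGF, rfl, fun x => ⟨G x, LinearMap.congr_fun hFG x⟩,
    hpF, fun x => ?_⟩
  change proj K W (cofree φ (A.Q (G (cofree φ x)))) = _
  rw [show G (cofree φ x) = x from LinearMap.congr_fun hGF x, hpF]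

theorem Alg.IsMinimal.of_surjective {W : ℤ → Type w} [∀ i, AddCommGroup (W i)]
    [∀ i, Module K (W i)] {A : Alg K V} {B : Alg K W} (hA : A.IsMinimal) (F : Hom A B)
    (hF : ∀ i, Function.Surjective (F.f₁Deg i)) : B.IsMinimal := by
  refine DirectSum.linearMap_ext K fun i => LinearMap.ext fun w => ?_
  obtain ⟨v, rfl⟩ := hF i w
  rw [LinearMap.comp_apply, ← F.f₁_lof, ← F.f₁_d, hA]
  simp

/-- A minimal algebra with a morphism to a trivial one that is injective in degrees at least two is
isomorphic to one whose Taylor coefficients have values in degrees at most one. -/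
theorem Alg.IsMinimal.exists_truncated {U : ℤ → Type w} [∀ i, AddCommGroup (U i)]
    [∀ i, Module K (U i)] {A : Alg K V} (hA : A.IsMinimal) (G : Hom A (trivial K U))
    (hG : ∀ i, 2 ≤ i → Function.Injective (G.f₁Deg i)) :
    ∃ (B : Alg K V) (F : Hom A B), F.IsWeakEquiv ∧ B.IsMinimal ∧
      ∀ i, 2 ≤ i → ∀ x, DirectSum.component K ℤ V i (proj K V (B.Q x)) = 0 := by
  have hj : ∀ i, ∃ j : U i →ₗ[K] V i, 2 ≤ i → ∀ x, j (G.f₁Deg i x) = x := by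
    intro i
    by_cases hi : 2 ≤ i
    · obtain ⟨j, hj⟩ := (G.f₁Deg i).exists_leftInverse_of_injective
        (LinearMap.ker_eq_bot.mpr (hG i hi))
      exact ⟨j, fun _ => LinearMap.congr_fun hj⟩
    · exact ⟨0, fun h => absurd h hi⟩
  choose j hj using hj
  have hGQ : ∀ x, G.F (A.Q x) = 0 := LinearMap.congr_fun G.map_Q
  -- In degrees at least two, where j g₁ = 1, the coordinates become j p G. The linear part is
  -- unchanged because p G restricts to g₁ on V.
  let φ : Sym K V →ₗ[K] ⨁ i, V i :=
    proj K V - DirectSum.lmap j ∘ₗ G.f₁ ∘ₗ proj K V + DirectSum.lmap j ∘ₗ proj K U ∘ₗ G.F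
  have hφ : ∀ x, φ x = proj K V x - DirectSum.lmap j (G.f₁ (proj K V x)) +
    DirectSum.lmap j (proj K U (G.F x)) := fun x => rfl
  have hφ1 : φ 1 = 0 := by simp [hφ, LInf.proj_one, G.map_unit]
  have hφd : IsDegreeZero φ := by
    intro d x hx
    obtain ⟨a, ha⟩ := proj_mem_of_mem_degPart d x hx
    obtain ⟨b, hb⟩ := proj_mem_of_mem_degPart _ _ (G.degree_zero d x hx)
    refine ⟨a - j d (G.f₁Deg d a) + j d b, ?_⟩
    rw [hφ, ← ha, ← hb, G.f₁_lof, DirectSum.lmap_lof, DirectSum.lmap_lof, map_add, map_sub]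
  have hφι : ∀ i v, φ (gen K V i v) = DirectSum.lof K ℤ V i v := by
    intro i v
    rw [hφ, LInf.proj_gen]
    exact sub_add_cancel _ _
  have hlin : ∀ i, DirectSum.component K ℤ V i ∘ₗ φ ∘ₗ gen K V i = LinearMap.id := by
    intro i
    ext v
    rw [LinearMap.comp_apply, LinearMap.comp_apply, hφι, DirectSum.component.lof_self]
    rfl
  obtain ⟨B, F, hF, -, hFs, hpF, hB⟩ := A.exists_transport hφ1 hφd (fun i => by
    rw [hlin]
    exact Function.bijective_id)
  refine ⟨B, F, hF, hA.of_surjective F fun i => ?_, fun i hi x => ?_⟩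
  · have : F.f₁Deg i = LinearMap.id := by
      rw [← hlin i]
      exact LinearMap.ext fun v => congrArg (DirectSum.component K ℤ V i) (hpF _)
    rw [this]
    exact Function.surjective_id
  · obtain ⟨x, rfl⟩ := hFs x
    -- G Q = 0 because the target is trivial. What remains is (1 - j g₁) p Q x, which is zero in
    -- degrees at least two.
    rw [hB, hφ, hGQ, map_zero, map_zero, add_zero]
    generalize proj K V (A.Q x) = y
    induction y using DirectSum.induction_on with
    | zero => simp
    | of k v =>
      change DirectSum.component K ℤ V i (DirectSum.lof K ℤ V k v -
        DirectSum.lmap j (G.f₁ (DirectSum.lof K ℤ V k v))) = 0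
      rw [G.f₁_lof, DirectSum.lmap_lof, ← map_sub]
      rcases eq_or_ne k i with rfl | hk
      · rw [hj k hi, sub_self, map_zero, map_zero]
      · exact DirectSum.of_eq_of_ne _ _ _ hk.symm
    | add y z hy hz =>
      rw [map_add, map_add, add_sub_add_comm, map_add, hy, hz, add_zero]

end Reduction

/-! ### The degree-zero part of S(V) as a polynomial ring. -/

section Polynomials

variable {K : Type u} [Field K] {V : ℤ → Type v} [∀ i, AddCommGroup (V i)] [∀ i, Module K (V i)]
variable {n : ℕ}

theorem gen_zero_commute (j : ℤ) (v : V 0) (w : V j) :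
    gen K V 0 v * gen K V j w = gen K V j w * gen K V 0 v := by
  rw [gen_mul_gen, zero_mul, Int.negOnePow_zero, one_smul]

theorem gen_zero_mul_mem_degPart {d : ℤ} (v : V 0) {x : Sym K V} (hx : x ∈ degPart K V d) :
    gen K V 0 v * x ∈ degPart K V d := by
  refine degPart_induction (P := fun x => gen K V 0 v * x ∈ degPart K V d) ?_ ?_ ?_ hx
  · rw [mul_zero]
    exact Submodule.zero_mem _
  · intro x y hx hy
    rw [mul_add]
    exact add_mem hx hy
  · intro k x hx
    have h := homPart_le_degPart _ _ (gen_mul_mem_homPart 0 v hx)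
    rwa [zero_add] at h

open scoped IsMulCommutative in
/-- The algebra map from polynomials to `S(V)` sending the variables to elements of degree zero. -/
def polyHom (e : Fin n → V 0) : MvPolynomial (Fin n) K →ₐ[K] Sym K V :=
  -- S(V) is not commutative as a ring, so `MvPolynomial.aeval` is applied in the commutative
  -- subalgebra generated by V⁰.
  haveI := Algebra.isMulCommutative_adjoin K (s := Set.range (gen K V 0)) (by
    rintro _ ⟨v, rfl⟩ _ ⟨w, rfl⟩
    exact gen_zero_commute 0 v w)
  (Subalgebra.val _).comp (MvPolynomial.aeval fun i =>
    (⟨gen K V 0 (e i), Algebra.subset_adjoin ⟨_, rfl⟩⟩ :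
      Algebra.adjoin K (Set.range (gen K V 0))))

open scoped IsMulCommutative in
theorem polyHom_X (e : Fin n → V 0) (i : Fin n) :
    polyHom (K := K) e (MvPolynomial.X i) = gen K V 0 (e i) := by
  simp [polyHom]

theorem polyHom_monomial (e : Fin n → V 0) (I : Fin n →₀ ℕ) :
    polyHom e (MvPolynomial.monomial I 1) =
      (((List.finRange n).flatMap fun i =>
        List.replicate (I i) (DirectSum.lof K ℤ V 0 (e i))).map (ι K V)).prod := by
  rw [MvPolynomial.monomial_eq, map_one, one_mul, Finsupp.prod_fintype _ _ (fun i => pow_zero _),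
    Fin.prod_univ_def, map_list_prod, List.map_map]
  induction List.finRange n with
  | nil => simp
  | cons i l ih =>
    rw [List.flatMap_cons, List.map_append, List.prod_append, ← ih, List.map_cons, List.prod_cons,
      List.map_replicate, List.prod_replicate, Function.comp_apply, map_pow, polyHom_X]
    rfl

/-- The algebra map from `S(V)` to polynomials which kills the elements of degree different from
zero, in terms of a basis of `V⁰`. -/
def toPoly (e : Module.Basis (Fin n) K (V 0)) : Sym K V →ₐ[K] MvPolynomial (Fin n) K :=
  lift (e.constr K MvPolynomial.X ∘ₗ DirectSum.component K ℤ V 0) (by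
    intro i j v w
    by_cases h : i = 0 ∧ j = 0
    · obtain ⟨rfl, rfl⟩ := h
      rw [zero_mul, Int.negOnePow_zero, one_smul, mul_comm]
    · have key : ∀ i (v : V i), i ≠ 0 → (e.constr K (MvPolynomial.X (R := K)) ∘ₗ
          DirectSum.component K ℤ V 0) (DirectSum.lof K ℤ V i v) = 0 := by
        intro i v hi
        rw [LinearMap.comp_apply]
        have : DirectSum.component K ℤ V 0 (DirectSum.lof K ℤ V i v) = 0 :=
          DirectSum.of_eq_of_ne _ _ _ hi.symm
        rw [this, map_zero]
      rcases not_and_or.mp h with h | h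
      · rw [key i v h]; simp
      · rw [key j w h]; simp)

theorem toPoly_gen (e : Module.Basis (Fin n) K (V 0)) (v : V 0) :
    toPoly e (gen K V 0 v) = e.constr K MvPolynomial.X v := by
  rw [toPoly, lift_gen, LinearMap.comp_apply, DirectSum.component.lof_self]

theorem toPoly_gen_of_ne (e : Module.Basis (Fin n) K (V 0)) {i : ℤ} (hi : i ≠ 0) (v : V i) :
    toPoly e (gen K V i v) = 0 := by
  rw [toPoly, lift_gen, LinearMap.comp_apply]
  have : DirectSum.component K ℤ V 0 (DirectSum.lof K ℤ V i v) = 0 :=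
    DirectSum.of_eq_of_ne _ _ _ hi.symm
  rw [this, map_zero]

theorem toPoly_polyHom (e : Module.Basis (Fin n) K (V 0)) (p : MvPolynomial (Fin n) K) :
    toPoly e (polyHom e p) = p := by
  have : (toPoly e).comp (polyHom e) = AlgHom.id K _ :=
    MvPolynomial.algHom_ext fun i => by
      rw [AlgHom.comp_apply, polyHom_X, toPoly_gen, Module.Basis.constr_basis, AlgHom.id_apply]
  exact AlgHom.congr_fun this p

theorem gen_mem_range_polyHom (e : Module.Basis (Fin n) K (V 0)) (v : V 0) :
    gen K V 0 v ∈ (polyHom (K := K) e).range := by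
  refine ⟨e.constr K MvPolynomial.X v, ?_⟩
  have : (polyHom e).toLinearMap ∘ₗ e.constr K MvPolynomial.X = gen K V 0 :=
    e.ext fun i => by
      rw [LinearMap.comp_apply, Module.Basis.constr_basis]
      exact polyHom_X _ i
  exact LinearMap.congr_fun this v

theorem toPoly_of_mem_degPart (e : Module.Basis (Fin n) K (V 0)) {d : ℤ} (hd : d ≠ 0)
    {x : Sym K V} (hx : x ∈ degPart K V d) : toPoly e x = 0 := by
  have : degPart K V d ≤ LinearMap.ker (toPoly e).toLinearMap := by
    refine Submodule.span_le.mpr ?_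
    rintro _ ⟨l, hl, rfl⟩
    have h : ∃ a ∈ l, a.1 ≠ 0 := by
      by_contra! h
      refine hd (hl ▸ List.sum_eq_zero fun x hx => ?_)
      obtain ⟨a, ha, rfl⟩ := List.mem_map.mp hx
      exact h a ha
    obtain ⟨a, ha, ha0⟩ := h
    change toPoly e _ = 0
    rw [map_list_prod]
    refine List.prod_eq_zero ?_
    rw [List.map_map]
    exact List.mem_map.mpr ⟨a, ha, toPoly_gen_of_ne e ha0 _⟩
  exact this hx

theorem toPoly_isHomogeneous (e : Module.Basis (Fin n) K (V 0)) (l : List (⨁ i, V i)) :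
    (toPoly e (l.map (ι K V)).prod).IsHomogeneous l.length := by
  induction l with
  | nil => simpa using MvPolynomial.isHomogeneous_one (Fin n) K
  | cons x l ih =>
    rw [List.map_cons, List.prod_cons, map_mul, List.length_cons, add_comm]
    refine MvPolynomial.IsHomogeneous.mul ?_ ih
    rw [toPoly, lift_ι, LinearMap.comp_apply, Module.Basis.constr_apply_fintype]
    refine MvPolynomial.IsHomogeneous.sum _ _ _ fun i _ => ?_
    exact (MvPolynomial.homogeneousSubmodule (Fin n) K 1).smul_mem _
      (MvPolynomial.isHomogeneous_X _ _)

/-- Products with a factor of negative degree vanish if `V` has no elements of negative degree. -/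
theorem prod_eq_zero_or_nonneg (hneg : ∀ i < 0, Subsingleton (V i)) (l : List (Σ i, V i)) :
    (l.map fun a => gen K V a.1 a.2).prod = 0 ∨ ∀ a ∈ l, 0 ≤ a.1 := by
  by_cases h : ∀ a ∈ l, 0 ≤ a.1
  · exact Or.inr h
  · push Not at h
    obtain ⟨a, ha, h0⟩ := h
    left
    refine List.prod_eq_zero (List.mem_map.mpr ⟨a, ha, ?_⟩)
    have := hneg _ h0
    rw [Subsingleton.elim a.2 0, map_zero]

theorem eq_zero_of_mem_degPart (hneg : ∀ i < 0, Subsingleton (V i)) {d : ℤ} (hd : d < 0)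
    {x : Sym K V} (hx : x ∈ degPart K V d) : x = 0 := by
  have : degPart K V d ≤ ⊥ := by
    refine Submodule.span_le.mpr ?_
    rintro _ ⟨l, hl, rfl⟩
    refine (prod_eq_zero_or_nonneg hneg l).resolve_right fun h => ?_
    have : 0 ≤ (l.map Sigma.fst).sum := List.sum_nonneg fun x hx => by
      obtain ⟨a, ha, rfl⟩ := List.mem_map.mp hx
      exact h a ha
    omega
  exact this hx

/-- Without negative degrees, a nonzero product of total degree 0 has only factors of degree 0. -/
theorem degPart_zero_le (hneg : ∀ i < 0, Subsingleton (V i)) (e : Module.Basis (Fin n) K (V 0)) :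
    degPart K V 0 ≤ Subalgebra.toSubmodule (polyHom (K := K) e).range := by
  refine Submodule.span_le.mpr ?_
  rintro _ ⟨l, hl, rfl⟩
  rcases prod_eq_zero_or_nonneg (K := K) hneg l with h | h
  · rw [h]
    exact Submodule.zero_mem _
  · refine (polyHom (K := K) e).range.list_prod_mem fun x hx => ?_
    obtain ⟨⟨i, v⟩, ha, rfl⟩ := List.mem_map.mp hx
    have h0 : i = 0 := by
      have h1 : i ≤ (l.map Sigma.fst).sum := List.single_le_sum (fun x hx => by
        obtain ⟨a, ha, rfl⟩ := List.mem_map.mp hx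
        exact h a ha) _ (List.mem_map.mpr ⟨_, ha, rfl⟩)
      exact le_antisymm (hl ▸ h1) (h _ ha)
    subst h0
    exact gen_mem_range_polyHom e v

theorem polyHom_toPoly (hneg : ∀ i < 0, Subsingleton (V i)) (e : Module.Basis (Fin n) K (V 0))
    {x : Sym K V} (hx : x ∈ degPart K V 0) : polyHom e (toPoly e x) = x := by
  obtain ⟨p, rfl⟩ := degPart_zero_le hneg e hx
  change polyHom e (toPoly e (polyHom e p)) = _
  rw [toPoly_polyHom]
  rfl

theorem polyHom_mem_degPart (e : Fin n → V 0) (p : MvPolynomial (Fin n) K) :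
    polyHom e p ∈ degPart K V 0 := by
  induction p using MvPolynomial.induction_on with
  | C c =>
    rw [← MvPolynomial.algebraMap_eq, AlgHom.commutes, Algebra.algebraMap_eq_smul_one]
    exact Submodule.smul_mem _ _ (Submodule.subset_span ⟨[], by simp, by simp⟩)
  | add p q hp hq => rw [map_add]; exact add_mem hp hq
  | mul_X p i hp =>
    rw [mul_comm, map_mul, polyHom_X]
    exact gen_zero_mul_mem_degPart (e i) hp

/-- The elements of degree one are sums of products of an element of `V¹` with elements of degree
zero. -/
theorem degPart_one_le (hneg : ∀ i < 0, Subsingleton (V i)) :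
    degPart K V 1 ≤ Submodule.span K
      {x | ∃ (v : V 1), ∃ y ∈ degPart K V 0, x = gen K V 1 v * y} := by
  refine Submodule.span_le.mpr ?_
  rintro _ ⟨l, hl, rfl⟩
  rcases prod_eq_zero_or_nonneg (K := K) hneg l with h | h
  · rw [h]
    exact Submodule.zero_mem _
  · clear hneg
    induction l with
    | nil => simp at hl
    | cons a l ih =>
      obtain ⟨i, v⟩ := a
      rw [List.map_cons, List.sum_cons] at hl
      have hi : 0 ≤ i := h ⟨i, v⟩ (by simp)
      have hl' : ∀ a ∈ l, 0 ≤ a.1 := fun a ha => h a (by simp [ha])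
      have hs : 0 ≤ (l.map Sigma.fst).sum := List.sum_nonneg fun x hx => by
        obtain ⟨a, ha, rfl⟩ := List.mem_map.mp hx
        exact hl' a ha
      rw [List.map_cons, List.prod_cons]
      rcases (show i = 0 ∨ i = 1 by simp only at hl; omega) with rfl | rfl
      · have := ih (by simpa using hl) hl'
        refine Submodule.span_induction (p := fun x _ => gen K V 0 v * x ∈ Submodule.span K
          {x | ∃ (v : V 1), ∃ y ∈ degPart K V 0, x = gen K V 1 v * y}) ?_ ?_ ?_ ?_ this
        · rintro _ ⟨w, y, hy, rfl⟩
          refine Submodule.subset_span ⟨w, gen K V 0 v * y, ?_, ?_⟩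
          · exact gen_zero_mul_mem_degPart v hy
          · rw [← mul_assoc, gen_zero_commute, mul_assoc]
        · rw [mul_zero]; exact Submodule.zero_mem _
        · intro x y _ _ hx hy
          rw [mul_add]; exact add_mem hx hy
        · intro c x _ hx
          rw [mul_smul_comm]; exact Submodule.smul_mem _ _ hx
      · exact Submodule.subset_span ⟨v, _, Submodule.subset_span ⟨l, by simpa using hl, rfl⟩, rfl⟩

end Polynomials

/-! ### Linear forms on S(V) as formal power series. -/

section PowerSeries

variable {K : Type u} [Field K] {V : ℤ → Type v} [∀ i, AddCommGroup (V i)] [∀ i, Module K (V i)]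
variable {n : ℕ}

/-- The power series `∑_I λ(e^{⊙ I}) / I! x^I` of a linear form `λ` on `S(V)`. -/
def ser (e : Fin n → V 0) : (Sym K V →ₗ[K] K) →ₗ[K] MvPowerSeries (Fin n) K where
  toFun l := fun I => (∏ i, ((I i).factorial : K))⁻¹ * l (polyHom e (MvPolynomial.monomial I 1))
  map_add' _ _ := funext fun _ => mul_add _ _ _
  map_smul' _ _ := funext fun _ => mul_left_comm _ _ _

theorem coeff_ser (e : Fin n → V 0) (l : Sym K V →ₗ[K] K) (I : Fin n →₀ ℕ) :
    MvPowerSeries.coeff I (ser e l) =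
      (∏ i, ((I i).factorial : K))⁻¹ * l (polyHom e (MvPolynomial.monomial I 1)) := rfl

theorem kuranishiSeries_eq_ser (A : Alg K V) (e : Module.Basis (Fin n) K (V 0))
    (η : Module.Dual K (V 1)) :
    kuranishiSeries A e η = ser e (η ∘ₗ DirectSum.component K ℤ V 1 ∘ₗ proj K V ∘ₗ A.Q) := by
  funext I
  change _ = _ * η (DirectSum.component K ℤ V 1 (proj K V (A.Q _)))
  rw [polyHom_monomial]
  rfl

theorem ser_congr (e : Fin n → V 0) {l m : Sym K V →ₗ[K] K}
    (h : ∀ x ∈ degPart K V 0, l x = m x) : ser e l = ser e m := by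
  ext I
  rw [coeff_ser, coeff_ser, h _ (polyHom_mem_degPart e _)]

theorem polyHom_monomial_add_single (e : Fin n → V 0) (I : Fin n →₀ ℕ) (i : Fin n) :
    polyHom (K := K) e (MvPolynomial.monomial (I + Finsupp.single i 1) 1) =
      gen K V 0 (e i) * polyHom e (MvPolynomial.monomial I 1) := by
  rw [← polyHom_X, ← map_mul, MvPolynomial.X, MvPolynomial.monomial_mul, add_comm, one_mul]

theorem prod_factorial_add_single (I : Fin n →₀ ℕ) (i : Fin n) :
    ∏ j, (((I + Finsupp.single i 1 : Fin n →₀ ℕ) j).factorial : K) =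
      (I i + 1) * ∏ j, ((I j).factorial : K) := by
  rw [← Finset.mul_prod_erase _ _ (Finset.mem_univ i),
    ← Finset.mul_prod_erase Finset.univ (fun j => ((I j).factorial : K)) (Finset.mem_univ i),
    ← mul_assoc]
  congr 1
  · simp [Nat.factorial_succ]
  · refine Finset.prod_congr rfl fun j hj => ?_
    simp [Finsupp.single_eq_of_ne (Finset.ne_of_mem_erase hj)]

theorem ser_counit (e : Fin n → V 0) : ser e (counit K V) = 1 := by
  ext I
  rw [coeff_ser, MvPowerSeries.coeff_one]
  split_ifs with h
  · subst h
    simp [counit_one]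
  · obtain ⟨i, hi⟩ := Finsupp.ne_iff.mp h
    obtain ⟨J, rfl⟩ : ∃ J, I = J + Finsupp.single i 1 :=
      ⟨I - Finsupp.single i 1, (tsub_add_cancel_of_le
        (Finsupp.single_le_iff.mpr (Nat.one_le_iff_ne_zero.mpr hi))).symm⟩
    rw [polyHom_monomial_add_single, counit_gen_mul, mul_zero]

/-- The product of linear forms dual to the coproduct. -/
def dualMul (l m : Sym K V →ₗ[K] K) : Sym K V →ₗ[K] K :=
  LinearMap.mul' K K ∘ₗ TensorProduct.map l m ∘ₗ comul K V

theorem dualMul_comp {W : ℤ → Type w} [∀ i, AddCommGroup (W i)] [∀ i, Module K (W i)]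
    {F : Sym K V →ₗ[K] Sym K W} (hF : IsCoalgHom F) (l m : Sym K W →ₗ[K] K) :
    dualMul l m ∘ₗ F = dualMul (l ∘ₗ F) (m ∘ₗ F) := by
  rw [dualMul, LinearMap.comp_assoc, LinearMap.comp_assoc, hF.map_comul, dualMul,
    TensorProduct.map_comp, LinearMap.comp_assoc]

theorem dualMul_gen_mul (l m : Sym K V →ₗ[K] K) (v : V 0) :
    dualMul l m ∘ₗ LinearMap.mulLeft K (gen K V 0 v) =
      dualMul (l ∘ₗ LinearMap.mulLeft K (gen K V 0 v)) m +
        dualMul l (m ∘ₗ LinearMap.mulLeft K (gen K V 0 v)) := by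
  refine LinearMap.ext fun x => ?_
  simp only [dualMul, LinearMap.comp_apply, LinearMap.add_apply, LinearMap.mulLeft_apply,
    comul_gen_mul]
  induction comul K V x using TensorProduct.induction_on with
  | zero => simp
  | add s t hs ht =>
    simp only [map_add, hs, ht]
    abel
  | tmul a b =>
    have : sign K V 0 a = a := sign_of_even (by simp) a
    rw [comulAct_lof, this]
    simp

/-- The linear form on `S(V)` with given power series, vanishing in degrees different from zero. -/
def dualSer (e : Module.Basis (Fin n) K (V 0)) (a : MvPowerSeries (Fin n) K) : Sym K V →ₗ[K] K :=
  (MvPolynomial.basisMonomials (Fin n) K).constr K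
    (fun I => (∏ i, ((I i).factorial : K)) * MvPowerSeries.coeff I a) ∘ₗ (toPoly e).toLinearMap

theorem dualSer_polyHom (e : Module.Basis (Fin n) K (V 0)) (a : MvPowerSeries (Fin n) K)
    (I : Fin n →₀ ℕ) : dualSer e a (polyHom e (MvPolynomial.monomial I 1)) =
      (∏ i, ((I i).factorial : K)) * MvPowerSeries.coeff I a := by
  rw [dualSer, LinearMap.comp_apply, AlgHom.toLinearMap_apply, toPoly_polyHom,
    ← congrFun (MvPolynomial.coe_basisMonomials (Fin n) K) I, Module.Basis.constr_basis]

theorem dualSer_of_mem_degPart (e : Module.Basis (Fin n) K (V 0)) (a : MvPowerSeries (Fin n) K)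
    {d : ℤ} (hd : d ≠ 0) {x : Sym K V} (hx : x ∈ degPart K V d) : dualSer e a x = 0 := by
  rw [dualSer, LinearMap.comp_apply, AlgHom.toLinearMap_apply, toPoly_of_mem_degPart e hd hx,
    map_zero]

variable [CharZero K]

theorem prod_factorial_ne_zero (I : Fin n →₀ ℕ) : ∏ i, ((I i).factorial : K) ≠ 0 :=
  Finset.prod_ne_zero_iff.mpr fun _ _ => Nat.cast_ne_zero.mpr (Nat.factorial_ne_zero _)

/-- Formally the series of l is l(exp(∑ xᵢ eᵢ)), and differentiating the exponential by xᵢ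
multiplies it by eᵢ. -/
theorem pderiv_ser (e : Fin n → V 0) (l : Sym K V →ₗ[K] K) (i : Fin n) :
    MvPowerSeries.pderiv K i (ser e l) = ser e (l ∘ₗ LinearMap.mulLeft K (gen K V 0 (e i))) := by
  ext I
  have h : ((I i : K) + 1) ≠ 0 := Nat.cast_add_one_ne_zero _
  have h' := prod_factorial_ne_zero (K := K) I
  rw [MvPowerSeries.coeff_pderiv, coeff_ser, coeff_ser, polyHom_monomial_add_single,
    prod_factorial_add_single, LinearMap.comp_apply, LinearMap.mulLeft_apply]
  field_simp

/-- The exponential of an element of degree 0 is formally group-like. The proof compares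
coefficients by induction on the degree, as both products satisfy the Leibniz rule for ∂ᵢ and agree
at the origin. -/
theorem ser_dualMul (e : Fin n → V 0) (l m : Sym K V →ₗ[K] K) :
    ser e (dualMul l m) = ser e l * ser e m := by
  have key : ∀ (k : ℕ) (I : Fin n →₀ ℕ), I.degree = k → ∀ l m : Sym K V →ₗ[K] K,
      MvPowerSeries.coeff I (ser e (dualMul l m)) = MvPowerSeries.coeff I (ser e l * ser e m) := by
    intro k
    induction k with
    | zero =>
      intro I hI l m
      rw [Finsupp.degree_eq_zero_iff] at hI
      subst hI
      rw [MvPowerSeries.coeff_zero_eq_constantCoeff_apply (ser e l * ser e m), map_mul,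
        ← MvPowerSeries.coeff_zero_eq_constantCoeff_apply,
        ← MvPowerSeries.coeff_zero_eq_constantCoeff_apply]
      simp only [coeff_ser]
      simp [dualMul, comul_one]
    | succ k ih =>
      intro I hI l m
      have hI0 : I ≠ 0 := by rintro rfl; simp at hI
      obtain ⟨i, hi⟩ := Finsupp.ne_iff.mp hI0
      obtain ⟨J, rfl⟩ : ∃ J, I = J + Finsupp.single i 1 :=
        ⟨I - Finsupp.single i 1, (tsub_add_cancel_of_le
          (Finsupp.single_le_iff.mpr (Nat.one_le_iff_ne_zero.mpr hi))).symm⟩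
      have hJ : J.degree = k := by simpa using hI
      have h : ((J i : K) + 1) ≠ 0 := Nat.cast_add_one_ne_zero _
      refine mul_right_cancel₀ h ?_
      rw [← MvPowerSeries.coeff_pderiv, ← MvPowerSeries.coeff_pderiv, pderiv_ser, dualMul_gen_mul,
        map_add, map_add, ih J hJ, ih J hJ, Derivation.leibniz, pderiv_ser, pderiv_ser, map_add,
        smul_eq_mul, smul_eq_mul, add_comm, mul_comm (ser e m)]
  ext I
  exact key _ I rfl l m

theorem ser_dualSer (e : Module.Basis (Fin n) K (V 0)) (a : MvPowerSeries (Fin n) K) :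
    ser e (dualSer e a) = a := by
  ext I
  rw [coeff_ser, dualSer_polyHom, inv_mul_cancel_left₀ (prod_factorial_ne_zero I)]

/-- The monomials in the basis of V⁰ span the degree-zero part, and a form's values on them are the
coefficients of its series up to nonzero factorials. -/
theorem eq_of_ser_eq (hneg : ∀ i < 0, Subsingleton (V i)) (e : Module.Basis (Fin n) K (V 0))
    {l m : Sym K V →ₗ[K] K} (h : ser e l = ser e m) {x : Sym K V} (hx : x ∈ degPart K V 0) :
    l x = m x := by
  rw [← polyHom_toPoly hneg e hx]
  refine LinearMap.congr_fun (f := l ∘ₗ (polyHom e).toLinearMap)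
    (g := m ∘ₗ (polyHom e).toLinearMap)
    ((MvPolynomial.basisMonomials (Fin n) K).ext fun I => ?_) _
  rw [MvPolynomial.coe_basisMonomials]
  have h1 := congrArg (MvPowerSeries.coeff I) h
  rw [coeff_ser, coeff_ser] at h1
  exact mul_left_cancel₀ (inv_ne_zero (prod_factorial_ne_zero I)) h1

/-- A coalgebra morphism induces a map of algebras of power series. -/
def pullback {W : ℤ → Type w} [∀ i, AddCommGroup (W i)] [∀ i, Module K (W i)] {m : ℕ}
    (hneg : ∀ i < 0, Subsingleton (W i)) (e : Fin n → V 0)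
    (e' : Module.Basis (Fin m) K (W 0)) {F : Sym K V →ₗ[K] Sym K W} (hF : IsCoalgHom F) :
    MvPowerSeries (Fin m) K →ₐ[K] MvPowerSeries (Fin n) K :=
  -- Many forms share one series. The pullback does not depend on the choice, as F preserves degree
  -- 0 and there the form is determined.
  have key : ∀ l : Sym K W →ₗ[K] K, ser e (dualSer e' (ser e' l) ∘ₗ F) = ser e (l ∘ₗ F) :=
    fun l => ser_congr e fun x hx =>
      eq_of_ser_eq hneg e' (ser_dualSer e' _) (hF.degree_zero 0 x hx)
  AlgHom.ofLinearMap
    { toFun := fun a => ser e (dualSer e' a ∘ₗ F)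
      map_add' := fun a b => by
        rw [← ser_dualSer e' a, ← ser_dualSer e' b, ← map_add, key, key, key, LinearMap.add_comp,
          map_add]
      map_smul' := fun c a => by
        rw [← ser_dualSer e' a, ← map_smul, key, key, LinearMap.smul_comp, map_smul,
          RingHom.id_apply] }
    (by
      change ser e (dualSer e' 1 ∘ₗ F) = 1
      rw [← ser_counit e', key, hF.map_counit, ser_counit])
    (fun a b => by
      change ser e (dualSer e' (a * b) ∘ₗ F) = ser e (dualSer e' a ∘ₗ F) * ser e (dualSer e' b ∘ₗ F)
      rw [← ser_dualMul, ← dualMul_comp hF, ← key (dualMul _ _), ser_dualMul, ser_dualSer,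
        ser_dualSer])

section Pullback

variable {W : ℤ → Type w} [∀ i, AddCommGroup (W i)] [∀ i, Module K (W i)] {m : ℕ}

theorem pullback_apply (hneg : ∀ i < 0, Subsingleton (W i)) (e : Fin n → V 0)
    (e' : Module.Basis (Fin m) K (W 0)) {F : Sym K V →ₗ[K] Sym K W} (hF : IsCoalgHom F)
    (a : MvPowerSeries (Fin m) K) : pullback hneg e e' hF a = ser e (dualSer e' a ∘ₗ F) := rfl

theorem pullback_ser (hneg : ∀ i < 0, Subsingleton (W i)) (e : Fin n → V 0)
    (e' : Module.Basis (Fin m) K (W 0)) {F : Sym K V →ₗ[K] Sym K W} (hF : IsCoalgHom F)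
    (l : Sym K W →ₗ[K] K) : pullback hneg e e' hF (ser e' l) = ser e (l ∘ₗ F) :=
  ser_congr e fun x hx => eq_of_ser_eq hneg e' (ser_dualSer e' _) (hF.degree_zero 0 x hx)

theorem pullback_pullback (hnegV : ∀ i < 0, Subsingleton (V i))
    (hneg : ∀ i < 0, Subsingleton (W i)) (e : Module.Basis (Fin n) K (V 0))
    (e' : Module.Basis (Fin m) K (W 0)) {F : Sym K V →ₗ[K] Sym K W} (hF : IsCoalgHom F)
    {G : Sym K W →ₗ[K] Sym K V} (hG : IsCoalgHom G) (h : G ∘ₗ F = LinearMap.id)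
    (a : MvPowerSeries (Fin n) K) :
    pullback hneg e e' hF (pullback hnegV e' e hG a) = a := by
  rw [pullback_apply hnegV, pullback_ser, LinearMap.comp_assoc, h, LinearMap.comp_id, ser_dualSer]

end Pullback

end PowerSeries

/-! ### Contraction and invariance of the Kuranishi ideal. -/

section Ideals

variable {K : Type u} [Field K] {V : ℤ → Type v} [∀ i, AddCommGroup (V i)] [∀ i, Module K (V i)]
variable {n : ℕ}

/-- Contraction with a linear form on `V¹`. -/
def contract (η : Module.Dual K (V 1)) : Sym K V →ₗ[K] Sym K V :=
  (TensorProduct.lid K (Sym K V)).toLinearMap ∘ₗ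
    TensorProduct.map (η ∘ₗ DirectSum.component K ℤ V 1 ∘ₗ proj K V) LinearMap.id ∘ₗ comul K V

theorem component_signV (j : ℤ) (x : ⨁ i, V i) :
    DirectSum.component K ℤ V 1 (signV K V j x) =
      j.negOnePow • DirectSum.component K ℤ V 1 x := by
  induction x using DirectSum.induction_on with
  | zero => simp
  | of i v =>
    change DirectSum.component K ℤ V 1 (signV K V j (DirectSum.lof K ℤ V i v)) =
      j.negOnePow • DirectSum.component K ℤ V 1 (DirectSum.lof K ℤ V i v)
    rw [signV_lof, Units.smul_def, map_zsmul, Units.smul_def]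
    rcases eq_or_ne i 1 with rfl | hi
    · rw [mul_one]
    · have : DirectSum.component K ℤ V 1 (DirectSum.lof K ℤ V i v) = 0 :=
        DirectSum.of_eq_of_ne _ _ _ hi.symm
      rw [this, smul_zero, smul_zero]
  | add x y hx hy => simp only [map_add, hx, hy, smul_add]

theorem contract_gen_mul (η : Module.Dual K (V 1)) (i : ℤ) (v : V i) (x : Sym K V) :
    contract η (gen K V i v * x) =
      η (DirectSum.component K ℤ V 1 (DirectSum.lof K ℤ V i v)) • x +
        i.negOnePow • (gen K V i v * contract η x) := by
  have key : ∀ t : Sym K V ⊗[K] Sym K V, TensorProduct.lid K (Sym K V)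
      (TensorProduct.map (η ∘ₗ DirectSum.component K ℤ V 1 ∘ₗ proj K V) LinearMap.id
        (comulAct K V (DirectSum.lof K ℤ V i v) t)) =
      η (DirectSum.component K ℤ V 1 (DirectSum.lof K ℤ V i v)) •
        TensorProduct.lid K (Sym K V) (TensorProduct.map (counit K V) LinearMap.id t) +
      i.negOnePow • (gen K V i v * TensorProduct.lid K (Sym K V)
        (TensorProduct.map (η ∘ₗ DirectSum.component K ℤ V 1 ∘ₗ proj K V) LinearMap.id t)) := by
    intro t
    induction t using TensorProduct.induction_on with
    | zero => simp
    | add s t hs ht =>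
      simp only [map_add, hs, ht, smul_add, mul_add]
      abel
    | tmul a b =>
      rw [comulAct_lof]
      simp only [map_add, TensorProduct.map_tmul, LinearMap.comp_apply, LinearMap.id_apply,
        proj_gen_mul, proj_sign, component_signV, TensorProduct.lid_tmul,
        map_smul, Units.smul_def, map_zsmul, smul_eq_mul, mul_smul_comm, smul_assoc]
      rw [smul_smul, mul_comm]
  have h := key (comul K V x)
  rwa [← comul_gen_mul, counit_comul] at h

theorem contract_one (η : Module.Dual K (V 1)) : contract η (1 : Sym K V) = 0 := by
  simp [contract, comul_one, proj_one]

theorem contract_of_mem (hneg : ∀ i < 0, Subsingleton (V i)) (η : Module.Dual K (V 1))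
    {x : Sym K V} (hx : x ∈ degPart K V 0) : contract η x = 0 := by
  have : degPart K V 0 ≤ LinearMap.ker (contract η) := by
    refine Submodule.span_le.mpr ?_
    rintro _ ⟨l, hl, rfl⟩
    rcases prod_eq_zero_or_nonneg (K := K) hneg l with h | h
    · rw [h]
      exact Submodule.zero_mem _
    · induction l with
      | nil => exact contract_one η
      | cons a l ih =>
        obtain ⟨i, v⟩ := a
        rw [List.map_cons, List.sum_cons] at hl
        have hi : 0 ≤ i := h ⟨i, v⟩ (by simp)
        have hl' : ∀ a ∈ l, 0 ≤ a.1 := fun a ha => h a (by simp [ha])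
        have hs : 0 ≤ (l.map Sigma.fst).sum := List.sum_nonneg fun x hx => by
          obtain ⟨a, ha, rfl⟩ := List.mem_map.mp hx
          exact hl' a ha
        obtain rfl : i = 0 := by simp only at hl; omega
        have h1 : DirectSum.component K ℤ V 1 (DirectSum.lof K ℤ V 0 v) = 0 :=
          DirectSum.of_eq_of_ne (β := V) 0 1 v one_ne_zero
        have h2 := ih (by simpa using hl) hl'
        change contract η _ = 0 at h2
        change contract η _ = 0
        rw [List.map_cons, List.prod_cons, contract_gen_mul, h1, h2]
        simp
  exact this hx

theorem contract_gen_one_mul (hneg : ∀ i < 0, Subsingleton (V i)) (η : Module.Dual K (V 1))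
    (v : V 1) {x : Sym K V} (hx : x ∈ degPart K V 0) :
    contract η (gen K V 1 v * x) = η v • x := by
  rw [contract_gen_mul, contract_of_mem hneg η hx, DirectSum.component.lof_self, mul_zero,
    smul_zero, add_zero]

theorem contract_mem_degPart (η : Module.Dual K (V 1)) {d : ℤ} {x : Sym K V}
    (hx : x ∈ degPart K V d) : contract η x ∈ degPart K V (d - 1) := by
  refine degPart_induction (P := fun x => contract η x ∈ degPart K V (d - 1)) ?_ ?_ ?_ hx
  · rw [map_zero]
    exact Submodule.zero_mem _
  · intro x y hx hy
    rw [map_add]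
    exact add_mem hx hy
  · intro n x hx
    refine apply_comul_mem (degPart K V (d - 1)) ((TensorProduct.lid K (Sym K V)).toLinearMap ∘ₗ
      TensorProduct.map (η ∘ₗ DirectSum.component K ℤ V 1 ∘ₗ proj K V) LinearMap.id) hx ?_
    intro i j a b x y _ hab hx hy
    change η (DirectSum.component K ℤ V 1 (proj K V x)) • y ∈ _
    rcases eq_or_ne a 1 with rfl | ha
    · refine Submodule.smul_mem _ _ ?_
      rw [← hab, add_sub_cancel_left]
      exact homPart_le_degPart _ _ hy
    · obtain ⟨w, hw⟩ := proj_mem_of_mem_degPart a x (homPart_le_degPart _ _ hx)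
      have : DirectSum.component K ℤ V 1 (DirectSum.lof K ℤ V a w) = 0 :=
        DirectSum.of_eq_of_ne _ _ _ ha.symm
      rw [← hw, this, map_zero, zero_smul]
      exact Submodule.zero_mem _

/-- Without negative degrees, an element of degree one is linear in V¹ with coefficients of degree
zero, and the contractions read off these coefficients. -/
theorem sum_gen_mul_contract (hneg : ∀ i < 0, Subsingleton (V i)) {m : ℕ}
    (ε : Module.Basis (Fin m) K (V 1)) {x : Sym K V} (hx : x ∈ degPart K V 1) :
    ∑ k, gen K V 1 (ε k) * contract (ε.coord k) x = x := by
  refine Submodule.span_induction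
    (p := fun x _ => ∑ k, gen K V 1 (ε k) * contract (ε.coord k) x = x) ?_ ?_ ?_ ?_
    (degPart_one_le hneg hx)
  · rintro _ ⟨v, y, hy, rfl⟩
    simp only [contract_gen_one_mul hneg _ v hy, mul_smul_comm, ← smul_mul_assoc]
    rw [← Finset.sum_mul]
    congr 1
    simp only [← map_smul, ← map_sum, Module.Basis.coord_apply, ε.sum_repr]
  · simp
  · intro x y _ _ hx hy
    simp only [map_add, mul_add, Finset.sum_add_distrib, hx, hy]
  · intro c x _ hx
    simp only [map_smul, mul_smul_comm, ← Finset.smul_sum, hx]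

/-- By the co-Leibniz rule, contraction by η after Q is convolution with η p Q, minus Q applied to
the contraction of x. The latter is zero since x has degree 0. -/
theorem Alg.apply_contract_Q (A : Alg K V) (hneg : ∀ i < 0, Subsingleton (V i))
    (η : Module.Dual K (V 1)) (l : Sym K V →ₗ[K] K) {x : Sym K V} (hx : x ∈ degPart K V 0) :
    l (contract η (A.Q x)) =
      dualMul (η ∘ₗ DirectSum.component K ℤ V 1 ∘ₗ proj K V ∘ₗ A.Q) l x := by
  have h0 : A.Q (contract η x) = 0 := by rw [contract_of_mem hneg η hx, map_zero]
  have h := LinearMap.congr_fun A.coderivation x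
  simp only [LinearMap.comp_apply] at h
  rw [contract, LinearMap.comp_apply, LinearMap.comp_apply, h, LinearMap.add_apply, map_add,
    map_add]
  have h2 : ∀ t : Sym K V ⊗[K] Sym K V, (TensorProduct.lid K (Sym K V)).toLinearMap
      (TensorProduct.map (η ∘ₗ DirectSum.component K ℤ V 1 ∘ₗ proj K V) LinearMap.id
        (TensorProduct.map (sign K V 1).toLinearMap A.Q t)) =
      -A.Q ((TensorProduct.lid K (Sym K V)).toLinearMap
        (TensorProduct.map (η ∘ₗ DirectSum.component K ℤ V 1 ∘ₗ proj K V) LinearMap.id t)) := by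
    intro t
    induction t using TensorProduct.induction_on with
    | zero => simp
    | add s t hs ht => simp only [map_add, hs, ht, neg_add]
    | tmul a b => simp [proj_sign, component_signV, Units.smul_def]
  have h3 : ∀ t : Sym K V ⊗[K] Sym K V, l ((TensorProduct.lid K (Sym K V)).toLinearMap
      (TensorProduct.map (η ∘ₗ DirectSum.component K ℤ V 1 ∘ₗ proj K V) LinearMap.id
        (TensorProduct.map A.Q LinearMap.id t))) =
      LinearMap.mul' K K (TensorProduct.map
        (η ∘ₗ DirectSum.component K ℤ V 1 ∘ₗ proj K V ∘ₗ A.Q) l t) := by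
    intro t
    induction t using TensorProduct.induction_on with
    | zero => simp
    | add s t hs ht => simp only [map_add, hs, ht]
    | tmul a b => simp
  rw [h2]
  change l (_ + -A.Q (contract η x)) = _
  rw [h0, neg_zero, add_zero, h3]
  rfl

variable [CharZero K]

theorem Alg.ser_contract_Q (A : Alg K V) (hneg : ∀ i < 0, Subsingleton (V i))
    (e : Module.Basis (Fin n) K (V 0)) (η : Module.Dual K (V 1)) (l : Sym K V →ₗ[K] K) :
    ser e (l ∘ₗ contract η ∘ₗ A.Q) = kuranishiSeries A e η * ser e l := by
  rw [kuranishiSeries_eq_ser, ← ser_dualMul]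
  exact ser_congr e fun x hx => A.apply_contract_Q hneg η l hx

/-- Expanding Q x along a basis of V¹ writes l ∘ Q as a sum of terms, each a Kuranishi series times
another series. This is where finiteness of V¹ enters. -/
theorem Alg.ser_Q_mem (A : Alg K V) (hneg : ∀ i < 0, Subsingleton (V i))
    [Module.Finite K (V 1)] (e : Module.Basis (Fin n) K (V 0)) (l : Sym K V →ₗ[K] K) :
    ser e (l ∘ₗ A.Q) ∈ kuranishiIdeal A e := by
  let ε := Module.finBasis K (V 1)
  have : ser e (l ∘ₗ A.Q) = ∑ k, ser e ((l ∘ₗ LinearMap.mulLeft K (gen K V 1 (ε k))) ∘ₗ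
      contract (ε.coord k) ∘ₗ A.Q) := by
    rw [← map_sum]
    refine ser_congr e fun x hx => ?_
    conv_lhs => rw [LinearMap.comp_apply,
      ← sum_gen_mul_contract hneg ε (show A.Q x ∈ degPart K V 1 from A.degree_one 0 x hx), map_sum]
    rw [LinearMap.sum_apply]
    rfl
  rw [this]
  refine Ideal.sum_mem _ fun k _ => ?_
  rw [A.ser_contract_Q hneg]
  exact Ideal.mul_mem_right _ _ (Ideal.subset_span ⟨_, rfl⟩)

variable {W : ℤ → Type w} [∀ i, AddCommGroup (W i)] [∀ i, Module K (W i)] {m : ℕ}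
variable {A : Alg K V} {B : Alg K W}

/-- With R the codifferential of B, the pullback of a generator is the series of η p R F = (η p F)
Q, again of the form l ∘ Q. -/
theorem Hom.map_kuranishiIdeal_le (F : Hom A B) (hnegV : ∀ i < 0, Subsingleton (V i))
    (hneg : ∀ i < 0, Subsingleton (W i)) [Module.Finite K (V 1)]
    (e : Module.Basis (Fin n) K (V 0)) (e' : Module.Basis (Fin m) K (W 0)) :
    (kuranishiIdeal B e').map (pullback hneg e e' F.isCoalgHom) ≤ kuranishiIdeal A e := by
  rw [Ideal.map_le_iff_le_comap]
  refine Ideal.span_le.mpr ?_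
  rintro _ ⟨η, rfl⟩
  change pullback hneg e e' F.isCoalgHom _ ∈ kuranishiIdeal A e
  rw [kuranishiSeries_eq_ser, pullback_ser]
  have h := A.ser_Q_mem hnegV e (η ∘ₗ DirectSum.component K ℤ W 1 ∘ₗ proj K W ∘ₗ F.F)
  simp only [LinearMap.comp_assoc] at h ⊢
  rwa [F.map_Q] at h

/-- Isomorphic minimal algebras have isomorphic Kuranishi algebras. -/
theorem Hom.nonempty_kuranishi_equiv (F : Hom A B) (hnegV : ∀ i < 0, Subsingleton (V i))
    (hneg : ∀ i < 0, Subsingleton (W i)) [Module.Finite K (V 1)] [Module.Finite K (W 1)]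
    (hF : ∀ i, Function.Bijective (F.f₁Deg i))
    (e : Module.Basis (Fin n) K (V 0)) (e' : Module.Basis (Fin m) K (W 0)) :
    Nonempty ((MvPowerSeries (Fin n) K ⧸ kuranishiIdeal A e) ≃ₐ[K]
      MvPowerSeries (Fin m) K ⧸ kuranishiIdeal B e') := by
  obtain ⟨G, hFG, hGF⟩ := F.exists_inverse hF
  have h1 := F.map_kuranishiIdeal_le hnegV hneg e e'
  have h2 := G.map_kuranishiIdeal_le hneg hnegV e' e
  let f : MvPowerSeries (Fin n) K ≃ₐ[K] MvPowerSeries (Fin m) K :=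
    AlgEquiv.ofAlgHom (pullback hnegV e' e G.isCoalgHom) (pullback hneg e e' F.isCoalgHom)
      (AlgHom.ext fun a => pullback_pullback hneg hnegV e' e G.isCoalgHom F.isCoalgHom hFG a)
      (AlgHom.ext fun a => pullback_pullback hnegV hneg e e' F.isCoalgHom G.isCoalgHom hGF a)
  refine ⟨Ideal.quotientEquivAlg _ _ f (le_antisymm ?_ h2)⟩
  intro x hx
  have hx' : pullback hneg e e' F.isCoalgHom x ∈ kuranishiIdeal A e :=
    h1 (Ideal.mem_map_of_mem _ hx)
  have := Ideal.mem_map_of_mem f hx'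
  rwa [show f (pullback hneg e e' F.isCoalgHom x) = x from f.apply_symm_apply x] at this

end Ideals

/-! ### Power series rings, coordinate changes and the quadratic normal form. -/

section FormalCoordinates

open MvPowerSeries

variable {K : Type u} [Field K] {n : ℕ}

/-- Otherwise f - τ(f) would have nonzero constant term, hence be a unit, although τ kills it.
Algebra maps of power series rings are therefore local without any continuity assumption. -/
theorem ringHom_apply_eq_constantCoeff (τ : MvPowerSeries (Fin n) K →+* K)
    (hτ : ∀ c, τ (C c) = c) (f : MvPowerSeries (Fin n) K) : τ f = constantCoeff f := by
  by_contra h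
  have hu : IsUnit (f - C (τ f)) := by
    rw [MvPowerSeries.isUnit_iff_constantCoeff, map_sub, constantCoeff_C, isUnit_iff_ne_zero]
    exact sub_ne_zero.mpr (Ne.symm h)
  have := hu.map τ
  rw [map_sub, hτ, sub_self] at this
  exact not_isUnit_zero this

theorem coeff_single_one_mul (i : Fin n) (f g : MvPowerSeries (Fin n) K) :
    coeff (Finsupp.single i 1) (f * g) =
      constantCoeff f * coeff (Finsupp.single i 1) g +
        coeff (Finsupp.single i 1) f * constantCoeff g := by
  have h : ∀ f : MvPowerSeries (Fin n) K,
      coeff (Finsupp.single i 1) f = constantCoeff (pderiv K i f) := by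
    intro f
    rw [← coeff_zero_eq_constantCoeff_apply, coeff_pderiv]
    simp
  rw [h, Derivation.leibniz, h f, h g, map_add, smul_eq_mul, smul_eq_mul, map_mul, map_mul,
    mul_comm (constantCoeff g)]

theorem exists_eq_sum_X_mul (f : MvPowerSeries (Fin n) K) (hf : constantCoeff f = 0) :
    ∃ g : Fin n → MvPowerSeries (Fin n) K, f = ∑ i, X i * g i ∧
      ∀ i, constantCoeff (g i) = coeff (Finsupp.single i 1) f := by
  classical
  -- Each monomial is assigned to the smallest variable dividing it.
  let c : Fin n → MvPowerSeries (Fin n) K := fun i I =>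
    if I.support.min = (i : WithTop (Fin n)) then coeff I f else 0
  have hc : ∀ i, X i ∣ c i := by
    intro i
    rw [X_dvd_iff]
    intro I hI
    refine if_neg fun h => ?_
    exact (Finsupp.mem_support_iff.mp (Finset.mem_of_min h)) hI
  choose g hg using hc
  have hfg : f = ∑ i, X i * g i := by
    simp only [← hg]
    ext I
    rw [map_sum]
    change _ = ∑ i : Fin n, if I.support.min = (i : WithTop (Fin n)) then coeff I f else 0
    by_cases hI : I = 0
    · subst hI
      rw [coeff_zero_eq_constantCoeff_apply, hf]
      simp
    · obtain ⟨i, hi⟩ := Finset.min_of_nonempty (Finsupp.support_nonempty_iff.mpr hI)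
      rw [hi, Finset.sum_eq_single i]
      · simp
      · intro j _ hj
        exact if_neg fun h => hj (by simpa using h.symm)
      · simp
  refine ⟨g, hfg, fun i => ?_⟩
  rw [hfg, map_sum, Finset.sum_eq_single i]
  · rw [coeff_single_one_mul, coeff_index_single_self_X]
    simp
  · intro j _ hj
    rw [coeff_single_one_mul, coeff_index_single_X, if_neg (Ne.symm hj)]
    simp
  · simp

/-- The series without constant and linear terms form an ideal. -/
theorem coeff_eq_zero_of_mem_span {S : Set (MvPowerSeries (Fin n) K)}
    (hS : ∀ f ∈ S, constantCoeff f = 0 ∧ ∀ j, coeff (Finsupp.single j 1) f = 0)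
    {f : MvPowerSeries (Fin n) K} (hf : f ∈ Ideal.span S) :
    constantCoeff f = 0 ∧ ∀ j, coeff (Finsupp.single j 1) f = 0 := by
  induction hf using Submodule.span_induction with
  | mem f hf => exact hS f hf
  | zero => simp
  | add f g _ _ hf hg => exact ⟨by simp [hf.1, hg.1], fun j => by simp [hf.2 j, hg.2 j]⟩
  | smul r f _ hf =>
    exact ⟨by simp [hf.1], fun j => by rw [smul_eq_mul, coeff_single_one_mul, hf.1, hf.2]; simp⟩

/-- The chain rule for linear parts, well defined modulo I because I has no constant or linear
terms. Writing g as g(0) + ∑ Xᵢ γᵢ avoids any continuity of χ. -/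
theorem coeff_single_lift {N : ℕ} {I : Ideal (MvPowerSeries (Fin n) K)}
    (hI : ∀ f ∈ I, constantCoeff f = 0 ∧ ∀ j, coeff (Finsupp.single j 1) f = 0)
    (χ : MvPowerSeries (Fin N) K →ₐ[K] MvPowerSeries (Fin n) K ⧸ I)
    {a : Fin N → MvPowerSeries (Fin n) K} (ha : ∀ i, Ideal.Quotient.mk I (a i) = χ (X i))
    {f : MvPowerSeries (Fin n) K} {g : MvPowerSeries (Fin N) K}
    (hfg : Ideal.Quotient.mk I f = χ g) :
    constantCoeff f = constantCoeff g ∧ ∀ j, coeff (Finsupp.single j 1) f =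
      ∑ i, coeff (Finsupp.single i 1) g * coeff (Finsupp.single j 1) (a i) := by
  have hχC : ∀ c, χ (C c) = Ideal.Quotient.mk I (C c) := fun c => χ.commutes c
  have h0 : ∀ (f : MvPowerSeries (Fin n) K) (g : MvPowerSeries (Fin N) K),
      Ideal.Quotient.mk I f = χ g → constantCoeff f = constantCoeff g := by
    intro f g hfg
    let τ := Ideal.Quotient.lift I constantCoeff fun f hf => (hI f hf).1
    have h := ringHom_apply_eq_constantCoeff (τ.comp χ.toRingHom) (fun c => by
      change τ (χ (C c)) = c
      rw [hχC, Ideal.Quotient.lift_mk, constantCoeff_C]) g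
    rw [← h]
    change _ = τ (χ g)
    rw [← hfg, Ideal.Quotient.lift_mk]
  refine ⟨h0 f g hfg, fun j => ?_⟩
  obtain ⟨γ, hγ, hγ'⟩ := exists_eq_sum_X_mul (g - C (constantCoeff g)) (by simp)
  choose h hh using fun i => Ideal.Quotient.mk_surjective (I := I) (χ (γ i))
  have hmem : f - (C (constantCoeff g) + ∑ i, a i * h i) ∈ I := by
    rw [← Ideal.Quotient.eq, hfg, map_add, map_sum]
    conv_lhs => rw [← add_sub_cancel (C (constantCoeff g)) g, hγ, map_add, map_sum, hχC]
    simp only [map_mul, ha, hh]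
  have h1 := (hI _ hmem).2 j
  have hC : ∀ (k : ℕ) (i : Fin k) (c : K), coeff (Finsupp.single i 1) (C c) = 0 := by
    intro k i c
    rw [coeff_C, if_neg (by simp)]
  rw [map_sub, map_add, hC, zero_add, sub_eq_zero, map_sum] at h1
  rw [h1]
  refine Finset.sum_congr rfl fun i _ => ?_
  rw [coeff_single_one_mul, h0 _ _ (ha i), h0 _ _ (hh i), hγ', map_sub, hC]
  simp [mul_comm]

/-- The kernels of the powers of f stabilize, and an element of ker f is an f^k-image. -/
theorem injective_of_surjective_of_isNoetherianRing {R : Type*} [CommRing R] [IsNoetherianRing R]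
    (f : R →+* R) (hf : Function.Surjective f) : Function.Injective f := by
  have hmono : Monotone fun k => RingHom.ker (f ^ k) := by
    refine monotone_nat_of_le_succ fun k x hx => ?_
    rw [RingHom.mem_ker] at hx ⊢
    rw [pow_succ', RingHom.mul_def, RingHom.comp_apply, hx, map_zero]
  obtain ⟨k, hk⟩ := monotone_stabilizes_iff_noetherian.mpr ‹IsNoetherianRing R› ⟨_, hmono⟩
  refine (injective_iff_map_eq_zero f).mpr fun x hx => ?_
  have hs : Function.Surjective (f ^ k) := by
    rw [RingHom.coe_pow]
    exact hf.iterate k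
  obtain ⟨y, rfl⟩ := hs x
  have hy : y ∈ RingHom.ker (f ^ (k + 1)) := by
    rw [RingHom.mem_ker, pow_succ', RingHom.mul_def, RingHom.comp_apply, hx]
  have h := hk (k + 1) k.le_succ
  change RingHom.ker (f ^ k) = RingHom.ker (f ^ (k + 1)) at h
  rw [← h] at hy
  exact hy

/-- In a combination of the quadratic generators, each coefficient is replaced by its constant term;
the error has coefficients in the maximal ideal. -/
theorem exists_quadratic_part {S : Set (MvPolynomial (Fin n) K)}
    (hS : ∀ p ∈ S, p.IsHomogeneous 2) {g : MvPowerSeries (Fin n) K}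
    (hg : g ∈ Ideal.span ((fun p : MvPolynomial (Fin n) K => (p : MvPowerSeries (Fin n) K)) '' S)) :
    ∃ q : MvPolynomial (Fin n) K, q.IsHomogeneous 2 ∧
      (q : MvPowerSeries (Fin n) K) ∈
        Ideal.span ((fun p : MvPolynomial (Fin n) K => (p : MvPowerSeries (Fin n) K)) '' S) ∧
      g - q ∈ RingHom.ker (constantCoeff (σ := Fin n) (R := K)) *
        Ideal.span ((fun p : MvPolynomial (Fin n) K => (p : MvPowerSeries (Fin n) K)) '' S) := by
  induction hg using Submodule.span_induction with
  | mem f hf =>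
    obtain ⟨p, hp, rfl⟩ := hf
    exact ⟨p, hS p hp, Ideal.subset_span ⟨p, hp, rfl⟩, by simp⟩
  | zero => exact ⟨0, MvPolynomial.isHomogeneous_zero _ _ _, by simp, by simp⟩
  | add f g _ _ hf hg =>
    obtain ⟨p, hp, hp', hp''⟩ := hf
    obtain ⟨q, hq, hq', hq''⟩ := hg
    refine ⟨p + q, hp.add hq, ?_, ?_⟩
    · rw [MvPolynomial.coe_add]
      exact add_mem hp' hq'
    · rw [MvPolynomial.coe_add, add_sub_add_comm]
      exact add_mem hp'' hq''
  | smul r f _ hf =>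
    obtain ⟨p, hp, hp', hp''⟩ := hf
    have e : ((MvPolynomial.C (constantCoeff r) * p : MvPolynomial (Fin n) K) :
        MvPowerSeries (Fin n) K) = C (constantCoeff r) * (p : MvPowerSeries (Fin n) K) := by
      rw [MvPolynomial.coe_mul, MvPolynomial.coe_C]
    refine ⟨MvPolynomial.C (constantCoeff r) * p, ?_, ?_, ?_⟩
    · simpa using (MvPolynomial.isHomogeneous_C (Fin n) (constantCoeff r)).mul hp
    · rw [e]
      exact Ideal.mul_mem_left _ _ hp'
    · rw [e, smul_eq_mul, show r * f - C (constantCoeff r) * (p : MvPowerSeries (Fin n) K) =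
        r * (f - (p : MvPowerSeries (Fin n) K)) +
          (r - C (constantCoeff r)) * (p : MvPowerSeries (Fin n) K) by ring]
      refine add_mem (Ideal.mul_mem_left _ _ hp'') (Ideal.mul_mem_mul ?_ hp')
      rw [RingHom.mem_ker, map_sub, constantCoeff_C, sub_self]

theorem aeval_eq_apply_coe {N : ℕ} {R : Type*} [CommRing R] [Algebra K R]
    (α : MvPowerSeries (Fin N) K →ₐ[K] R) (p : MvPolynomial (Fin N) K) :
    α (p : MvPowerSeries (Fin N) K) = MvPolynomial.aeval (fun i => α (X i)) p := by
  have : α.comp (MvPolynomial.coeToMvPowerSeries.algHom K) =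
      MvPolynomial.aeval (fun i => α (X i)) :=
    MvPolynomial.algHom_ext fun i => by simp
  have h := AlgHom.congr_fun this p
  simpa using h

section Coordinates

variable {V : ℤ → Type v} [∀ i, AddCommGroup (V i)] [∀ i, Module K (V i)]

theorem constantCoeff_ser (e : Fin n → V 0) (l : Sym K V →ₗ[K] K) :
    constantCoeff (ser e l) = l 1 := by
  rw [← coeff_zero_eq_constantCoeff_apply, coeff_ser]
  simp

variable [CharZero K]

theorem coeff_single_ser (e : Fin n → V 0) (l : Sym K V →ₗ[K] K) (j : Fin n) :
    coeff (Finsupp.single j 1) (ser e l) = l (gen K V 0 (e j)) := by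
  have h := coeff_pderiv (R := K) (i := j) (ser e l) 0
  rw [pderiv_ser, coeff_zero_eq_constantCoeff_apply, constantCoeff_ser] at h
  simpa using h.symm

theorem ser_coord (e : Module.Basis (Fin n) K (V 0)) (i : Fin n) :
    ser e (e.coord i ∘ₗ DirectSum.component K ℤ V 0 ∘ₗ proj K V) = X i := by
  refine pderiv.ext (fun j => ?_) ?_
  · rw [pderiv_ser]
    have : (e.coord i ∘ₗ DirectSum.component K ℤ V 0 ∘ₗ proj K V) ∘ₗ
        LinearMap.mulLeft K (gen K V 0 (e j)) = (e.coord i (e j)) • counit K V := by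
      refine LinearMap.ext fun x => ?_
      simp only [LinearMap.comp_apply, LinearMap.mulLeft_apply, proj_gen_mul, map_smul,
        DirectSum.component.lof_self, LinearMap.smul_apply, smul_eq_mul]
      rw [mul_comm]
    rw [this, map_smul, ser_counit, pderiv_X, Module.Basis.coord_apply, Module.Basis.repr_self,
      Finsupp.single_apply]
    rcases eq_or_ne j i with rfl | h
    · simp
    · simp [h, Ne.symm h]
  · rw [constantCoeff_ser]
    simp [proj_one]

/-- Substitution of power series without constant term and with invertible linear part. -/
theorem exists_substitution_of_basis (hV : ∀ i, i ≠ 0 → Subsingleton (V i))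
    (e : Module.Basis (Fin n) K (V 0)) (a : Fin n → MvPowerSeries (Fin n) K)
    (ha : ∀ i, constantCoeff (a i) = 0)
    (hu : IsUnit (Matrix.of fun i j => coeff (Finsupp.single j 1) (a i))) :
    ∃ α : MvPowerSeries (Fin n) K →ₐ[K] MvPowerSeries (Fin n) K,
      Function.Surjective α ∧ ∀ i, α (X i) = a i := by
  -- The coordinates of φ in the basis e have the series a. The cofree extension is invertible, and
  -- its dual algebra map is the required substitution.
  let φ : Sym K V →ₗ[K] ⨁ i, V i :=
    ∑ i, (LinearMap.toSpanSingleton K _ (DirectSum.lof K ℤ V 0 (e i))) ∘ₗ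
      dualSer e (a i)
  have hφ : ∀ x, φ x = DirectSum.lof K ℤ V 0 (∑ i, dualSer e (a i) x • e i) := by
    intro x
    simp [φ, LinearMap.sum_apply]
  have hφ1 : φ 1 = 0 := by
    rw [hφ]
    have : ∀ i, dualSer e (a i) 1 = 0 := fun i => by
      rw [← constantCoeff_ser e, ser_dualSer, ha]
    simp [this]
  have hφd : IsDegreeZero φ := by
    intro d x hx
    rcases eq_or_ne d 0 with rfl | hd
    · exact ⟨_, (hφ x).symm⟩
    · refine ⟨0, ?_⟩
      rw [hφ]
      simp [dualSer_of_mem_degPart e _ hd hx]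
  have hF := isCoalgHom_cofree hφ1 hφd
  have hpF : ∀ x, proj K _ (cofree φ x) = φ x := LinearMap.congr_fun (proj_cofree hφ1)
  have hlin : ∀ i, Function.Bijective (linPart (cofree φ) i) := by
    intro i
    rcases eq_or_ne i 0 with rfl | hi
    · have : linPart (cofree φ) 0 =
          Matrix.toLin e e (Matrix.of fun i j => coeff (Finsupp.single j 1) (a i)) := by
        refine e.ext fun j => ?_
        change DirectSum.component K ℤ _ 0 (proj K _ (cofree φ (gen K _ 0 (e j)))) = _
        rw [hpF, hφ, DirectSum.component.lof_self, Matrix.toLin_self]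
        refine Finset.sum_congr rfl fun i _ => ?_
        rw [← coeff_single_ser, ser_dualSer]
        rfl
      rw [this]
      exact (Module.End.isUnit_iff _).mp (hu.map (Matrix.toLinAlgEquiv e))
    · have := hV i hi
      exact ⟨fun x y _ => Subsingleton.elim _ _, fun y => ⟨0, Subsingleton.elim _ _⟩⟩
  obtain ⟨G, hG, hFG, hGF⟩ := hF.exists_inverse hlin
  have hneg : ∀ i < 0, Subsingleton (V i) := fun i hi => hV i hi.ne
  refine ⟨pullback hneg e e hF, fun b => ⟨pullback hneg e e hG b,
    pullback_pullback hneg hneg e e hF hG hGF b⟩, fun i => ?_⟩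
  rw [← ser_coord e, pullback_ser]
  conv_rhs => rw [← ser_dualSer e (a i)]
  congr 1
  refine LinearMap.ext fun x => ?_
  simp only [LinearMap.comp_apply, hpF, hφ, DirectSum.component.lof_self]
  rw [map_sum, Finset.sum_eq_single i]
  · simp
  · intro j _ hj
    simp [hj]
  · simp

end Coordinates

variable [CharZero K]

/-- Substitution of power series without constant term and with invertible linear part. -/
theorem exists_substitution (a : Fin n → MvPowerSeries (Fin n) K)
    (ha : ∀ i, constantCoeff (a i) = 0)
    (hu : IsUnit (Matrix.of fun i j => coeff (Finsupp.single j 1) (a i))) :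
    ∃ α : MvPowerSeries (Fin n) K →ₐ[K] MvPowerSeries (Fin n) K,
      Function.Surjective α ∧ ∀ i, α (X i) = a i := by
  -- An auxiliary graded space, Kⁿ concentrated in degree 0.
  let V : ℤ → Submodule K (Fin n → K) := fun i => if i = 0 then ⊤ else ⊥
  have hV : ∀ i, i ≠ 0 → Subsingleton (V i) := fun i hi => by
    simp only [V, if_neg hi]
    infer_instance
  let e : Module.Basis (Fin n) K (V 0) :=
    (Pi.basisFun K (Fin n)).map (LinearEquiv.ofTop (V 0) (if_pos rfl)).symm
  exact exists_substitution_of_basis (V := fun i => V i) hV e a ha hu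

/-- If `K[[x]] / (κ₁, …, κₘ)` is quadratic, where the `κₖ` have no constant and linear terms, then
after a change of coordinates and an invertible linear transformation the `κₖ` become quadratic
polynomials. -/
theorem exists_quadratic_normal_form {m N : ℕ} {κ : Fin m → MvPowerSeries (Fin n) K}
    (hκ : ∀ k, constantCoeff (κ k) = 0 ∧ ∀ j, coeff (Finsupp.single j 1) (κ k) = 0)
    {S : Set (MvPolynomial (Fin N) K)} (hS : ∀ p ∈ S, p.IsHomogeneous 2)
    (ψ : (MvPowerSeries (Fin n) K ⧸ Ideal.span (Set.range κ)) ≃ₐ[K] MvPowerSeries (Fin N) K ⧸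
      Ideal.span ((fun p : MvPolynomial (Fin N) K => (p : MvPowerSeries (Fin N) K)) '' S)) :
    ∃ a : Fin n → MvPowerSeries (Fin n) K, (∀ i, constantCoeff (a i) = 0) ∧
      IsUnit (Matrix.of fun i j => coeff (Finsupp.single j 1) (a i)) ∧
      ∃ (q : Fin m → MvPolynomial (Fin n) K) (B : Fin m → Fin m → MvPowerSeries (Fin n) K),
        (∀ k, (q k).IsHomogeneous 2) ∧ (∀ k l, constantCoeff (B k l) = 0) ∧
        ∀ k, κ k = MvPolynomial.aeval a (q k) + ∑ l, B k l * κ l := by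
  set I := Ideal.span (Set.range κ) with hIdef
  set J := Ideal.span ((fun p : MvPolynomial (Fin N) K => (p : MvPowerSeries (Fin N) K)) '' S)
    with hJdef
  have hI : ∀ f ∈ I, constantCoeff f = 0 ∧ ∀ j, coeff (Finsupp.single j 1) f = 0 := by
    intro f hf
    refine coeff_eq_zero_of_mem_span ?_ hf
    rintro _ ⟨k, rfl⟩
    exact hκ k
  have hJ : ∀ f ∈ J, constantCoeff f = 0 ∧ ∀ j, coeff (Finsupp.single j 1) f = 0 := by
    intro f hf
    refine coeff_eq_zero_of_mem_span ?_ hf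
    rintro _ ⟨p, hp, rfl⟩
    refine ⟨?_, fun j => ?_⟩
    · rw [← coeff_zero_eq_constantCoeff_apply, MvPolynomial.coeff_coe]
      exact (hS p hp).coeff_eq_zero (by simp)
    · rw [MvPolynomial.coeff_coe]
      exact (hS p hp).coeff_eq_zero (by simp)
  let χ : MvPowerSeries (Fin N) K →ₐ[K] MvPowerSeries (Fin n) K ⧸ I :=
    ψ.symm.toAlgHom.comp (Ideal.Quotient.mkₐ K J)
  let χ' : MvPowerSeries (Fin n) K →ₐ[K] MvPowerSeries (Fin N) K ⧸ J :=
    ψ.toAlgHom.comp (Ideal.Quotient.mkₐ K I)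
  -- Lifts to power series of the images of the variables under the inverse of ψ and under ψ.
  choose a ha using fun i => Ideal.Quotient.mk_surjective (I := I) (χ (X i))
  choose c hc using fun i => Ideal.Quotient.mk_surjective (I := J) (χ' (X i))
  have hχ : ∀ g, χ g = ψ.symm (Ideal.Quotient.mk J g) := fun g => rfl
  have hχ' : ∀ g, χ' g = ψ (Ideal.Quotient.mk I g) := fun g => rfl
  have ha0 : ∀ i, constantCoeff (a i) = 0 := fun i => by
    rw [(coeff_single_lift hI χ ha (ha i)).1, constantCoeff_X]
  let L : Matrix (Fin N) (Fin n) K := Matrix.of fun i j => coeff (Finsupp.single j 1) (a i)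
  let L' : Matrix (Fin n) (Fin N) K := Matrix.of fun i j => coeff (Finsupp.single j 1) (c i)
  -- Neither ideal has constant or linear terms, so the linear parts of the lifts are mutually
  -- inverse. In particular N = n.
  have hLL' : L * L' = 1 := by
    ext i j
    have h := (coeff_single_lift hJ χ' hc (f := X i) (g := a i)
      (by rw [hχ', ha, hχ, ψ.apply_symm_apply])).2 j
    rw [coeff_index_single_X] at h
    rw [Matrix.mul_apply, Matrix.one_apply, if_congr eq_comm rfl rfl]
    exact h.symm
  have hL'L : L' * L = 1 := by
    ext i j
    have h := (coeff_single_lift hI χ ha (f := X i) (g := c i)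
      (by rw [hχ, hc, hχ', ψ.symm_apply_apply])).2 j
    rw [coeff_index_single_X] at h
    rw [Matrix.mul_apply, Matrix.one_apply, if_congr eq_comm rfl rfl]
    exact h.symm
  obtain rfl : N = n := by
    simpa using Matrix.square_of_invertible L L' hLL' hL'L
  have hu : IsUnit L := IsUnit.of_mul_eq_one L' hLL'
  obtain ⟨α, hα, hαX⟩ := exists_substitution a ha0 hu
  -- Agreement with χ is proved on polynomials only. This suffices for α(J) ⊆ I, because J has
  -- polynomial generators.
  have hαp : ∀ p : MvPolynomial (Fin N) K,
      Ideal.Quotient.mk I (α (p : MvPowerSeries (Fin N) K)) = χ (p : MvPowerSeries (Fin N) K) := by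
    intro p
    have h1 := aeval_eq_apply_coe ((Ideal.Quotient.mkₐ K I).comp α) p
    rw [aeval_eq_apply_coe χ]
    refine h1.trans ?_
    congr 2
    funext i
    rw [← ha, ← hαX]
    rfl
  have hαJ : J ≤ I.comap α := by
    refine Ideal.span_le.mpr ?_
    rintro _ ⟨p, hp, rfl⟩
    change α _ ∈ I
    have hpJ : (p : MvPowerSeries (Fin N) K) ∈ J := Ideal.subset_span ⟨p, hp, rfl⟩
    rw [← Ideal.Quotient.eq_zero_iff_mem, hαp, hχ, Ideal.Quotient.eq_zero_iff_mem.mpr hpJ, map_zero]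
  -- The map that α induces from the quotient by J to that by I, followed by ψ, is a surjective
  -- endomorphism of a Noetherian ring, hence injective.
  have hinj : ∀ g, α g ∈ I → g ∈ J := by
    intro g hg
    let β : (MvPowerSeries (Fin N) K ⧸ J) →+* MvPowerSeries (Fin N) K ⧸ J :=
      (ψ : _ →+* MvPowerSeries (Fin N) K ⧸ J).comp (Ideal.quotientMap I (α : _ →+* _) hαJ)
    have hβ : Function.Surjective β := by
      refine ψ.surjective.comp (Ideal.quotientMap_surjective hα)
    have h := injective_of_surjective_of_isNoetherianRing β hβ
    rw [← Ideal.Quotient.eq_zero_iff_mem]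
    refine h ?_
    change ψ (Ideal.Quotient.mk I (α g)) = β 0
    rw [Ideal.Quotient.eq_zero_iff_mem.mpr hg, map_zero, map_zero]
  have hαm : ∀ f, constantCoeff (α f) = constantCoeff f := fun f =>
    ringHom_apply_eq_constantCoeff (constantCoeff.comp α.toRingHom) (fun c => by
      change constantCoeff (α (C c)) = c
      rw [show α (C c) = C c from α.commutes c, constantCoeff_C]) f
  -- Write κₖ = α(g) with g in J and let q be the quadratic part of g. Then g - q lies in 𝔪J, so α
  -- maps it into 𝔪I, which makes the coefficients B vanish at the origin.
  have key : ∀ k, ∃ (q : MvPolynomial (Fin N) K) (B : Fin m → MvPowerSeries (Fin N) K),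
      q.IsHomogeneous 2 ∧ (∀ l, constantCoeff (B l) = 0) ∧
      κ k = MvPolynomial.aeval a q + ∑ l, B l * κ l := by
    intro k
    obtain ⟨g, hg⟩ := hα (κ k)
    have hgJ : g ∈ J := hinj g (by rw [hg]; exact Ideal.subset_span ⟨k, rfl⟩)
    obtain ⟨q, hq, -, hgq⟩ := exists_quadratic_part hS hgJ
    have h1 : α (g - q) ∈ RingHom.ker (constantCoeff (σ := Fin N) (R := K)) •
        Submodule.span (MvPowerSeries (Fin N) K) (Set.range κ) := by
      have h2 := Ideal.mem_map_of_mem α hgq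
      rw [Ideal.map_mul] at h2
      refine Ideal.mul_mono ?_ (Ideal.map_le_iff_le_comap.mpr hαJ) h2
      refine Ideal.map_le_iff_le_comap.mpr fun f hf => ?_
      rw [RingHom.mem_ker] at hf
      change constantCoeff (α f) = 0
      rw [hαm, hf]
    rw [Submodule.mem_ideal_smul_span_iff_exists_sum] at h1
    obtain ⟨B, hB, hBs⟩ := h1
    rw [Finsupp.sum_fintype _ _ (by simp)] at hBs
    refine ⟨q, B, hq, hB, ?_⟩
    have h3 := aeval_eq_apply_coe α q
    simp only [hαX] at h3
    simp only [smul_eq_mul] at hBs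
    rw [hBs, map_sub, hg, h3, add_sub_cancel]
  choose q B hq hB hqB using key
  exact ⟨a, ha0, hu, q, B, hq, hB, hqB⟩

end FormalCoordinates

/-! ### From a quadratic Kuranishi algebra to formality. -/

section Formality

variable {K : Type u} [Field K] {V : ℤ → Type v} [∀ i, AddCommGroup (V i)] [∀ i, Module K (V i)]
variable {n : ℕ}

theorem kuranishiIdeal_eq_span (A : Alg K V) (e : Module.Basis (Fin n) K (V 0)) {m : ℕ}
    (ε : Module.Basis (Fin m) K (V 1)) :
    kuranishiIdeal A e = Ideal.span (Set.range fun k => kuranishiSeries A e (ε.coord k)) := by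
  refine le_antisymm (Ideal.span_le.mpr ?_) (Ideal.span_mono ?_)
  · rintro _ ⟨η, rfl⟩
    have : kuranishiSeries A e η =
        ∑ k, MvPowerSeries.C (η (ε k)) * kuranishiSeries A e (ε.coord k) := by
      have hη : η = ∑ k, η (ε k) • ε.coord k := by
        refine ε.ext fun j => ?_
        rw [LinearMap.sum_apply, Finset.sum_eq_single j]
        · simp
        · intro k _ hk
          simp [hk.symm]
        · simp
      conv_lhs => rw [hη]
      simp only [kuranishiSeries_eq_ser, ← MvPowerSeries.smul_eq_C_mul, ← map_smul, ← map_sum]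
      congr 1
      refine LinearMap.ext fun x => ?_
      rw [LinearMap.sum_apply, LinearMap.comp_apply, LinearMap.sum_apply]
      rfl
    rw [this]
    exact Ideal.sum_mem _ fun k _ => Ideal.mul_mem_left _ _ (Ideal.subset_span ⟨k, rfl⟩)
  · rintro _ ⟨k, rfl⟩
    exact ⟨_, rfl⟩

/-- A product of l factors maps to a homogeneous polynomial of degree l, which pairs to zero with a
quadratic form unless l = 2. -/
theorem dualSer_eq_zero (e : Module.Basis (Fin n) K (V 0)) {q : MvPolynomial (Fin n) K}
    (hq : q.IsHomogeneous 2) {l : List (⨁ i, V i)} (hl : l.length ≠ 2) :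
    dualSer e q (l.map (ι K V)).prod = 0 := by
  rw [dualSer, LinearMap.comp_apply, AlgHom.toLinearMap_apply]
  have hp := toPoly_isHomogeneous e l
  generalize toPoly e (l.map (ι K V)).prod = p at hp
  rw [← MvPolynomial.support_sum_monomial_coeff p, map_sum]
  refine Finset.sum_eq_zero fun I hI => ?_
  have h1 : MvPolynomial.monomial I (MvPolynomial.coeff I p) =
      MvPolynomial.coeff I p • MvPolynomial.basisMonomials (Fin n) K I := by
    rw [MvPolynomial.coe_basisMonomials, MvPolynomial.smul_monomial, smul_eq_mul, mul_one]
  have h2 : I.degree = l.length := by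
    by_contra h
    exact MvPolynomial.mem_support_iff.mp hI (hp.coeff_eq_zero h)
  rw [h1, map_smul, Module.Basis.constr_basis, MvPolynomial.coeff_coe,
    hq.coeff_eq_zero (by rwa [h2]), mul_zero, smul_zero]

theorem Alg.isMinimal_of_taylor {B : Alg K V} (hB : ∀ l, l.length ≠ 2 → B.taylor l = 0) :
    B.IsMinimal :=
  LinearMap.ext fun x => by simpa [Alg.taylor, Alg.d] using hB [x] (by simp)

theorem isQuadraticAlgebra_of_taylor {B : Alg K V} (hB : ∀ l, l.length ≠ 2 → B.taylor l = 0)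
    (e : Module.Basis (Fin n) K (V 0)) :
    IsQuadraticAlgebra K (MvPowerSeries (Fin n) K ⧸ kuranishiIdeal B e) := by
  have hzero : ∀ (η : Module.Dual K (V 1)) (I : Fin n →₀ ℕ), I.degree ≠ 2 →
      MvPowerSeries.coeff I (kuranishiSeries B e η) = 0 := by
    intro η I hI
    change _ * η (DirectSum.component K ℤ V 1 (B.taylor _)) = 0
    rw [hB _ ?_, map_zero, map_zero, mul_zero]
    rw [List.length_flatMap]
    simp only [List.length_replicate]
    rwa [← Fin.sum_univ_def, ← Finsupp.degree_eq_sum]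
  let p : Module.Dual K (V 1) → MvPolynomial (Fin n) K := fun η =>
    -- Truncation at (2, …, 2) keeps every monomial of degree two, and the series has no others.
    MvPowerSeries.trunc' K (Finsupp.equivFunOnFinite.symm fun _ => 2) (kuranishiSeries B e η)
  have hp : ∀ η, (p η : MvPowerSeries (Fin n) K) = kuranishiSeries B e η := by
    intro η
    ext I
    rw [MvPolynomial.coeff_coe, MvPowerSeries.coeff_trunc']
    split_ifs with h
    · rfl
    · rw [hzero]
      intro hI
      refine h fun i => ?_
      simpa [hI] using Finsupp.le_degree i I
  refine ⟨n, Set.range p, ?_, ⟨?_⟩⟩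
  · rintro _ ⟨η, rfl⟩
    intro I hI
    by_contra h
    refine hI ?_
    rw [← MvPolynomial.coeff_coe, hp]
    refine hzero η I fun h' => h ?_
    rw [← h', Finsupp.degree_eq_weight_one]
    rfl
  · refine Ideal.quotientEquivAlgOfEq K ?_
    rw [← Set.range_comp]
    exact congrArg (fun s => Ideal.span (Set.range s)) (funext fun η => (hp η).symm)

theorem comul_gen_mul_gen (i j : ℤ) (v : V i) (w : V j) :
    comul K V (gen K V i v * gen K V j w) =
      (gen K V i v * gen K V j w) ⊗ₜ 1 + (i * j).negOnePow • (gen K V j w ⊗ₜ[K] gen K V i v) +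
        gen K V i v ⊗ₜ gen K V j w + 1 ⊗ₜ (gen K V i v * gen K V j w) := by
  have h : comul K V (gen K V j w) = gen K V j w ⊗ₜ 1 + 1 ⊗ₜ gen K V j w := comul_ι _
  rw [comul_gen_mul, h, map_add, comulAct_lof, comulAct_lof, sign_gen, map_one, mul_one,
    Units.smul_def, Units.smul_def, TensorProduct.smul_tmul']
  abel

theorem symMap_symm_comp {W : ℤ → Type w} [∀ i, AddCommGroup (W i)] [∀ i, Module K (W i)]
    (s : ∀ i, V i ≃ₗ[K] W i) :
    (symMap fun i => (s i).symm.toLinearMap).toLinearMap ∘ₗ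
      (symMap fun i => (s i).toLinearMap).toLinearMap = LinearMap.id := by
  refine LinearMap.ext fun x => ?_
  change symMap _ (symMap _ x) = x
  rw [symMap_comp]
  simp only [LinearEquiv.symm_comp, symMap_id]

theorem IsQuadraticAlgebra.congr {R S : Type*} [CommRing R] [Algebra K R] [CommRing S] [Algebra K S]
    (f : R ≃ₐ[K] S) (hS : IsQuadraticAlgebra K S) : IsQuadraticAlgebra K R := by
  obtain ⟨n, T, hT, ⟨g⟩⟩ := hS
  exact ⟨n, T, hT, ⟨f.trans g⟩⟩

variable [CharZero K]

/-- A minimal algebra with Taylor coefficients in degrees at most one and with quadratic Kuranishi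
algebra is isomorphic to one with only a quadratic Taylor coefficient. -/
theorem Alg.IsMinimal.exists_quadratic {A : Alg K V} (hA : A.IsMinimal)
    (hneg : ∀ i < 0, Subsingleton (V i))
    (htr : ∀ i, 2 ≤ i → ∀ x, DirectSum.component K ℤ V i (proj K V (A.Q x)) = 0)
    (e : Module.Basis (Fin n) K (V 0)) {m : ℕ} (ε : Module.Basis (Fin m) K (V 1))
    (hquad : IsQuadraticAlgebra K (MvPowerSeries (Fin n) K ⧸ kuranishiIdeal A e)) :
    ∃ (B : Alg K V) (F : Hom A B), F.IsWeakEquiv ∧ ∀ l, l.length ≠ 2 → B.taylor l = 0 := by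
  rw [kuranishiIdeal_eq_span A e ε] at hquad
  obtain ⟨N, S, hS, ⟨ψ⟩⟩ := hquad
  -- The Kuranishi series have no constant term since Q 1 = 0, and no linear term by minimality.
  obtain ⟨a, ha0, hu, q, b, hq, hb, hqb⟩ := exists_quadratic_normal_form (fun k => by
    rw [kuranishiSeries_eq_ser]
    refine ⟨?_, fun j => ?_⟩
    · rw [constantCoeff_ser]
      simp [A.Q_one]
    · rw [coeff_single_ser]
      have hd : proj K V (A.Q (gen K V 0 (e j))) = 0 :=
        LinearMap.congr_fun hA (DirectSum.lof K ℤ V 0 (e j))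
      simp [hd]) hS ψ
  -- The matrix 1 - B, which turns the Kuranishi series κ into q(a) and is the identity at the
  -- origin.
  let c : Fin m → Fin m → MvPowerSeries (Fin n) K := fun j k => (if j = k then 1 else 0) - b j k
  have hc : ∀ j, ∑ k, kuranishiSeries A e (ε.coord k) * c j k = MvPolynomial.aeval a (q j) := by
    intro j
    have h := hqb j
    rw [← sub_eq_iff_eq_add] at h
    rw [← h]
    simp only [c, mul_sub, Finset.sum_sub_distrib]
    congr 1
    · simp
    · exact Finset.sum_congr rfl fun k _ => mul_comm _ _
  have hc0 : ∀ j k, MvPowerSeries.constantCoeff (c j k) = if j = k then 1 else 0 := by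
    intro j k
    simp only [c, map_sub, hb, sub_zero]
    split_ifs <;> simp
  -- New coordinates: the series a on V⁰, the frame change 1 - B acting on the coefficients along
  -- V¹, and the old projection in degrees at least two.
  let f₀ : Sym K V →ₗ[K] V 0 := ∑ i, (LinearMap.toSpanSingleton K _ (e i)) ∘ₗ dualSer e (a i)
  let g : Fin m → Sym K V →ₗ[K] K := fun j => ∑ k, dualSer e (c j k) ∘ₗ contract (ε.coord k)
  let f₁ : Sym K V →ₗ[K] V 1 := ∑ j, (LinearMap.toSpanSingleton K _ (ε j)) ∘ₗ g j
  have hf₀ : ∀ x, f₀ x = ∑ i, dualSer e (a i) x • e i := fun x => by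
    simp [f₀, LinearMap.sum_apply]
  have hg : ∀ j x, g j x = ∑ k, dualSer e (c j k) (contract (ε.coord k) x) := fun j x => by
    simp [g, LinearMap.sum_apply]
  have hf₁ : ∀ x, f₁ x = ∑ j, g j x • ε j := fun x => by
    simp [f₁, LinearMap.sum_apply]
  let t : ∀ i, V i →ₗ[K] V i := fun i => if 2 ≤ i then LinearMap.id else 0
  let φ : Sym K V →ₗ[K] ⨁ i, V i :=
    DirectSum.lof K ℤ V 0 ∘ₗ f₀ + DirectSum.lof K ℤ V 1 ∘ₗ f₁ + DirectSum.lmap t ∘ₗ proj K V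
  have hφ : ∀ x, φ x = DirectSum.lof K ℤ V 0 (f₀ x) + DirectSum.lof K ℤ V 1 (f₁ x) +
    DirectSum.lmap t (proj K V x) := fun x => rfl
  have hf₀z : ∀ d, d ≠ 0 → ∀ x ∈ degPart K V d, f₀ x = 0 := by
    intro d hd x hx
    rw [hf₀]
    exact Finset.sum_eq_zero fun i _ => by rw [dualSer_of_mem_degPart e _ hd hx, zero_smul]
  have hf₁z : ∀ d, d ≠ 1 → ∀ x ∈ degPart K V d, f₁ x = 0 := by
    intro d hd x hx
    rw [hf₁]
    refine Finset.sum_eq_zero fun j _ => ?_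
    rw [hg, Finset.sum_eq_zero fun k _ => dualSer_of_mem_degPart e _ (sub_ne_zero.mpr hd)
      (contract_mem_degPart _ hx), zero_smul]
  have htz : ∀ d, d < 2 → ∀ x ∈ degPart K V d, DirectSum.lmap t (proj K V x) = 0 := by
    intro d hd x hx
    obtain ⟨w, hw⟩ := proj_mem_of_mem_degPart d x hx
    rw [← hw, DirectSum.lmap_lof]
    simp [t, not_le.mpr hd]
  have hφ0 : ∀ x ∈ degPart K V 0, φ x = DirectSum.lof K ℤ V 0 (f₀ x) := by
    intro x hx
    rw [hφ, hf₁z 0 (by decide) x hx, htz 0 (by decide) x hx, map_zero, add_zero, add_zero]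
  have hφ1 : ∀ x ∈ degPart K V 1, φ x = DirectSum.lof K ℤ V 1 (f₁ x) := by
    intro x hx
    rw [hφ, hf₀z 1 (by decide) x hx, htz 1 (by decide) x hx, map_zero, add_zero, zero_add]
  have hφ2 : ∀ d, 2 ≤ d → ∀ x ∈ degPart K V d, φ x = proj K V x := by
    intro d hd x hx
    rw [hφ, hf₀z d (by omega) x hx, hf₁z d (by omega) x hx, map_zero, map_zero, add_zero, zero_add]
    obtain ⟨w, hw⟩ := proj_mem_of_mem_degPart d x hx
    rw [← hw, DirectSum.lmap_lof]
    simp [t, hd]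
  have one_mem : (1 : Sym K V) ∈ degPart K V 0 := Submodule.subset_span ⟨[], by simp, by simp⟩
  have hφone : φ 1 = 0 := by
    have : ∀ i, dualSer e (a i) 1 = 0 := fun i => by
      rw [← constantCoeff_ser e, ser_dualSer, ha0]
    rw [hφ0 1 one_mem, hf₀]
    simp [this]
  have hφd : IsDegreeZero φ := by
    intro d x hx
    rcases (show d < 0 ∨ d = 0 ∨ d = 1 ∨ 2 ≤ d by omega) with hd | rfl | rfl | hd
    · rw [eq_zero_of_mem_degPart hneg hd hx, map_zero]
      exact Submodule.zero_mem _
    · exact ⟨_, (hφ0 x hx).symm⟩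
    · exact ⟨_, (hφ1 x hx).symm⟩
    · rw [hφ2 d hd x hx]
      exact proj_mem_of_mem_degPart d x hx
  obtain ⟨B, F, hF, -, hFs, hpF, hB⟩ := A.exists_transport hφone hφd (fun i => by
    rcases (show i < 0 ∨ i = 0 ∨ i = 1 ∨ 2 ≤ i by omega) with hi | rfl | rfl | hi
    · have := hneg i hi
      exact ⟨fun x y _ => Subsingleton.elim _ _, fun y => ⟨0, Subsingleton.elim _ _⟩⟩
    · have : DirectSum.component K ℤ V 0 ∘ₗ φ ∘ₗ gen K V 0 =
          Matrix.toLin e e (Matrix.of fun i j =>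
            MvPowerSeries.coeff (Finsupp.single j 1) (a i)) := by
        refine e.ext fun j => ?_
        rw [LinearMap.comp_apply, LinearMap.comp_apply, hφ0 _ (gen_mem_degPart 0 _),
          DirectSum.component.lof_self, hf₀, Matrix.toLin_self]
        refine Finset.sum_congr rfl fun i _ => ?_
        rw [← coeff_single_ser, ser_dualSer]
        rfl
      rw [this]
      exact (Module.End.isUnit_iff _).mp (hu.map (Matrix.toLinAlgEquiv e))
    · have : DirectSum.component K ℤ V 1 ∘ₗ φ ∘ₗ gen K V 1 = LinearMap.id := by
        refine LinearMap.ext fun v => ?_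
        rw [LinearMap.comp_apply, LinearMap.comp_apply, hφ1 _ (gen_mem_degPart 1 _),
          DirectSum.component.lof_self, hf₁, LinearMap.id_apply]
        conv_rhs => rw [← ε.sum_repr v]
        refine Finset.sum_congr rfl fun j _ => ?_
        have h1 : ∀ k, contract (ε.coord k) (gen K V 1 v) = ε.repr v k • 1 := fun k => by
          have := contract_gen_one_mul hneg (ε.coord k) v one_mem
          rwa [mul_one] at this
        have h2 : ∀ k, dualSer e (c j k) 1 = if j = k then 1 else 0 := fun k => by
          rw [← constantCoeff_ser e, ser_dualSer, hc0]
        simp only [hg, h1, map_smul, h2]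
        simp
      rw [this]
      exact Function.bijective_id
    · have : DirectSum.component K ℤ V i ∘ₗ φ ∘ₗ gen K V i = LinearMap.id := by
        refine LinearMap.ext fun v => ?_
        rw [LinearMap.comp_apply, LinearMap.comp_apply, hφ2 i hi _ (gen_mem_degPart i _),
          LInf.proj_gen, DirectSum.component.lof_self, LinearMap.id_apply]
      rw [this]
      exact Function.bijective_id)
  have hX : ∀ i, pullback hneg e e F.isCoalgHom (MvPowerSeries.X i) = a i := by
    intro i
    rw [← ser_coord e, pullback_ser]
    conv_rhs => rw [← ser_dualSer e (a i)]
    refine ser_congr e fun x hx => ?_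
    simp only [LinearMap.comp_apply, hpF, hφ0 x hx, DirectSum.component.lof_self, hf₀]
    rw [map_sum, Finset.sum_eq_single i]
    · simp
    · intro j _ hj
      simp [hj]
    · simp
  -- Contraction after Q multiplies by a Kuranishi series, so the left side has series ∑ₖ κₖ cⱼₖ =
  -- qⱼ(a), the pullback of qⱼ along F.
  have hgq : ∀ j, ∀ x ∈ degPart K V 0,
      g j (A.Q x) = dualSer e (q j : MvPowerSeries (Fin n) K) (F.F x) := by
    intro j x hx
    refine eq_of_ser_eq (l := g j ∘ₗ A.Q)
      (m := dualSer e (q j : MvPowerSeries (Fin n) K) ∘ₗ F.F) hneg e ?_ hx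
    have h1 : g j ∘ₗ A.Q = ∑ k, dualSer e (c j k) ∘ₗ contract (ε.coord k) ∘ₗ A.Q := by
      refine LinearMap.ext fun x => ?_
      rw [LinearMap.comp_apply, hg, LinearMap.sum_apply]
      rfl
    rw [← pullback_apply hneg e e F.isCoalgHom, aeval_eq_apply_coe, h1, map_sum]
    simp only [hX, A.ser_contract_Q hneg, ser_dualSer]
    exact hc j
  -- Only x of degree 0 contributes: for positive degree, Q x has degree at least two and p Q x
  -- vanishes by truncation.
  have hBQ : ∀ x, proj K V (B.Q (F.F x)) = DirectSum.lof K ℤ V 1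
      (∑ j, dualSer e (q j : MvPowerSeries (Fin n) K) (F.F x) • ε j) := by
    intro x
    rw [hB]
    induction x using hom_induction with
    | zero => simp
    | add x y hx hy =>
      simp only [map_add, hx, hy, add_smul, Finset.sum_add_distrib]
    | hom k d x hx =>
      have hx := homPart_le_degPart _ _ hx
      have hAx := A.degree_one d x hx
      rcases (show d < 0 ∨ d = 0 ∨ 1 ≤ d by omega) with hd | rfl | hd
      · rw [eq_zero_of_mem_degPart hneg hd hx]
        simp
      · rw [hφ1 _ hAx, hf₁]
        simp only [hgq _ x hx]
      · rw [hφ2 (d + 1) (by omega) _ hAx, Finset.sum_eq_zero, map_zero]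
        · obtain ⟨w, hw⟩ := proj_mem_of_mem_degPart _ _ hAx
          have h := htr (d + 1) (by omega) x
          rw [← hw, DirectSum.component.lof_self] at h
          rw [← hw, h, map_zero]
        · intro j _
          rw [dualSer_of_mem_degPart e _ (by omega) (F.degree_zero d x hx), zero_smul]
  refine ⟨B, F, hF, fun l hl => ?_⟩
  obtain ⟨x, hx⟩ := hFs (l.map (ι K V)).prod
  rw [Alg.taylor, ← hx, hBQ, hx]
  simp [dualSer_eq_zero e (hq _) hl]

/-- Since Q kills both factors, the co-Leibniz rule makes Q(x ⊙ y) primitive, hence an element of V.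
-/
theorem Alg.Q_gen_mul_gen (A : Alg K V) {i j : ℤ} (x : A.cocycles i) (y : A.cocycles j) :
    A.Q (gen K V i x * gen K V j y) =
      ι K V (A.taylor [DirectSum.lof K ℤ V i x, DirectSum.lof K ℤ V j y]) := by
  have hx : A.Q (gen K V i x) = 0 := by
    have h : A.d (DirectSum.lof K ℤ V i x) = 0 := x.2
    rw [gen, LinearMap.comp_apply, A.Q_ι, h, map_zero]
  have hy : A.Q (gen K V j y) = 0 := by
    have h : A.d (DirectSum.lof K ℤ V j y) = 0 := y.2
    rw [gen, LinearMap.comp_apply, A.Q_ι, h, map_zero]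
  rw [eq_ι_of_primitive (A.Q (gen K V i x * gen K V j y)) ?_]
  · simp [Alg.taylor, gen]
  · have h := LinearMap.congr_fun A.coderivation (gen K V i x * gen K V j y)
    rw [LinearMap.comp_apply, LinearMap.comp_apply, comul_gen_mul_gen] at h
    rw [h]
    simp only [Units.smul_def, LinearMap.add_apply, map_add, map_zsmul, TensorProduct.map_tmul, hx,
      hy, A.Q_one, LinearMap.id_apply, AlgHom.toLinearMap_apply, map_one, TensorProduct.zero_tmul,
      TensorProduct.tmul_zero, smul_zero, add_zero, zero_add]

variable {W : ℤ → Type w} [∀ i, AddCommGroup (W i)] [∀ i, Module K (W i)]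

/-- The difference F(x ⊙ y) - f₁x ⊙ f₁y is primitive, so the codifferential of the minimal target
kills it. The usual homotopy term therefore disappears on cocycles. -/
theorem Hom.taylor_f₁ {A : Alg K V} {B : Alg K W} (hB : B.IsMinimal) (F : Hom A B) {i j : ℤ}
    (x : A.cocycles i) (y : A.cocycles j) :
    B.taylor [F.f₁ (DirectSum.lof K ℤ V i x), F.f₁ (DirectSum.lof K ℤ V j y)] =
      F.f₁ (A.taylor [DirectSum.lof K ℤ V i x, DirectSum.lof K ℤ V j y]) := by
  have hF : ∀ k v, F.F (gen K V k v) = gen K W k (F.f₁Deg k v) := fun k v => by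
    rw [gen, LinearMap.comp_apply, F.F_ι, F.f₁_lof]
    rfl
  have h1 : F.F (gen K V i x * gen K V j y) -
      gen K W i (F.f₁Deg i x) * gen K W j (F.f₁Deg j y) = ι K W (proj K W
        (F.F (gen K V i x * gen K V j y) -
          gen K W i (F.f₁Deg i x) * gen K W j (F.f₁Deg j y))) := by
    refine eq_ι_of_primitive _ ?_
    have h := LinearMap.congr_fun F.map_comul (gen K V i x * gen K V j y)
    rw [LinearMap.comp_apply, LinearMap.comp_apply, comul_gen_mul_gen] at h
    rw [map_sub, h, comul_gen_mul_gen]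
    simp only [map_add, TensorProduct.map_tmul, hF, F.map_unit, Units.smul_def, map_zsmul,
      TensorProduct.sub_tmul, TensorProduct.tmul_sub]
    abel
  have h2 : B.Q (F.F (gen K V i x * gen K V j y)) =
      B.Q (gen K W i (F.f₁Deg i x) * gen K W j (F.f₁Deg j y)) := by
    rw [← sub_eq_zero, ← map_sub, h1, B.Q_ι, hB, LinearMap.zero_apply, map_zero]
  have h3 := LinearMap.congr_fun F.map_Q (gen K V i x * gen K V j y)
  rw [LinearMap.comp_apply, LinearMap.comp_apply, A.Q_gen_mul_gen, F.F_ι, h2] at h3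
  have h4 := congrArg (proj K W) h3
  rw [LInf.proj_ι] at h4
  rw [h4, F.f₁_lof, F.f₁_lof]
  simp [Alg.taylor, gen]

/-- When f₁ sends cocycles to their classes, compatibility of f₁ with the quadratic coefficients is
exactly the bracket formula; q₂(x, y) is a cocycle by Q² = 0. -/
theorem Alg.isCohomologyBracket_of_f₁ {A : Alg K V} {B : Alg K A.H}
    (hB : ∀ l, l.length ≠ 2 → B.taylor l = 0) (F : Hom A B)
    (hF : ∀ i (x : A.cocycles i), F.f₁Deg i x = A.cls i x) : A.IsCohomologyBracket B := by
  refine ⟨hB, fun i j x y => ?_⟩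
  have hmem : gen K V i (x : V i) * gen K V j (y : V j) ∈ degPart K V (i + j) :=
    Submodule.subset_span ⟨[⟨i, x⟩, ⟨j, y⟩], by simp, by simp⟩
  obtain ⟨z, hz⟩ := proj_mem_of_mem_degPart _ _ (A.degree_one _ _ hmem)
  rw [A.Q_gen_mul_gen, LInf.proj_ι] at hz
  have hz0 : z ∈ A.cocycles (i + j + 1) := by
    change A.d (DirectSum.lof K ℤ V _ z) = 0
    have h := LinearMap.congr_fun A.square_zero (gen K V i (x : V i) * gen K V j (y : V j))
    rw [LinearMap.comp_apply, A.Q_gen_mul_gen, A.Q_ι, ← hz] at h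
    have h' := congrArg (proj K V) h
    rwa [LInf.proj_ι, LinearMap.zero_apply, map_zero] at h'
  refine ⟨⟨z, hz0⟩, hz, ?_⟩
  have h := F.taylor_f₁ (Alg.isMinimal_of_taylor hB) x y
  rw [← hz, F.f₁_lof, F.f₁_lof, F.f₁_lof, hF, hF] at h
  rw [h]
  congr 1
  exact hF _ ⟨z, hz0⟩

/-- An algebra with a weak equivalence to one with only a quadratic Taylor coefficient is
formal. -/
theorem Alg.isFormal_of_taylor {A : Alg K V} {B : Alg K W}
    (hB : ∀ l, l.length ≠ 2 → B.taylor l = 0) (F : Hom A B) (hF : F.IsWeakEquiv) : A.IsFormal := by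
  have hmin := Alg.isMinimal_of_taylor hB
  -- The target is identified with the cohomology through the inverse of F on cohomology, so that w
  -- ∘ f₁ sends a cocycle to its own class.
  let w : ∀ i, W i ≃ₗ[K] A.H i := fun i =>
    (LinearEquiv.ofBijective (hmin.toH i) (hmin.toH_bijective i)).trans
      (LinearEquiv.ofBijective (F.mapH i) (hF i)).symm
  have hw : ∀ i (x : A.cocycles i), w i (F.f₁Deg i x) = A.cls i x := by
    intro i x
    change (LinearEquiv.ofBijective (F.mapH i) (hF i)).symm (hmin.toH i (F.f₁Deg i x)) = _
    rw [LinearEquiv.symm_apply_eq]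
    rfl
  have h1 := symMap_symm_comp w
  have h2 := symMap_symm_comp fun i => (w i).symm
  simp only [LinearEquiv.symm_symm] at h2
  have hS := isCoalgHom_symMap fun i => (w i).toLinearMap
  have hS' := isCoalgHom_symMap fun i => (w i).symm.toLinearMap
  have htaylor : ∀ l, l.length ≠ 2 → (B.transport hS hS' h2 h1).taylor l = 0 := by
    intro l hl
    change proj K _ (symMap _ (B.Q (symMap _ (l.map (ι K A.H)).prod))) = 0
    have h := hB (l.map (DirectSum.lmap fun i => (w i).symm.toLinearMap)) (by rwa [List.length_map])
    rw [Alg.taylor, List.map_map] at h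
    rw [proj_symMap, map_list_prod, List.map_map]
    have : (symMap fun i => (w i).symm.toLinearMap) ∘ ι K A.H =
        ι K W ∘ DirectSum.lmap fun i => (w i).symm.toLinearMap := funext fun x => symMap_ι _ x
    rw [this, h, map_zero]
  refine ⟨B.transport hS hS' h2 h1, A.isCohomologyBracket_of_f₁ htaylor
    ((B.toTransport hS hS' h2 h1).comp F) fun i x => ?_, (B.toTransport hS hS' h2 h1).comp F,
    (B.toTransport_isWeakEquiv hS hS' h2 h1).comp hF⟩
  rw [← hw, Hom.f₁Deg_comp]
  change DirectSum.component K ℤ A.H i (proj K A.H (symMap _ (gen K W i _))) = _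
  rw [symMap_gen, LInf.proj_gen, DirectSum.component.lof_self]
  rfl

/-- The pieces of a minimal model are the cohomology spaces. -/
def MinimalModel.equivH {A : Alg K V} (M : MinimalModel A) (i : ℤ) : M.V i ≃ₗ[K] A.H i :=
  (LinearEquiv.ofBijective _ (M.isMinimal.toH_bijective i)).trans
    (LinearEquiv.ofBijective _ (M.isWeakEquiv i))

end Formality

end LInf

end

/-! ### The theorem. -/

theorem mainTheorem8 {K : Type*} [Field K] [CharZero K]
    {V : ℤ → Type*} [∀ i, AddCommGroup (V i)] [∀ i, Module K (V i)] (Q : LInf.Alg K V)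
    (hneg : ∀ i < 0, Subsingleton (Q.H i))
    [Module.Finite K (Q.H 0)] [Module.Finite K (Q.H 1)]
    {W : ℤ → Type*} [∀ i, AddCommGroup (W i)] [∀ i, Module K (W i)] (R : LInf.Alg K W)
    (hR : R.IsHomotopyAbelian) (f : LInf.Hom Q R)
    (hf : ∀ i, 2 ≤ i → Function.Injective (f.mapH i)) :
    Nonempty (LInf.MinimalModel Q) ∧
      ∀ M : LInf.MinimalModel Q, Q.IsFormal ↔ LInf.IsQuadraticAlgebra K M.KuranishiAlgebra := by
  obtain ⟨M₀, -⟩ := Q.exists_minimalModel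
  refine ⟨⟨M₀⟩, fun M => ?_⟩
  have hnegM : ∀ i < 0, Subsingleton (M.V i) := fun i hi =>
    have := hneg i hi
    (M.equivH i).toEquiv.subsingleton
  have : Module.Finite K (M.V 1) := Module.Finite.equiv (M.equivH 1).symm
  constructor
  · rintro ⟨B, hB, F, hF⟩
    have hmin := LInf.Alg.isMinimal_of_taylor hB.taylor_eq_zero
    -- The composite M ⇢ V ⇢ H is a weak equivalence of minimal algebras, hence an isomorphism.
    obtain ⟨ψ⟩ := (F.comp M.hom).nonempty_kuranishi_equiv hnegM hneg
      (LInf.Hom.f₁Deg_bijective M.isMinimal hmin (hF.comp M.isWeakEquiv))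
      (Module.finBasis K (M.V 0)) (Module.finBasis K (Q.H 0))
    exact (LInf.isQuadraticAlgebra_of_taylor hB.taylor_eq_zero _).congr ψ
  · intro hquad
    obtain ⟨U, _, _, E, hE⟩ := hR.exists_weakEquiv
    have htriv : (LInf.Alg.trivial K U).IsMinimal := by
      simp [LInf.Alg.IsMinimal, LInf.Alg.d, LInf.Alg.trivial]
    -- The composite M ⇢ V ⇢ W ⇢ U is injective on cohomology in these degrees, and both ends are
    -- minimal, so its linear part is injective there.
    have hinj : ∀ i, 2 ≤ i → Function.Injective (((E.comp f).comp M.hom).f₁Deg i) := by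
      intro i hi
      have h1 : Function.Injective (((E.comp f).comp M.hom).mapH i) := by
        rw [LInf.Hom.mapH_comp, LInf.Hom.mapH_comp]
        exact ((hE i).injective.comp (hf i hi)).comp (M.isWeakEquiv i).injective
      have h2 : Function.Injective
          (htriv.toH i ∘ ((E.comp f).comp M.hom).f₁Deg i) :=
        h1.comp (M.isMinimal.toH_bijective i).injective
      exact h2.of_comp
    obtain ⟨A, F, hF, hA, hAtr⟩ := M.isMinimal.exists_truncated _ hinj
    obtain ⟨G, hFG, hGF⟩ := F.exists_inverse (LInf.Hom.f₁Deg_bijective M.isMinimal hA hF)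
    -- The truncated algebra is isomorphic to M, so its Kuranishi algebra is still quadratic.
    obtain ⟨ψ⟩ := G.nonempty_kuranishi_equiv hnegM hnegM
      (LInf.Hom.f₁Deg_bijective hA M.isMinimal (LInf.Hom.isWeakEquiv_of_inverse (G := F) hFG hGF))
      (Module.finBasis K (M.V 0)) (Module.finBasis K (M.V 0))
    obtain ⟨B, F', hF', hB⟩ := hA.exists_quadratic hnegM hAtr (Module.finBasis K (M.V 0))
      (Module.finBasis K (M.V 1)) (hquad.congr ψ)
    obtain ⟨P, hP⟩ := M.exists_weakEquiv
    exact LInf.Alg.isFormal_of_taylor hB (F'.comp (F.comp P)) (hF'.comp (hF.comp hP))
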